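/- **Setting.** Let $\Omega\subset\mathbb R^3$ be a bounded domain with smooth boundary $\Gamma$ and outward unit normal $\nu$. Let $\lambda,\mu,\nu_p,\nu_u,B,\rho_s,\rho_f,C,\phi,\kappa,\omega$ be real with $\mu>0$, $3\lambda+2\mu>0$, $\nu_p\neq\frac12$, $\nu_u\notin\{\frac12,-1,\nu_p\}$ and $B,\rho_f,\phi,\kappa,\omega\neq0$. Put $\rho_a=C\phi\rho_f$, $\rho=(1-\phi)\rho_s+\phi\rho_f$, $$\alpha=\tfrac{3(\nu_u-\nu_p)}{B(1-2\nu_p)(1+\nu_u)},\quad R=\tfrac{2\phi^2\mu B^2(1-2\nu_p)(1+\nu_u)^2}{9(\nu_u-\nu_p)(1-2\nu_u)},\quad \beta=\tfrac{\omega\phi^2\rho_f\kappa}{i\phi^2+\omega\kappa(\rho_a+\phi\rho_f)},\quad q=\tfrac{\omega^2\phi^2\rho_f}{\beta R},\quad \gamma=-\tfrac{i\omega\rho_f(\alpha-\beta)}{\beta},$$ $$k_p=\omega\sqrt{\tfrac{\rho-\beta\rho_f}{\lambda+2\mu}},\qquad k_s=\omega\sqrt{\tfrac{\rho-\beta\rho_f}{\mu}},\qquad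 \epsilon=\tfrac{i\omega\gamma(\alpha-\beta)}{q(\lambda+2\mu)},$$ and let $k_1,k_2\in\mathbb C$ satisfy $k_1^2+k_2^2=q(1+\epsilon)+k_p^2$, $k_1^2k_2^2=qk_p^2$, $\operatorname{Im}k_i\ge0$ and $k_1^2\ne k_2^2$. With $\gamma_k(x,y)=\frac{e^{ik|x-y|}}{4\pi|x-y|}$, let $E=\begin{bmatrix}E_{11}&E_{12}\\E_{21}^\top&E_{22}\end{bmatrix}$, where $$E_{11}=\tfrac1\mu\gamma_{k_s}I+\tfrac{1}{(\rho-\beta\rho_f)\omega^2}\nabla_x\nabla_x^\top\Big[\gamma_{k_s}-\tfrac{k_p^2-k_2^2}{k_1^2-k_2^2}\gamma_{k_1}+\tfrac{k_p^2-k_1^2}{k_1^2-k_2^2}\gamma_{k_2}\Big],$$ $$E_{12}=\tfrac{i\omega\gamma}{(\lambda+2\mu)(k_1^2-k_2^2)}\nabla_x[\gamma_{k_1}-\gamma_{k_2}],\quad E_{21}=-\tfrac{\alpha-\beta}{(\lambda+2\mu)(k_1^2-k_2^2)}\nabla_x[\gamma_{k_1}-\gamma_{k_2}],$$ $$E_{22}=-\tfrac1{k_1^2-k_2^2}\big[(k_p^2-k_1^2)\gamma_{k_1}-(k_p^2-k_2^2)\gamma_{k_2}\big].$$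 Let $T(\partial,\nu)u=2\mu\partial_\nu u+\lambda\nu\nabla\cdot u+\mu\,\nu\times\operatorname{curl}u$ and $$\widetilde T(\partial,\nu)=\begin{bmatrix}T(\partial,\nu)&-\alpha\nu\\-\rho_f\omega^2\nu^\top&\partial_\nu\end{bmatrix},\qquad \widetilde T^*(\partial,\nu)=\begin{bmatrix}T(\partial,\nu)&-\frac{\rho_f\omega^2\alpha}{\beta}\nu\\-\beta\nu^\top&\partial_\nu\end{bmatrix}.$$ The hyper-singular operator is $$N(\varphi)(x)=\int_\Gamma\widetilde T(\partial_x,\nu_x)\big(\widetilde T^*(\partial_y,\nu_y)E(x,y)\big)^\top\varphi(y)\,ds_y,\qquad x\in\Gamma,$$ as a Hadamard finite part: the constant term, as $\varepsilon\to0^+$, of the integral over $\{y\in\Gamma:|x-y|\ge\varepsilon\}$ after removal of multiples of $\varepsilon^{-1}$ and $\log\varepsilon$. Its block $N_2$ maps a scalar density $p$ to the first three components of $N\big((0,p)^\top\big)$. Let $\nabla^S$ be the surface gradient, $(\partial^S_1,\partial^S_2,\partial^S_3)^\top=\nu\times\nabla^S$, and let $$M(\partial,\nu)=\begin{pmatrix}0&-\partial_3^S&\partial_2^S\\\partial_3^S&0&-\partial_1^S\\-\partial_2^S&\partial_1^S&0\end{pmatrix}$$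 be the Günter derivative; $Mp$ is a matrix field for a scalar $p$, and $Mv$ is a vector field for a vector field $v$. **Theorem.** For every $p\in C^1(\Gamma)$ and every $x\in\Gamma$ the finite part $N_2(p)(x)$ exists, and $$N_2=N_2^1+M(\partial,\nu)N_2^2M(\partial,\nu)+M(\partial,\nu)N_2^3,$$ that is, $N_2(p)(x)=N_2^1(p)(x)+M\big[N_2^2(Mp)\big](x)+M\big[N_2^3(p)\big](x)$, where $$\begin{aligned}N_2^1(p)(x)={}&\tfrac{\alpha-\beta}{k_1^2-k_2^2}\int_\Gamma\partial_{\nu_y}\big[k_1^2\gamma_{k_1}-k_2^2\gamma_{k_2}\big]\nu_x\,p(y)\,ds_y\\&+\beta\int_\Gamma\big[\nu_x\nabla_x^\top(\gamma_{k_s}-\gamma_{k_1})-\partial_{\nu_x}\gamma_{k_s}I\big]\nu_y\,p(y)\,ds_y\\&+\Big(\tfrac{i\omega\gamma\alpha\beta}{(k_1^2-k_2^2)(\lambda+2\mu)}-\tfrac{\beta(k_2^2-q)}{k_1^2-k_2^2}\Big)\int_\Gamma\nu_x\nabla_x^\top(\gamma_{k_1}-\gamma_{k_2})\nu_y\,p(y)\,ds_y\\&+\tfrac{\alpha}{k_1^2-k_2^2}\int_\Gamma\partial_{\nu_y}\big[(k_p^2-k_1^2)\gamma_{k_1}-(k_p^2-k_2^2)\gamma_{k_2}\big]\nu_x\,p(y)\,ds_y,\\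 N_2^2(W)(x)={}&\tfrac{2\mu(\alpha-\beta)}{(\lambda+2\mu)(k_1^2-k_2^2)}\int_\Gamma\big\{\nabla_y^\top[\gamma_{k_1}-\gamma_{k_2}]\,W(y)\big\}^\top ds_y\quad\text{for matrix fields }W,\\ N_2^3(p)(x)={}&-\beta\int_\Gamma\big[2\mu E_{11}-\gamma_{k_s}I\big]\nu_y\,p(y)\,ds_y-\tfrac{2\mu(\alpha-\beta)}{(\lambda+2\mu)(k_1^2-k_2^2)}\int_\Gamma\big[k_1^2\gamma_{k_1}-k_2^2\gamma_{k_2}\big]\nu_y\,p(y)\,ds_y.\end{aligned}$$ The kernels of $N_2^1,N_2^2,N_2^3$ are weakly singular: they are continuous for $x\neq y$ on $\Gamma$ and bounded by $\mathrm{const}/|x-y|$. The integrals $N_2^1(p)(x)$, $N_2^2(Mp)(x)$ and $N_2^3(p)(x)$ converge absolutely for every $x\in\Gamma$, and $N_2^2(Mp)$ and $N_2^3(p)$ are differentiable along $\Gamma$. -/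

import Mathlib

open Filter Topology MeasureTheory
open scoped Matrix ContDiff

noncomputable section

namespace Poroelastic

abbrev E3 := EuclideanSpace ℝ (Fin 3)

abbrev C3 := Fin 3 → ℂ

/-- Component index of `U = (u, p)`: three for the displacement, one for the pressure. -/
abbrev Idx := Fin 3 ⊕ Unit

/-! ### Smooth domains, outward normal -/

/-- `ψ` is a smooth local defining function of `Ω` at the boundary point `x`. -/
def IsLocalDefiningFunction (Ω : Set E3) (x : E3) (ψ : E3 → ℝ) : Prop :=
  ContDiff ℝ ∞ ψ ∧ gradient ψ x ≠ 0 ∧ ∀ᶠ y in 𝓝 x, (y ∈ Ω ↔ ψ y < 0)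

/-- A bounded domain of `ℝ³` with smooth boundary. -/
structure IsSmoothBoundedDomain (Ω : Set E3) : Prop where
  isOpen : IsOpen Ω
  isConnected : IsConnected Ω
  isBounded : Bornology.IsBounded Ω
  smooth_boundary : ∀ x ∈ frontier Ω, ∃ ψ, IsLocalDefiningFunction Ω x ψ

/-- `ν` is the outward unit normal field on the boundary of `Ω`. -/
def IsOutwardUnitNormal (Ω : Set E3) (ν : E3 → E3) : Prop :=
  ∀ x ∈ frontier Ω, ‖ν x‖ = 1 ∧
    ∃ ψ, IsLocalDefiningFunction Ω x ψ ∧ gradient ψ x = ‖gradient ψ x‖ • ν x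

/-! ### Material parameters -/

/-- The independent parameters: Lamé parameters, Poisson ratio, undrained Poisson ratio, Skempton
coefficient, solid and fluid density, the constant in `ρ_a = C φ ρ_f`, porosity, permeability,
frequency. -/
structure Params where
  lam : ℝ
  mu : ℝ
  nuP : ℝ
  nuU : ℝ
  B : ℝ
  rhoS : ℝ
  rhoF : ℝ
  C : ℝ
  phi : ℝ
  kappa : ℝ
  omega : ℝ

/-- The conditions under which the derived parameters are meaningful. -/
structure Params.Admissible (P : Params) : Prop where
  mu_pos : 0 < P.mu
  lame_pos : 0 < 3 * P.lam + 2 * P.mu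
  nuP_ne : 1 - 2 * P.nuP ≠ 0
  nuU_ne : 1 - 2 * P.nuU ≠ 0
  nuU_ne' : 1 + P.nuU ≠ 0
  nu_ne : P.nuU ≠ P.nuP
  B_ne : P.B ≠ 0
  rhoF_ne : P.rhoF ≠ 0
  phi_ne : P.phi ≠ 0
  kappa_ne : P.kappa ≠ 0
  omega_ne : P.omega ≠ 0

namespace Params

variable (P : Params)

/-- apparent mass density -/
def rhoA : ℝ := P.C * P.phi * P.rhoF

/-- bulk density -/
def rho : ℝ := (1 - P.phi) * P.rhoS + P.phi * P.rhoF

/-- compressibility -/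
def alpha : ℝ := 3 * (P.nuU - P.nuP) / (P.B * (1 - 2 * P.nuP) * (1 + P.nuU))

/-- constitutive coefficient -/
def R : ℝ :=
  2 * P.phi ^ 2 * P.mu * P.B ^ 2 * (1 - 2 * P.nuP) * (1 + P.nuU) ^ 2 /
    (9 * (P.nuU - P.nuP) * (1 - 2 * P.nuU))

def beta : ℂ :=
  (P.omega * P.phi ^ 2 * P.rhoF * P.kappa : ℂ) /
    (Complex.I * P.phi ^ 2 + P.omega * P.kappa * (P.rhoA + P.phi * P.rhoF))

def q : ℂ := P.omega ^ 2 * P.phi ^ 2 * P.rhoF / (P.beta * P.R)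

def gam : ℂ := -(Complex.I * P.omega * P.rhoF * (P.alpha - P.beta)) / P.beta

/-- compressional wave number -/
def kp : ℂ := P.omega * Complex.sqrt ((P.rho - P.beta * P.rhoF) / (P.lam + 2 * P.mu))

/-- shear wave number -/
def ks : ℂ := P.omega * Complex.sqrt ((P.rho - P.beta * P.rhoF) / P.mu)

def eps : ℂ :=
  Complex.I * P.omega * P.gam * (P.alpha - P.beta) / (P.q * (P.lam + 2 * P.mu))

/-- `k₁, k₂` are the wave numbers of the two compressional waves. -/
structure IsWaveNumbers (k₁ k₂ : ℂ) : Prop where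
  add : k₁ ^ 2 + k₂ ^ 2 = P.q * (1 + P.eps) + P.kp ^ 2
  mul : k₁ ^ 2 * k₂ ^ 2 = P.q * P.kp ^ 2
  im₁ : 0 ≤ k₁.im
  im₂ : 0 ≤ k₂.im

end Params

/-! ### Differential operators in `ℝ³` -/

/-- The `i`-th partial derivative. -/
def pd (i : Fin 3) (f : E3 → ℂ) (x : E3) : ℂ := fderiv ℝ f x (EuclideanSpace.single i 1)

def grad (f : E3 → ℂ) (x : E3) : C3 := fun i => pd i f x

/-- `∇∇ᵀ f` -/
def hess (f : E3 → ℂ) (x : E3) : Matrix (Fin 3) (Fin 3) ℂ := Matrix.of fun i j => pd i (pd j f) x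

def dvg (u : E3 → C3) (x : E3) : ℂ := ∑ i, pd i (fun z => u z i) x

def curl (u : E3 → C3) (x : E3) : C3 :=
  ![pd 1 (fun z => u z 2) x - pd 2 (fun z => u z 1) x,
    pd 2 (fun z => u z 0) x - pd 0 (fun z => u z 2) x,
    pd 0 (fun z => u z 1) x - pd 1 (fun z => u z 0) x]

/-- A real vector as a complex one. -/
def cvec (n : E3) : C3 := fun i => (n i : ℂ)

/-- `n · ∇ f` -/
def normalD (n : E3) (f : E3 → ℂ) (x : E3) : ℂ := cvec n ⬝ᵥ grad f x

/-- The traction operator `T(∂, n) u = 2μ ∂ₙ u + λ n (∇ · u) + μ n × curl u`. -/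
def traction (P : Params) (n : E3) (u : E3 → C3) (x : E3) : C3 :=
  (2 * P.mu : ℂ) • (fun i => normalD n (fun z => u z i) x) +
    (P.lam * dvg u x) • cvec n + (P.mu : ℂ) • crossProduct (cvec n) (curl u x)

/-- The boundary operator `T̃(∂, n)`. -/
def bdryOp (P : Params) (n : E3) (U : E3 → Idx → ℂ) (x : E3) : Idx → ℂ :=
  Sum.elim
    (traction P n (fun z i => U z (Sum.inl i)) x - (P.alpha * U x (Sum.inr ())) • cvec n)
    (fun _ => -(P.rhoF * P.omega ^ 2 * (cvec n ⬝ᵥ fun i => U x (Sum.inl i))) +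
      normalD n (fun z => U z (Sum.inr ())) x)

/-- The adjoint boundary operator `T̃*(∂, n)`. -/
def adjBdryOp (P : Params) (n : E3) (U : E3 → Idx → ℂ) (x : E3) : Idx → ℂ :=
  Sum.elim
    (traction P n (fun z i => U z (Sum.inl i)) x -
      (P.rhoF * P.omega ^ 2 * P.alpha / P.beta * U x (Sum.inr ())) • cvec n)
    (fun _ => -(P.beta * (cvec n ⬝ᵥ fun i => U x (Sum.inl i))) +
      normalD n (fun z => U z (Sum.inr ())) x)

/-- An operator on 4-component fields, applied to each column of a matrix field. -/
def colwise (T : (E3 → Idx → ℂ) → E3 → Idx → ℂ) (A : E3 → Matrix Idx Idx ℂ) (x : E3) :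
    Matrix Idx Idx ℂ :=
  Matrix.of fun i j => T (fun z k => A z k j) x i

/-! ### Fundamental solution -/

/-- The fundamental solution `γ_k` of the Helmholtz equation. -/
def helm (k : ℂ) (x y : E3) : ℂ :=
  Complex.exp (Complex.I * k * ‖x - y‖) / (4 * Real.pi * ‖x - y‖)

variable (P : Params) (k₁ k₂ : ℂ)

def E11 (x y : E3) : Matrix (Fin 3) (Fin 3) ℂ :=
  (1 / (P.mu : ℂ) * helm P.ks x y) • (1 : Matrix (Fin 3) (Fin 3) ℂ) +
    (1 / ((P.rho - P.beta * P.rhoF) * P.omega ^ 2)) •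
      hess (fun z => helm P.ks z y
        - (P.kp ^ 2 - k₂ ^ 2) / (k₁ ^ 2 - k₂ ^ 2) * helm k₁ z y
        + (P.kp ^ 2 - k₁ ^ 2) / (k₁ ^ 2 - k₂ ^ 2) * helm k₂ z y) x

def E12 (x y : E3) : C3 :=
  (Complex.I * P.omega * P.gam / ((P.lam + 2 * P.mu) * (k₁ ^ 2 - k₂ ^ 2))) •
    grad (fun z => helm k₁ z y - helm k₂ z y) x

def E21 (x y : E3) : C3 :=
  (-(P.alpha - P.beta) / ((P.lam + 2 * P.mu) * (k₁ ^ 2 - k₂ ^ 2))) •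
    grad (fun z => helm k₁ z y - helm k₂ z y) x

def E22 (x y : E3) : ℂ :=
  -(1 / (k₁ ^ 2 - k₂ ^ 2)) *
    ((P.kp ^ 2 - k₁ ^ 2) * helm k₁ x y - (P.kp ^ 2 - k₂ ^ 2) * helm k₂ x y)

/-- `E = [E₁₁, E₁₂; E₂₁ᵀ, E₂₂]` -/
def fundSol (x y : E3) : Matrix Idx Idx ℂ :=
  Matrix.fromBlocks (E11 P k₁ k₂ x y) (Matrix.replicateCol Unit (E12 P k₁ k₂ x y))
    (Matrix.replicateRow Unit (E21 P k₁ k₂ x y)) (Matrix.of fun _ _ => E22 P k₁ k₂ x y)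

/-! ### The hyper-singular operator -/

/-- `a` is the Hadamard finite part of `F ε` as `ε → 0⁺`: the constant term that remains after the
removal of multiples of `1/ε` and of `log ε`. -/
def HasFinitePart {V : Type*} [NormedAddCommGroup V] [NormedSpace ℝ V] (F : ℝ → V) (a : V) : Prop :=
  ∃ c d : V, Tendsto (fun ε : ℝ => F ε - (1 / ε) • c - Real.log ε • d) (𝓝[>] 0) (𝓝 a)

variable (Γ : Set E3) (ν : E3 → E3)

/-- The kernel `T̃(∂ₓ, νₓ) (T̃*(∂_y, ν_y) E(x, y))ᵀ` of the hyper-singular operator `N`. -/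
def hyperKernel (x y : E3) : Matrix Idx Idx ℂ :=
  colwise (bdryOp P (ν x))
    (fun z => (colwise (adjBdryOp P (ν y)) (fun w => fundSol P k₁ k₂ z w) y)ᵀ) x

/-- `N₂(p)(x) = a`, where `N₂` is the block of `N` that maps a pressure density to displacement
components: the upper components of `∫_Γ hyperKernel x y (0, p(y)) ds_y`, as a finite part. -/
def HasN2 (p : E3 → ℂ) (x : E3) (a : C3) : Prop :=
  let integrand : E3 → C3 := fun y i =>
    (hyperKernel P k₁ k₂ ν x y *ᵥ Sum.elim (0 : C3) (fun _ => p y)) (Sum.inl i)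
  (∀ ε > 0, IntegrableOn integrand (Γ \ Metric.ball x ε) μHE[2]) ∧
    HasFinitePart (fun ε => ∫ y in Γ \ Metric.ball x ε, integrand y ∂μHE[2]) a

/-! ### Günter derivative on the surface -/

/-- The surface gradient `∇ˢ f` of a function on `Γ`. -/
def surfGrad (f : E3 → ℂ) (x : E3) : C3 := fun i =>
  fderivWithin ℝ f Γ x (EuclideanSpace.single i 1 - (ν x i) • ν x)

/-- `ν × ∇ˢ f` -/
def surfCurl (f : E3 → ℂ) (x : E3) : C3 := crossProduct (cvec (ν x)) (surfGrad Γ ν f x)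

/-- `M(∂, ν) f` for a scalar function `f`, a matrix. -/
def gunterScalar (f : E3 → ℂ) (x : E3) : Matrix (Fin 3) (Fin 3) ℂ :=
  !![0, -surfCurl Γ ν f x 2, surfCurl Γ ν f x 1;
     surfCurl Γ ν f x 2, 0, -surfCurl Γ ν f x 0;
     -surfCurl Γ ν f x 1, surfCurl Γ ν f x 0, 0]

/-- `M(∂, ν) u` for a vector field `u`. -/
def gunter (u : E3 → C3) (x : E3) : C3 := fun i =>
  ∑ j, gunterScalar Γ ν (fun z => u z j) x i j

/-! ### The operators of the regularized expression -/

/-- The kernel `k` on `Γ × Γ` is weakly singular on the surface `Γ`. -/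
def IsWeaklySingularKernel (k : E3 → E3 → C3) : Prop :=
  ContinuousOn (fun z : E3 × E3 => k z.1 z.2) {z | z.1 ∈ Γ ∧ z.2 ∈ Γ ∧ z.1 ≠ z.2} ∧
    ∃ C : ℝ, ∀ x ∈ Γ, ∀ y ∈ Γ, x ≠ y → ‖k x y‖ ≤ C / ‖x - y‖

/-- Kernel of `N₂¹`. -/
def kerN21 (x y : E3) : C3 :=
  ((P.alpha - P.beta) / (k₁ ^ 2 - k₂ ^ 2) *
      normalD (ν y) (fun w => k₁ ^ 2 * helm k₁ x w - k₂ ^ 2 * helm k₂ x w) y) • cvec (ν x)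
  + P.beta •
      ((grad (fun z => helm P.ks z y - helm k₁ z y) x ⬝ᵥ cvec (ν y)) • cvec (ν x)
        - normalD (ν x) (fun z => helm P.ks z y) x • cvec (ν y))
  + ((Complex.I * P.omega * P.gam * P.alpha * P.beta /
          ((k₁ ^ 2 - k₂ ^ 2) * (P.lam + 2 * P.mu))
        - P.beta * (k₂ ^ 2 - P.q) / (k₁ ^ 2 - k₂ ^ 2)) *
      (grad (fun z => helm k₁ z y - helm k₂ z y) x ⬝ᵥ cvec (ν y))) • cvec (ν x)
  + (P.alpha / (k₁ ^ 2 - k₂ ^ 2) *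
      normalD (ν y) (fun w => (P.kp ^ 2 - k₁ ^ 2) * helm k₁ x w
        - (P.kp ^ 2 - k₂ ^ 2) * helm k₂ x w) y) • cvec (ν x)

/-- Kernel of `N₂²`. -/
def kerN22 (x y : E3) : C3 :=
  (2 * P.mu * (P.alpha - P.beta) / ((P.lam + 2 * P.mu) * (k₁ ^ 2 - k₂ ^ 2))) •
    grad (fun w => helm k₁ x w - helm k₂ x w) y

/-- Kernel of `N₂³`. -/
def kerN23 (x y : E3) : C3 :=
  -(P.beta • (((2 * P.mu : ℂ) • E11 P k₁ k₂ x y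
      - helm P.ks x y • (1 : Matrix (Fin 3) (Fin 3) ℂ)) *ᵥ cvec (ν y)))
  - (2 * P.mu * (P.alpha - P.beta) / ((P.lam + 2 * P.mu) * (k₁ ^ 2 - k₂ ^ 2)) *
      (k₁ ^ 2 * helm k₁ x y - k₂ ^ 2 * helm k₂ x y)) • cvec (ν y)

def N21 (p : E3 → ℂ) (x : E3) : C3 := ∫ y in Γ, p y • kerN21 P k₁ k₂ ν x y ∂μHE[2]

/-- `N₂²` acts on matrix fields: `W ↦ c ∫_Γ {∇_yᵀ[γ_{k₁} - γ_{k₂}] W(y)}ᵀ ds_y`. -/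
def N22 (W : E3 → Matrix (Fin 3) (Fin 3) ℂ) (x : E3) : C3 :=
  ∫ y in Γ, kerN22 P k₁ k₂ x y ᵥ* W y ∂μHE[2]

def N23 (p : E3 → ℂ) (x : E3) : C3 := ∫ y in Γ, p y • kerN23 P k₁ k₂ ν x y ∂μHE[2]

end Poroelastic

end

noncomputable section

namespace Poroelastic

/-! ### Partial derivatives -/

/-! Algebra away from the diagonal. The traction splits as T u = 2μ M u + (λ+2μ) ν div u − μ ν ×
curl u (`traction_eq`). In the block N₂ it acts on `adjDisp`, which consists of −β E₁₁ν_y and second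
derivatives of γ_{k₁} − γ_{k₂}. The terms that are gradients in x have no curl, and the Helmholtz
equation lowers the third derivatives in the divergence to first derivatives. Divergence, curl and
pressure thus contribute only first derivatives of the kernels γ_k. By k₁²k₂² = q k_p² and (ρ −
βρ_f)ω² = k_p²(λ+2μ) they add up to the kernel of N₂¹, and the rest is a Günter derivative of the
matrices `matN22` + `matN23` applied to ν_y (`hyperKernel_eq`). The kernel of N₂¹ is weakly singular
because ν·(x−y) = O(|x−y|²) on the surface.

Here `matN23` is the kernel of N₂³, and `matN22` is what the kernel of N₂²(M p) becomes after
integration by parts on Γ. The latter rests on the surface Stokes theorem ∫ ν × ∇f = 0, used for f =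
p ∂ᵢ(γ_{k₁} − γ_{k₂}). This f is bounded with derivative O(1/r), because the 1/r terms of the two
Helmholtz kernels cancel (`integral_cross_grad`, `N22_apply`). The same cancellation in `potZ` makes
every entry of both matrices O(1/r).

It remains to take M out of the integral. The entries are even functions of x − y with singularity
1/r, so a potential with C¹ density is differentiable along Γ and its tangential derivatives are
principal values (`hasFDerivWithinAt_potential`). In a graph chart the integration variable is
translated with the point of evaluation. The differentiated kernel then contains DF(v) − DF(v+w) =
O(|w|) and is integrable. It differs from the principal value integrand by the w-derivative of
H(F(0) − F(w))ρ(w). The integrals of that derivative over the truncated plane tend to zero, since H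
is even and the graph deviates from its tangent plane only quadratically. All truncated integrals
therefore converge as they stand, and the finite part is an ordinary limit with no ε⁻¹ or log ε
term.

The geometry behind this: the implicit function theorem gives graph charts compatible with the
outward normal (`exists_isChart`), and the area formula (`comap_eq_withDensity`) turns integrals for
the Hausdorff measure into plane integrals. -/

lemma pd_comp_sub_right (i : Fin 3) (f : E3 → ℂ) (x y : E3) :
    pd i (fun z => f (z - y)) x = pd i f (x - y) := by
  simp only [pd, fderiv_comp_sub]

lemma pd_comp_sub_left (i : Fin 3) (f : E3 → ℂ) (x y : E3) :
    pd i (fun w => f (x - w)) y = -pd i f (x - y) := by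
  have h : (fun w => f (x - w)) = fun w => (fun v => f (-v)) (w - x) := by
    funext w; simp
  have h2 : (fun v : E3 => f (-v)) = f ∘ (ContinuousLinearEquiv.neg ℝ : E3 ≃L[ℝ] E3) := by
    funext v; simp
  rw [h, pd_comp_sub_right i (fun v => f (-v)), pd, h2, ContinuousLinearEquiv.comp_right_fderiv]
  simp [pd]

lemma pd_comp_neg (i : Fin 3) (f : E3 → ℂ) (z : E3) :
    pd i (fun v => f (-v)) z = -pd i f (-z) := by
  simpa using pd_comp_sub_left i f 0 z

lemma pd_congr {f g : E3 → ℂ} {z : E3} (h : f =ᶠ[𝓝 z] g) (i : Fin 3) : pd i f z = pd i g z := by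
  simp only [pd, h.fderiv_eq]

lemma compl_zero_mem_nhds {z : E3} (hz : z ≠ 0) : ({0}ᶜ : Set E3) ∈ 𝓝 z :=
  isOpen_compl_singleton.mem_nhds hz

lemma pd_congr_off {f g : E3 → ℂ} (h : ∀ z ≠ 0, f z = g z) {z : E3} (hz : z ≠ 0) (i : Fin 3) :
    pd i f z = pd i g z :=
  pd_congr (Filter.eventually_of_mem (compl_zero_mem_nhds hz) fun w hw => h w hw) i

lemma pd_add {f g : E3 → ℂ} {z : E3} (hf : DifferentiableAt ℝ f z) (hg : DifferentiableAt ℝ g z)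
    (i : Fin 3) : pd i (fun w => f w + g w) z = pd i f z + pd i g z := by
  simp [pd, fderiv_fun_add hf hg]

lemma pd_sub {f g : E3 → ℂ} {z : E3} (hf : DifferentiableAt ℝ f z) (hg : DifferentiableAt ℝ g z)
    (i : Fin 3) : pd i (fun w => f w - g w) z = pd i f z - pd i g z := by
  simp [pd, fderiv_fun_sub hf hg]

lemma pd_mul {f g : E3 → ℂ} {z : E3} (hf : DifferentiableAt ℝ f z) (hg : DifferentiableAt ℝ g z)
    (i : Fin 3) : pd i (fun w => f w * g w) z = f z * pd i g z + pd i f z * g z := by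
  simp [pd, fderiv_fun_mul hf hg]; ring

lemma pd_const_mul {f : E3 → ℂ} {z : E3} (hf : DifferentiableAt ℝ f z) (c : ℂ) (i : Fin 3) :
    pd i (fun w => c * f w) z = c * pd i f z := by
  simp [pd, fderiv_const_mul hf c]

lemma fderiv_apply_eq_sum_pd (f : E3 → ℂ) (z v : E3) :
    fderiv ℝ f z v = ∑ i, (v i : ℂ) * pd i f z := by
  have hv : v = ∑ i, v i • EuclideanSpace.single i (1 : ℝ) := by
    ext j; simp [Fin.sum_univ_three]; fin_cases j <;> simp
  conv_lhs => rw [hv]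
  simp [pd, map_sum]

lemma norm_fderiv_le_sum_pd (f : E3 → ℂ) (z : E3) :
    ‖fderiv ℝ f z‖ ≤ ∑ i, ‖pd i f z‖ := by
  refine ContinuousLinearMap.opNorm_le_bound _ (by positivity) fun v => ?_
  rw [fderiv_apply_eq_sum_pd, Finset.sum_mul]
  refine (norm_sum_le _ _).trans (Finset.sum_le_sum fun i _ => ?_)
  rw [norm_mul, mul_comm]
  gcongr
  simpa using PiLp.norm_apply_le v i

lemma contDiffOn_pd {f : E3 → ℂ} (hf : ContDiffOn ℝ ∞ f {0}ᶜ) (i : Fin 3) :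
    ContDiffOn ℝ ∞ (pd i f) {0}ᶜ := by
  have h := hf.fderiv_of_isOpen isOpen_compl_singleton (m := ∞) (by simp)
  exact h.clm_apply contDiffOn_const

lemma pd_comm {f : E3 → ℂ} (hf : ContDiffOn ℝ ∞ f {0}ᶜ) {z : E3} (hz : z ≠ 0) (i j : Fin 3) :
    pd i (pd j f) z = pd j (pd i f) z := by
  have hc : ContDiffAt ℝ 2 f z :=
    (hf.contDiffAt (compl_zero_mem_nhds hz)).of_le (WithTop.coe_le_coe.2 le_top)
  have hsymm := hc.isSymmSndFDerivAt (by simp)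
  have hd : DifferentiableAt ℝ (fderiv ℝ f) z :=
    (hc.fderiv_right (m := 1) (by norm_num)).differentiableAt (by norm_num)
  have key : ∀ a b : Fin 3, pd a (pd b f) z =
      fderiv ℝ (fderiv ℝ f) z (EuclideanSpace.single a 1) (EuclideanSpace.single b 1) := by
    intro a b
    unfold pd
    rw [fderiv_clm_apply hd (differentiableAt_const _)]
    simp
  rw [key, key]
  exact hsymm _ _

/-! ### Functions with a point singularity of given order -/

/-- The bounds `|∂^j f| ≤ C r^{-(m+j)}`, `j ≤ n`, on bounded sets. -/
def SingBound : ℕ → ℕ → (E3 → ℂ) → Prop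
  | 0, m, f => ∀ R : ℝ, ∃ C : ℝ, ∀ z ≠ 0, ‖z‖ ≤ R → ‖f z‖ ≤ C / ‖z‖ ^ m
  | n + 1, m, f => (∀ R : ℝ, ∃ C : ℝ, ∀ z ≠ 0, ‖z‖ ≤ R → ‖f z‖ ≤ C / ‖z‖ ^ m) ∧
      ∀ i, SingBound n (m + 1) (pd i f)

/-- `f` is smooth off the origin with a singularity of order `m` at the origin. -/
def IsSing (m : ℕ) (f : E3 → ℂ) : Prop := ContDiffOn ℝ ∞ f {0}ᶜ ∧ ∀ n, SingBound n m f

lemma SingBound.zero {n m : ℕ} {f : E3 → ℂ} (h : SingBound n m f) : SingBound 0 m f := by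
  cases n with
  | zero => exact h
  | succ n => exact h.1

lemma SingBound.congr {n m : ℕ} {f g : E3 → ℂ} (h : SingBound n m f) (hfg : ∀ z ≠ 0, f z = g z) :
    SingBound n m g := by
  have base : ∀ {m : ℕ} {f g : E3 → ℂ}, SingBound 0 m f → (∀ z ≠ 0, f z = g z) →
      SingBound 0 m g := by
    intro m f g h hfg R
    obtain ⟨C, hC⟩ := h R
    exact ⟨C, fun z hz hR => hfg z hz ▸ hC z hz hR⟩
  induction n generalizing m f g with
  | zero => exact base h hfg
  | succ n ih => exact ⟨base h.1 hfg, fun i => ih (h.2 i) fun z hz => pd_congr_off hfg hz i⟩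

lemma SingBound.add {n m : ℕ} {f g : E3 → ℂ} (hf : SingBound n m f) (hg : SingBound n m g)
    (cf : ContDiffOn ℝ ∞ f {0}ᶜ) (cg : ContDiffOn ℝ ∞ g {0}ᶜ) :
    SingBound n m (fun z => f z + g z) := by
  have base : ∀ {m : ℕ} {f g : E3 → ℂ}, SingBound 0 m f → SingBound 0 m g →
      SingBound 0 m (fun z => f z + g z) := by
    intro m f g hf hg R
    obtain ⟨C, hC⟩ := hf R
    obtain ⟨C', hC'⟩ := hg R
    refine ⟨C + C', fun z hz hR => ?_⟩
    rw [add_div]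
    exact (norm_add_le _ _).trans (add_le_add (hC z hz hR) (hC' z hz hR))
  induction n generalizing m f g with
  | zero => exact base hf hg
  | succ n ih =>
    refine ⟨base hf.1 hg.1, fun i => ?_⟩
    refine (ih (hf.2 i) (hg.2 i) (contDiffOn_pd cf i) (contDiffOn_pd cg i)).congr fun z hz => ?_
    rw [pd_add ((cf.contDiffAt (compl_zero_mem_nhds hz)).differentiableAt (by simp))
      ((cg.contDiffAt (compl_zero_mem_nhds hz)).differentiableAt (by simp))]

lemma SingBound.mul {n a b : ℕ} {f g : E3 → ℂ} (hf : SingBound n a f) (hg : SingBound n b g)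
    (cf : ContDiffOn ℝ ∞ f {0}ᶜ) (cg : ContDiffOn ℝ ∞ g {0}ᶜ) :
    SingBound n (a + b) (fun z => f z * g z) := by
  -- In the Leibniz rule one factor stays undifferentiated; its bounds must be cut from `n + 1` to
  -- `n` derivatives to fit the induction hypothesis.
  have mono : ∀ {n m : ℕ} {f : E3 → ℂ}, SingBound (n + 1) m f → SingBound n m f := by
    intro n
    induction n with
    | zero => intro m f h; exact h.1
    | succ n ih => intro m f h; exact ⟨h.1, fun i => ih (h.2 i)⟩
  have base : ∀ {a b : ℕ} {f g : E3 → ℂ}, SingBound 0 a f → SingBound 0 b g →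
      SingBound 0 (a + b) (fun z => f z * g z) := by
    intro a b f g hf hg R
    obtain ⟨C, hC⟩ := hf R
    obtain ⟨C', hC'⟩ := hg R
    refine ⟨C * C', fun z hz hR => ?_⟩
    rw [pow_add, ← div_mul_div_comm, norm_mul]
    exact mul_le_mul (hC z hz hR) (hC' z hz hR) (norm_nonneg _)
      ((norm_nonneg _).trans (hC z hz hR))
  induction n generalizing a b f g with
  | zero => exact base hf hg
  | succ n ih =>
    refine ⟨base hf.1 hg.1, fun i => ?_⟩
    have h1 := ih (mono hf) (hg.2 i) cf (contDiffOn_pd cg i)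
    have h2 := ih (hf.2 i) (mono hg) (contDiffOn_pd cf i) cg
    rw [show a + 1 + b = a + (b + 1) by ring] at h2
    refine (h1.add h2 (cf.mul (contDiffOn_pd cg i)) ((contDiffOn_pd cf i).mul cg)).congr
      fun z hz => ?_
    rw [pd_mul ((cf.contDiffAt (compl_zero_mem_nhds hz)).differentiableAt (by simp))
      ((cg.contDiffAt (compl_zero_mem_nhds hz)).differentiableAt (by simp))]

lemma singBound_const (n : ℕ) (c : ℂ) : SingBound n 0 (fun _ => c) := by
  have h0 : ∀ n m : ℕ, SingBound n m (fun _ => 0) := by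
    intro n
    induction n with
    | zero => intro m R; exact ⟨0, by simp⟩
    | succ n ih =>
      intro m
      refine ⟨fun R => ⟨0, by simp⟩, fun i => ?_⟩
      convert ih (m + 1) using 1
      funext z; simp [pd]
  cases n with
  | zero => exact fun R => ⟨‖c‖, by simp⟩
  | succ n =>
    refine ⟨fun R => ⟨‖c‖, by simp⟩, fun i => ?_⟩
    convert h0 n 1 using 1
    funext z; simp [pd]

/-- The bounds are only required for |z| ≤ R, where 1 ≤ R/|z|; raising the order costs a factor R in
the constant. -/
lemma SingBound.succ_order {n m : ℕ} {f : E3 → ℂ} (h : SingBound n m f) : SingBound n (m + 1) f := by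
  have base : ∀ {m : ℕ} {f : E3 → ℂ}, SingBound 0 m f → SingBound 0 (m + 1) f := by
    intro m f h R
    obtain ⟨C, hC⟩ := h R
    refine ⟨C * R, fun z hz hR => (hC z hz hR).trans (le_of_sub_nonneg ?_)⟩
    have hz' : 0 < ‖z‖ := norm_pos_iff.2 hz
    have hC0 : 0 ≤ C / ‖z‖ ^ m := (norm_nonneg _).trans (hC z hz hR)
    have : C * R / ‖z‖ ^ (m + 1) - C / ‖z‖ ^ m = C / ‖z‖ ^ m * ((R - ‖z‖) / ‖z‖) := by
      rw [pow_succ]; field_simp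
    rw [this]
    exact mul_nonneg hC0 (div_nonneg (sub_nonneg.2 hR) hz'.le)
  induction n generalizing m f with
  | zero => exact base h
  | succ n ih => exact ⟨base h.1, fun i => ih (h.2 i)⟩

namespace IsSing

variable {m a b : ℕ} {f g : E3 → ℂ}

lemma differentiableAt (hf : IsSing m f) {z : E3} (hz : z ≠ 0) : DifferentiableAt ℝ f z :=
  (hf.1.contDiffAt (compl_zero_mem_nhds hz)).differentiableAt (by simp)

lemma bound (hf : IsSing m f) (R : ℝ) :
    ∃ C : ℝ, 0 ≤ C ∧ ∀ z ≠ 0, ‖z‖ ≤ R → ‖f z‖ ≤ C / ‖z‖ ^ m := by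
  obtain ⟨C, hC⟩ := hf.2 0 R
  refine ⟨max C 0, le_max_right _ _, fun z hz hR => (hC z hz hR).trans ?_⟩
  gcongr
  exact le_max_left _ _

lemma pd (hf : IsSing m f) (i : Fin 3) : IsSing (m + 1) (pd i f) :=
  ⟨contDiffOn_pd hf.1 i, fun n => (hf.2 (n + 1)).2 i⟩

lemma bound_fderiv (hf : IsSing m f) (R : ℝ) :
    ∃ C : ℝ, 0 ≤ C ∧ ∀ z ≠ 0, ‖z‖ ≤ R → ‖fderiv ℝ f z‖ ≤ C / ‖z‖ ^ (m + 1) := by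
  choose C hC0 hC using fun i => (hf.pd i).bound R
  refine ⟨∑ i, C i, Finset.sum_nonneg fun i _ => hC0 i, fun z hz hR => ?_⟩
  rw [Finset.sum_div]
  exact (norm_fderiv_le_sum_pd f z).trans (Finset.sum_le_sum fun i _ => hC i z hz hR)

lemma congr (hf : IsSing m f) (h : ∀ z ≠ 0, f z = g z) : IsSing m g :=
  ⟨hf.1.congr fun z hz => (h z hz).symm, fun n => (hf.2 n).congr h⟩

lemma add (hf : IsSing m f) (hg : IsSing m g) : IsSing m (fun z => f z + g z) :=
  ⟨hf.1.add hg.1, fun n => (hf.2 n).add (hg.2 n) hf.1 hg.1⟩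

lemma mul (hf : IsSing a f) (hg : IsSing b g) : IsSing (a + b) (fun z => f z * g z) :=
  ⟨hf.1.mul hg.1, fun n => (hf.2 n).mul (hg.2 n) hf.1 hg.1⟩

lemma const (c : ℂ) : IsSing 0 (fun _ => c) :=
  ⟨contDiffOn_const, fun n => singBound_const n c⟩

lemma const_mul (hf : IsSing m f) (c : ℂ) : IsSing m (fun z => c * f z) := by
  simpa using (const c).mul hf

lemma sub (hf : IsSing m f) (hg : IsSing m g) : IsSing m (fun z => f z - g z) :=
  (hf.add (hg.const_mul (-1))).congr fun z _ => by ring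

lemma succ (hf : IsSing m f) : IsSing (m + 1) f := ⟨hf.1, fun n => (hf.2 n).succ_order⟩

end IsSing

/-! ### Radial functions -/

/-- Differentiating |w|² in two ways determines the derivative of |w| away from the origin. -/
lemma hasFDerivAt_norm_apply {z : E3} (hz : z ≠ 0) :
    HasFDerivAt (fun w : E3 => ‖w‖) (‖z‖⁻¹ • innerSL ℝ z) z := by
  have h := ((contDiffAt_norm ℝ hz (n := 1)).differentiableAt (by norm_num)).hasFDerivAt
  have h1 : HasFDerivAt (fun w : E3 => ‖w‖ ^ 2) ((2 * ‖z‖) • fderiv ℝ (fun w : E3 => ‖w‖) z) z := by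
    have := h.pow 2
    simpa using this
  have h2 : HasFDerivAt (fun w : E3 => ‖w‖ ^ 2) (2 • innerSL ℝ z) z :=
    (hasStrictFDerivAt_norm_sq z).hasFDerivAt
  have h3 := h1.unique h2
  have hz' : ‖z‖ ≠ 0 := norm_ne_zero_iff.2 hz
  have : fderiv ℝ (fun w : E3 => ‖w‖) z = ‖z‖⁻¹ • innerSL ℝ z := by
    ext v
    have := congrArg (fun L => L v) h3
    simp at this ⊢
    field_simp
    linarith
  rw [← this]
  exact h

lemma pd_radial {φ : ℝ → ℂ} {φ' : ℂ} {z : E3} (hz : z ≠ 0) (h : HasDerivAt φ φ' ‖z‖) (i : Fin 3) :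
    pd i (fun w => φ ‖w‖) z = φ' * ((z i / ‖z‖ : ℝ) : ℂ) := by
  have h2 := h.hasFDerivAt.comp z (hasFDerivAt_norm_apply hz)
  rw [pd, show (fun w : E3 => φ ‖w‖) = φ ∘ fun w => ‖w‖ from rfl, h2.fderiv]
  simp [EuclideanSpace.inner_single_right]
  ring

lemma contDiffOn_radial {φ : ℝ → ℂ} (h : ContDiff ℝ ∞ φ) :
    ContDiffOn ℝ ∞ (fun z : E3 => φ ‖z‖) {0}ᶜ := fun z hz =>
  (h.contDiffAt.comp z (contDiffAt_norm ℝ hz)).contDiffWithinAt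

lemma contDiffOn_inv_norm : ContDiffOn ℝ ∞ (fun z : E3 => ((‖z‖⁻¹ : ℝ) : ℂ)) {0}ᶜ := fun z hz => by
  have h1 : ContDiffAt ℝ ∞ (fun z : E3 => ‖z‖⁻¹) z :=
    (contDiffAt_norm ℝ hz).inv (norm_ne_zero_iff.2 hz)
  exact (Complex.ofRealCLM.contDiff.contDiffAt.comp z h1).contDiffWithinAt

lemma contDiff_coord (i : Fin 3) : ContDiff ℝ ∞ (fun z : E3 => ((z i : ℝ) : ℂ)) :=
  (Complex.ofRealCLM.comp (EuclideanSpace.proj i : E3 →L[ℝ] ℝ)).contDiff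

lemma pd_coord (i j : Fin 3) (z : E3) :
    pd i (fun w : E3 => ((w j : ℝ) : ℂ)) z = if i = j then 1 else 0 := by
  have h : (fun w : E3 => ((w j : ℝ) : ℂ)) =
      (Complex.ofRealCLM.comp (EuclideanSpace.proj j : E3 →L[ℝ] ℝ)) := by
    funext w; simp
  rw [pd, h, ContinuousLinearMap.fderiv]
  simp [eq_comm]
  split_ifs <;> simp

lemma pd_inv_norm {z : E3} (hz : z ≠ 0) (i : Fin 3) :
    pd i (fun w : E3 => ((‖w‖⁻¹ : ℝ) : ℂ)) z
      = -((z i * ‖z‖⁻¹ : ℝ) : ℂ) * (((‖z‖⁻¹ : ℝ) : ℂ) * ((‖z‖⁻¹ : ℝ) : ℂ)) := by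
  have hz' : ‖z‖ ≠ 0 := norm_ne_zero_iff.2 hz
  have h : HasDerivAt (fun t : ℝ => ((t⁻¹ : ℝ) : ℂ)) ((-(‖z‖ ^ 2)⁻¹ : ℝ) : ℂ) ‖z‖ :=
    (hasDerivAt_inv hz').ofReal_comp
  rw [pd_radial (φ := fun t : ℝ => ((t⁻¹ : ℝ) : ℂ)) hz h]
  push_cast
  have : (‖z‖ : ℂ) ≠ 0 := by exact_mod_cast hz'
  field_simp

/-- With θ = z/|z|, the functions |z|⁻¹ and θ_j form a closed system under differentiation: ∂ᵢ|z|⁻¹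
= −θᵢ|z|⁻² and ∂ᵢθ_j = (δᵢⱼ − θᵢθ_j)|z|⁻¹. Hence the bounds for both are proved by one induction. -/
lemma singBound_inv_norm_and_direction (n : ℕ) :
    SingBound n 1 (fun z : E3 => ((‖z‖⁻¹ : ℝ) : ℂ)) ∧
    ∀ j : Fin 3, SingBound n 0 (fun z : E3 => ((z j * ‖z‖⁻¹ : ℝ) : ℂ)) := by
  have b1 : SingBound 0 1 (fun z : E3 => ((‖z‖⁻¹ : ℝ) : ℂ)) := fun R =>
    ⟨1, fun z hz _ => by simp⟩
  have b2 : ∀ j, SingBound 0 0 (fun z : E3 => ((z j * ‖z‖⁻¹ : ℝ) : ℂ)) := fun j R =>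
    ⟨1, fun z hz _ => by
      have := PiLp.norm_apply_le z j
      have hz' : 0 < ‖z‖ := norm_pos_iff.2 hz
      rw [Complex.norm_real, norm_mul, norm_inv, norm_norm]
      rw [pow_zero, div_one, ← div_eq_mul_inv, div_le_one hz']
      exact this⟩
  have c1 := contDiffOn_inv_norm
  have c2 : ∀ j : Fin 3, ContDiffOn ℝ ∞ (fun z : E3 => ((z j * ‖z‖⁻¹ : ℝ) : ℂ)) {0}ᶜ := fun j =>
    ((contDiff_coord j).contDiffOn.mul c1).congr fun z _ => by push_cast; rfl
  induction n with
  | zero => exact ⟨b1, b2⟩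
  | succ n ih =>
    refine ⟨⟨b1, fun i => ?_⟩, fun j => ⟨b2 j, fun i => ?_⟩⟩
    · have h := ((singBound_const n (-1)).mul (ih.2 i) contDiffOn_const (c2 i)).mul
        (ih.1.mul ih.1 c1 c1) (contDiffOn_const.mul (c2 i)) (c1.mul c1)
      refine h.congr fun z hz => ?_
      rw [pd_inv_norm hz]
      ring
    · have h1 := (singBound_const n (if i = j then 1 else 0)).mul ih.1 contDiffOn_const c1
      have h2 := ((singBound_const n (-1)).mul ((ih.2 j).mul (ih.2 i) (c2 j) (c2 i))
        contDiffOn_const ((c2 j).mul (c2 i))).mul ih.1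
        (contDiffOn_const.mul ((c2 j).mul (c2 i))) c1
      refine (h1.add h2 (contDiffOn_const.mul c1)
        ((contDiffOn_const.mul ((c2 j).mul (c2 i))).mul c1)).congr fun z hz => ?_
      have e : (fun z : E3 => ((z j * ‖z‖⁻¹ : ℝ) : ℂ)) =
        fun z : E3 => ((z j : ℝ) : ℂ) * ((‖z‖⁻¹ : ℝ) : ℂ) := by funext z; push_cast; rfl
      rw [e, pd_mul ((contDiff_coord j).differentiable (by simp) z)
        ((c1.contDiffAt (compl_zero_mem_nhds hz)).differentiableAt (by simp)), pd_coord,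
        pd_inv_norm hz]
      push_cast
      ring

lemma isSing_inv_norm : IsSing 1 (fun z : E3 => ((‖z‖⁻¹ : ℝ) : ℂ)) :=
  ⟨contDiffOn_inv_norm, fun n => (singBound_inv_norm_and_direction n).1⟩

lemma isSing_direction (j : Fin 3) : IsSing 0 (fun z : E3 => ((z j * ‖z‖⁻¹ : ℝ) : ℂ)) :=
  ⟨((contDiff_coord j).contDiffOn.mul contDiffOn_inv_norm).congr fun z _ => by push_cast; rfl,
    fun n => (singBound_inv_norm_and_direction n).2 j⟩

lemma pd_radial_eq {φ : ℝ → ℂ} (h : ContDiff ℝ ∞ φ) {z : E3} (hz : z ≠ 0) (i : Fin 3) :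
    pd i (fun w => φ ‖w‖) z = deriv φ ‖z‖ * ((z i * ‖z‖⁻¹ : ℝ) : ℂ) := by
  rw [pd_radial hz (h.differentiable (by simp) _).hasDerivAt, div_eq_mul_inv]

/-- The gradient is φ'(|z|) times the direction of z, so the induction has to run over all smooth φ
at once. -/
lemma isSing_radial {φ : ℝ → ℂ} (h : ContDiff ℝ ∞ φ) : IsSing 0 (fun z : E3 => φ ‖z‖) := by
  refine ⟨contDiffOn_radial h, fun n => ?_⟩
  induction n generalizing φ with
  | zero =>
    intro R
    obtain ⟨C, hC⟩ := (isCompact_Icc (a := (0 : ℝ)) (b := R)).exists_bound_of_continuousOn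
      h.continuous.continuousOn
    exact ⟨C, fun z _ hR => by simpa using hC ‖z‖ ⟨norm_nonneg _, hR⟩⟩
  | succ n ih =>
    have hd : ContDiff ℝ ∞ (deriv φ) := ((contDiff_succ_iff_deriv (n := ∞)).1 h).2.2
    refine ⟨(ih h).zero, fun i => SingBound.succ_order ?_⟩
    exact ((ih hd).mul ((isSing_direction i).2 n) (contDiffOn_radial hd)
      (isSing_direction i).1).congr fun z hz => (pd_radial_eq h hz i).symm

/-- One order better than `IsSing.pd` would give: the gradient of a smooth function of |z| stays
bounded, although it need not be continuous at the origin. -/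
lemma isSing_pd_radial {φ : ℝ → ℂ} (h : ContDiff ℝ ∞ φ) (i : Fin 3) :
    IsSing 0 (pd i fun z : E3 => φ ‖z‖) :=
  ((isSing_radial ((contDiff_succ_iff_deriv (n := ∞)).1 h).2.2).mul (isSing_direction i)).congr
    fun z hz => (pd_radial_eq h hz i).symm

/-! ### The Helmholtz kernel as a function of the difference -/

/-- `e^{ik|z|} / (4π|z|)` -/
def helmZ (k : ℂ) (z : E3) : ℂ := Complex.exp (Complex.I * k * ‖z‖) / (4 * Real.pi * ‖z‖)

lemma helm_eq (k : ℂ) (x y : E3) : helm k x y = helmZ k (x - y) := rfl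

lemma helmZ_neg (k : ℂ) (z : E3) : helmZ k (-z) = helmZ k z := by simp [helmZ]

/-- The quotient (e^{ikw} − 1)/w extends to an entire function. This is the regular part of the
Helmholtz kernel in `helmZ_eq`. -/
lemma contDiff_dslope_exp (k : ℂ) :
    ContDiff ℝ ∞ fun t : ℝ => dslope (fun w : ℂ => Complex.exp (Complex.I * k * w)) 0 (t : ℂ) := by
  have h : Differentiable ℂ (fun w : ℂ => Complex.exp (Complex.I * k * w)) := by fun_prop
  have h2 : Differentiable ℂ (dslope (fun w : ℂ => Complex.exp (Complex.I * k * w)) 0) := by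
    rw [← differentiableOn_univ] at h ⊢
    exact (Complex.differentiableOn_dslope univ_mem).2 h
  exact (h2.contDiff.restrict_scalars ℝ).comp Complex.ofRealCLM.contDiff

lemma helmZ_eq (k : ℂ) {z : E3} (hz : z ≠ 0) :
    helmZ k z = (1 / (4 * Real.pi)) * ((‖z‖⁻¹ : ℝ) +
      dslope (fun w : ℂ => Complex.exp (Complex.I * k * w)) 0 (‖z‖ : ℂ)) := by
  have hz' : (‖z‖ : ℂ) ≠ 0 := by exact_mod_cast norm_ne_zero_iff.2 hz
  rw [dslope_of_ne _ hz', slope_def_field, helmZ]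
  have : (Real.pi : ℂ) ≠ 0 := by exact_mod_cast Real.pi_ne_zero
  push_cast
  simp
  field_simp
  ring

lemma isSing_helmZ (k : ℂ) : IsSing 1 (helmZ k) :=
  ((isSing_inv_norm.add (isSing_radial (contDiff_dslope_exp k)).succ).const_mul
    (1 / (4 * Real.pi))).congr fun _ hz => (helmZ_eq k hz).symm

/-- The 1/|z| parts of the kernels do not depend on the wave number. They cancel when the
coefficients sum to zero, which leaves a smooth function of |z|. -/
lemma isSing_pd_combination (a b c : ℂ) (h : a + b + c = 0) (k l m : ℂ) (i : Fin 3) :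
    IsSing 0 (pd i fun z => a * helmZ k z + b * helmZ l z + c * helmZ m z) := by
  have hs := isSing_pd_radial (((contDiff_const (c := 1 / (4 * (Real.pi : ℂ)))).mul
    (((contDiff_const (c := a)).mul (contDiff_dslope_exp k)).add
    (((contDiff_const (c := b)).mul (contDiff_dslope_exp l)).add
    ((contDiff_const (c := c)).mul (contDiff_dslope_exp m)))))) i
  refine hs.congr fun z hz => pd_congr_off (fun w hw => ?_) hz i
  rw [helmZ_eq k hw, helmZ_eq l hw, helmZ_eq m hw]
  have hc : c = -a - b := by linear_combination h
  rw [hc]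
  ring

lemma isSing_pd_helmZ_sub (k l : ℂ) (i : Fin 3) :
    IsSing 0 (pd i fun z => helmZ k z - helmZ l z) := by
  have := isSing_pd_combination 1 (-1) 0 (by ring) k l 0 i
  convert this using 2
  funext z
  ring

/-- Helmholtz equation off the origin. -/
lemma laplacian_helmZ (k : ℂ) {z : E3} (hz : z ≠ 0) :
    ∑ i, pd i (pd i (helmZ k)) z = -k ^ 2 * helmZ k z := by
  -- `A` is φ'(t)/t for the radial profile φ(t) = e^{ikt}/(4πt), so the gradient is A(|z|) z and the
  -- Laplacian is 3A + |z|A'.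
  let A : ℝ → ℂ := fun t => (Complex.I * k * t - 1) * Complex.exp (Complex.I * k * t) /
    (4 * Real.pi * t ^ 3)
  have hpi : (Real.pi : ℂ) ≠ 0 := by exact_mod_cast Real.pi_ne_zero
  have e : ∀ t : ℝ, HasDerivAt (fun t : ℝ => Complex.exp (Complex.I * k * t))
      (Complex.exp (Complex.I * k * t) * (Complex.I * k)) t := fun t => by
    have h : HasDerivAt (fun w : ℂ => Complex.exp (Complex.I * k * w))
      (Complex.exp (Complex.I * k * t) * (Complex.I * k)) (t : ℂ) := by
      have := ((hasDerivAt_id (t : ℂ)).const_mul (Complex.I * k)).cexp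
      simpa using this
    exact h.comp_ofReal
  have idd : ∀ t : ℝ, HasDerivAt (fun t : ℝ => (t : ℂ)) 1 t := fun t =>
    Complex.ofRealCLM.hasDerivAt
  have h1 : ∀ w : E3, w ≠ 0 → ∀ i, pd i (helmZ k) w = A ‖w‖ * ((w i : ℝ) : ℂ) := by
    intro w hw i
    have hw' : (‖w‖ : ℂ) ≠ 0 := by exact_mod_cast norm_ne_zero_iff.2 hw
    have hd := (e ‖w‖).fun_div ((idd ‖w‖).const_mul (4 * (Real.pi : ℂ))) (by simp [hw', hpi])
    have := pd_radial (φ := fun t : ℝ => Complex.exp (Complex.I * k * t) / (4 * Real.pi * t)) hw hd i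
    refine Eq.trans this ?_
    simp only [A]
    push_cast
    field_simp
  have hz' : (‖z‖ : ℂ) ≠ 0 := by exact_mod_cast norm_ne_zero_iff.2 hz
  have hA := ((((idd ‖z‖).const_mul (Complex.I * k)).sub_const 1).fun_mul (e ‖z‖)).fun_div
    (((idd ‖z‖).fun_pow 3).const_mul (4 * (Real.pi : ℂ))) (by simp [hpi, hz])
  have hAz : ∀ i, pd i (fun w : E3 => A ‖w‖) z = _ := fun i => pd_radial (φ := A) hz hA i
  have hAd : DifferentiableAt ℝ (fun w : E3 => A ‖w‖) z :=
    DifferentiableAt.comp z (g := A) hA.differentiableAt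
      (hasFDerivAt_norm_apply hz).differentiableAt
  have h2 : ∀ i, pd i (pd i (helmZ k)) z =
      A ‖z‖ + pd i (fun w : E3 => A ‖w‖) z * ((z i : ℝ) : ℂ) := by
    intro i
    rw [pd_congr_off (fun w hw => h1 w hw i) hz,
      pd_mul hAd ((contDiff_coord i).differentiable (by simp) z), pd_coord]
    simp
  have hn : (‖z‖ : ℂ) ^ 2 = (z 0 : ℂ) ^ 2 + (z 1 : ℂ) ^ 2 + (z 2 : ℂ) ^ 2 := by
    have := EuclideanSpace.real_norm_sq_eq z
    rw [Fin.sum_univ_three] at this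
    exact_mod_cast this
  simp only [h2, hAz, Fin.sum_univ_three, A, helmZ]
  have hI : Complex.I ^ 2 = -1 := Complex.I_sq
  push_cast
  generalize ((‖z‖ : ℝ) : ℂ) = r at hn hz' ⊢
  generalize Complex.exp (Complex.I * k * r) = X
  field_simp
  -- `hn` replaces the sum of the squared coordinates by r²; what then remains is i² = −1.
  linear_combination (3 * X * r * Complex.I * k - 3 * X - X * r ^ 2 * Complex.I ^ 2 * k ^ 2) * hn +
    X * r ^ 4 * k ^ 2 * hI

/-- For c ≠ 0 the functions f and c f are differentiable together, and otherwise both derivatives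
have the default value zero. -/
lemma pd_const_mul' (f : E3 → ℂ) (z : E3) (c : ℂ) (i : Fin 3) :
    pd i (fun w => c * f w) z = c * pd i f z := by
  by_cases hc : c = 0
  · simp [hc, pd]
  by_cases hf : DifferentiableAt ℝ f z
  · exact pd_const_mul hf c i
  · have h2 : ¬ DifferentiableAt ℝ (fun w => c * f w) z := fun h => hf (by
      have := h.const_mul c⁻¹
      simpa [hc, ← mul_assoc] using this)
    simp [pd, fderiv_zero_of_not_differentiableAt hf, fderiv_zero_of_not_differentiableAt h2]

lemma pd_sum {ι : Type*} (s : Finset ι) {f : ι → E3 → ℂ} {z : E3}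
    (hf : ∀ j ∈ s, DifferentiableAt ℝ (f j) z) (i : Fin 3) :
    pd i (fun w => ∑ j ∈ s, f j w) z = ∑ j ∈ s, pd i (f j) z := by
  simp [pd, fderiv_fun_sum hf]

/-- The matrix of the map `v ↦ s × v`, up to the sign convention of the Günter derivative. -/
def crossMat (s : C3) : Matrix (Fin 3) (Fin 3) ℂ :=
  !![0, -s 2, s 1; s 2, 0, -s 0; -s 1, s 0, 0]

lemma gunterScalar_eq (Γ : Set E3) (ν : E3 → E3) (f : E3 → ℂ) (x : E3) :
    gunterScalar Γ ν f x = crossMat (surfCurl Γ ν f x) := rfl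

/-- The Günter derivative of a vector field with Jacobian `J j b = ∂_b u_j` and normal `n`. -/
def gunterJac (n : C3) (J : Fin 3 → C3) : C3 := fun l => ∑ j, crossMat (crossProduct n (J j)) l j

/-- This splitting isolates the Günter derivative, which will be pulled out of the surface integral;
the divergence and the curl that remain are of lower order for the fundamental solution. -/
lemma traction_eq (P : Params) (n : E3) (u : E3 → C3) (x : E3) (l : Fin 3) :
    traction P n u x l = 2 * P.mu * gunterJac (cvec n) (fun j b => pd b (fun z => u z j) x) l
      + (P.lam + 2 * P.mu) * cvec n l * ∑ i, pd i (fun z => u z i) x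
      - P.mu * crossProduct (cvec n) (curl u x) l := by
  simp only [traction, gunterJac, crossMat, normalD, dvg, curl, grad, Pi.add_apply, Pi.smul_apply,
    crossProduct, dotProduct, Fin.sum_univ_three, smul_eq_mul]
  fin_cases l <;> simp <;> ring

/-! ### The scalar potentials of the fundamental solution and the traces of their derivatives -/

variable (P : Params) (k₁ k₂ : ℂ)

/-- `γ_{k₁} - γ_{k₂}` -/
def diffZ (z : E3) : ℂ := helmZ k₁ z - helmZ k₂ z

/-- The potential whose Hessian enters `E₁₁`. -/
def potZ (z : E3) : ℂ :=
  helmZ P.ks z - (P.kp ^ 2 - k₂ ^ 2) / (k₁ ^ 2 - k₂ ^ 2) * helmZ k₁ z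
    + (P.kp ^ 2 - k₁ ^ 2) / (k₁ ^ 2 - k₂ ^ 2) * helmZ k₂ z

lemma grad_diff (x y : E3) (i : Fin 3) :
    grad (fun z => helm k₁ z y - helm k₂ z y) x i = pd i (diffZ k₁ k₂) (x - y) :=
  pd_comp_sub_right i (diffZ k₁ k₂) x y

lemma E11_apply (x y : E3) (i j : Fin 3) :
    E11 P k₁ k₂ x y i j = (if i = j then 1 / (P.mu : ℂ) * helmZ P.ks (x - y) else 0)
      + 1 / ((P.rho - P.beta * P.rhoF) * P.omega ^ 2) * pd i (pd j (potZ P k₁ k₂)) (x - y) := by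
  have h : (fun z => helm P.ks z y
        - (P.kp ^ 2 - k₂ ^ 2) / (k₁ ^ 2 - k₂ ^ 2) * helm k₁ z y
        + (P.kp ^ 2 - k₁ ^ 2) / (k₁ ^ 2 - k₂ ^ 2) * helm k₂ z y) =
      fun z => potZ P k₁ k₂ (z - y) := rfl
  have h2 : pd j (fun z => potZ P k₁ k₂ (z - y)) = fun z => pd j (potZ P k₁ k₂) (z - y) :=
    funext fun z => pd_comp_sub_right j _ z y
  simp only [E11, hess, Matrix.add_apply, Matrix.smul_apply, Matrix.of_apply, smul_eq_mul,
    Matrix.one_apply]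
  rw [h, h2, pd_comp_sub_right i]
  simp [helm_eq]

/-- The three coefficients sum to 1 − (k₁² − k₂²)/(k₁² − k₂²) = 0, so the gradient is bounded and
the Hessian is O(1/|z|) instead of O(1/|z|³). -/
lemma isSing_potZ (hne : k₁ ^ 2 ≠ k₂ ^ 2) (i j : Fin 3) : IsSing 1 (pd i (pd j (potZ P k₁ k₂))) := by
  have hD : k₁ ^ 2 - k₂ ^ 2 ≠ 0 := sub_ne_zero.2 hne
  have := (isSing_pd_combination 1 (-((P.kp ^ 2 - k₂ ^ 2) / (k₁ ^ 2 - k₂ ^ 2)))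
    ((P.kp ^ 2 - k₁ ^ 2) / (k₁ ^ 2 - k₂ ^ 2)) (by field_simp; ring) P.ks k₁ k₂ j).pd i
  convert this using 3
  funext z
  simp [potZ]
  ring

lemma isSing_diffZ (i : Fin 3) : IsSing 0 (pd i (diffZ k₁ k₂)) := isSing_pd_helmZ_sub k₁ k₂ i

lemma contDiffOn_helmZ (k : ℂ) : ContDiffOn ℝ ∞ (helmZ k) {0}ᶜ := (isSing_helmZ k).1

lemma contDiffOn_diffZ : ContDiffOn ℝ ∞ (diffZ k₁ k₂) {0}ᶜ :=
  (contDiffOn_helmZ k₁).sub (contDiffOn_helmZ k₂)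

lemma contDiffOn_potZ : ContDiffOn ℝ ∞ (potZ P k₁ k₂) {0}ᶜ :=
  ((contDiffOn_helmZ _).sub (contDiffOn_const.mul (contDiffOn_helmZ k₁))).add
    (contDiffOn_const.mul (contDiffOn_helmZ k₂))

lemma differentiableAt_of_contDiffOn {f : E3 → ℂ} (h : ContDiffOn ℝ ∞ f {0}ᶜ) {z : E3}
    (hz : z ≠ 0) : DifferentiableAt ℝ f z :=
  (h.contDiffAt (compl_zero_mem_nhds hz)).differentiableAt (by simp)

lemma pd_laplacian {f : E3 → ℂ} (h : ContDiffOn ℝ ∞ f {0}ᶜ) {z : E3} (hz : z ≠ 0) (j : Fin 3) :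
    ∑ i, pd i (pd j (pd i f)) z = pd j (fun w => ∑ i, pd i (pd i f) w) z := by
  rw [pd_sum _ fun i _ => differentiableAt_of_contDiffOn (contDiffOn_pd (contDiffOn_pd h i) i) hz]
  exact Finset.sum_congr rfl fun i _ => pd_comm (contDiffOn_pd h i) hz i j

lemma pd_combination {a b c : ℂ} {f g h : E3 → ℂ} {z : E3} (hf : DifferentiableAt ℝ f z)
    (hg : DifferentiableAt ℝ g z) (hh : DifferentiableAt ℝ h z) (i : Fin 3) :
    pd i (fun w => a * f w + b * g w + c * h w) z = a * pd i f z + b * pd i g z + c * pd i h z := by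
  rw [pd_add (f := fun w => a * f w + b * g w) ((hf.const_mul a).add (hg.const_mul b))
    (hh.const_mul c), pd_add (hf.const_mul a) (hg.const_mul b), pd_const_mul', pd_const_mul', pd_const_mul']

lemma laplacian_combination (a b c k l m : ℂ) {z : E3} (hz : z ≠ 0) :
    ∑ i, pd i (pd i fun w => a * helmZ k w + b * helmZ l w + c * helmZ m w) z =
      -(a * k ^ 2) * helmZ k z + -(b * l ^ 2) * helmZ l z + -(c * m ^ 2) * helmZ m z := by
  have h1 : ∀ i, pd i (pd i fun w => a * helmZ k w + b * helmZ l w + c * helmZ m w) z =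
      a * pd i (pd i (helmZ k)) z + b * pd i (pd i (helmZ l)) z + c * pd i (pd i (helmZ m)) z := by
    intro i
    rw [pd_congr_off (fun w hw => pd_combination (isSing_helmZ k |>.differentiableAt hw)
      (isSing_helmZ l |>.differentiableAt hw) (isSing_helmZ m |>.differentiableAt hw) i) hz]
    exact pd_combination ((isSing_helmZ k).pd i |>.differentiableAt hz)
      ((isSing_helmZ l).pd i |>.differentiableAt hz) ((isSing_helmZ m).pd i |>.differentiableAt hz) i
  simp only [h1, Finset.sum_add_distrib, ← Finset.mul_sum, laplacian_helmZ _ hz]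
  ring

lemma diffZ_eq : diffZ k₁ k₂ = fun w => 1 * helmZ k₁ w + (-1) * helmZ k₂ w + 0 * helmZ 0 w := by
  funext w; simp [diffZ]; ring

lemma potZ_eq : potZ P k₁ k₂ = fun w => 1 * helmZ P.ks w +
    (-((P.kp ^ 2 - k₂ ^ 2) / (k₁ ^ 2 - k₂ ^ 2))) * helmZ k₁ w +
    ((P.kp ^ 2 - k₁ ^ 2) / (k₁ ^ 2 - k₂ ^ 2)) * helmZ k₂ w := by
  funext w; simp [potZ]; ring

lemma laplacian_diffZ {z : E3} (hz : z ≠ 0) :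
    ∑ i, pd i (pd i (diffZ k₁ k₂)) z = -(k₁ ^ 2 * helmZ k₁ z - k₂ ^ 2 * helmZ k₂ z) := by
  rw [diffZ_eq, laplacian_combination _ _ _ _ _ _ hz]; ring

/-- This contraction is the gradient of the Laplacian, and the Helmholtz equation turns it into
first derivatives of the kernels; the same holds for `trace_third_potZ`. -/
lemma trace_third_diffZ {z : E3} (hz : z ≠ 0) (j : Fin 3) :
    ∑ i, pd i (pd j (pd i (diffZ k₁ k₂))) z =
      -(k₁ ^ 2) * pd j (helmZ k₁) z + k₂ ^ 2 * pd j (helmZ k₂) z := by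
  rw [pd_laplacian (contDiffOn_diffZ k₁ k₂) hz, diffZ_eq,
    pd_congr_off (fun w hw => laplacian_combination _ _ _ _ _ _ hw) hz,
    pd_combination (isSing_helmZ _ |>.differentiableAt hz)
      (isSing_helmZ _ |>.differentiableAt hz) (isSing_helmZ _ |>.differentiableAt hz)]
  ring

lemma trace_third_potZ {z : E3} (hz : z ≠ 0) (j : Fin 3) :
    ∑ i, pd i (pd j (pd i (potZ P k₁ k₂))) z = -(P.ks ^ 2) * pd j (helmZ P.ks) z
      + (P.kp ^ 2 - k₂ ^ 2) / (k₁ ^ 2 - k₂ ^ 2) * k₁ ^ 2 * pd j (helmZ k₁) z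
      - (P.kp ^ 2 - k₁ ^ 2) / (k₁ ^ 2 - k₂ ^ 2) * k₂ ^ 2 * pd j (helmZ k₂) z := by
  rw [pd_laplacian (contDiffOn_potZ P k₁ k₂) hz, potZ_eq,
    pd_congr_off (fun w hw => laplacian_combination _ _ _ _ _ _ hw) hz,
    pd_combination (isSing_helmZ _ |>.differentiableAt hz)
      (isSing_helmZ _ |>.differentiableAt hz) (isSing_helmZ _ |>.differentiableAt hz)]
  ring

/-! ### Pointwise form of the kernels -/

/-- Coefficient `(α - β) / ((λ + 2μ) (k₁² - k₂²))`. -/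
def couplingCoeff : ℂ := (P.alpha - P.beta) / ((P.lam + 2 * P.mu) * (k₁ ^ 2 - k₂ ^ 2))

/-- Matrix kernel of `N₂³`, to be applied to `ν_y`. -/
def matN23 (l j : Fin 3) (z : E3) : ℂ :=
  -P.beta * (2 * P.mu * (1 / ((P.rho - P.beta * P.rhoF) * P.omega ^ 2) *
      pd l (pd j (potZ P k₁ k₂)) z))
    + (if l = j then -P.beta * (2 * P.mu * (1 / (P.mu : ℂ)) - 1) * helmZ P.ks z
      - 2 * P.mu * couplingCoeff P k₁ k₂ * (k₁ ^ 2 * helmZ k₁ z - k₂ ^ 2 * helmZ k₂ z) else 0)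

/-- Matrix kernel of `p ↦ N₂²(M p)`, to be applied to `ν_y`. -/
def matN22 (l j : Fin 3) (z : E3) : ℂ :=
  2 * P.mu * couplingCoeff P k₁ k₂ * (pd l (pd j (diffZ k₁ k₂)) z
    - if l = j then ∑ i, pd i (pd i (diffZ k₁ k₂)) z else 0)

lemma kerN23_apply (ν : E3 → E3) (x y : E3) (l : Fin 3) :
    kerN23 P k₁ k₂ ν x y l = ∑ j, matN23 P k₁ k₂ l j (x - y) * cvec (ν y) j := by
  simp only [kerN23, matN23, couplingCoeff, Pi.sub_apply, Pi.neg_apply, Pi.smul_apply,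
    Matrix.mulVec, dotProduct, Matrix.sub_apply, Matrix.smul_apply, E11_apply, Matrix.one_apply,
    smul_eq_mul, Fin.sum_univ_three, helm_eq]
  fin_cases l <;> simp <;> ring

/-- Displacement part of the adjoint conormal derivative of the fundamental solution. -/
def adjDisp (m : C3) (l : Fin 3) (z : E3) : ℂ :=
  ∑ j, m j * (-P.beta * ((if l = j then 1 / (P.mu : ℂ) * helmZ P.ks z else 0) +
    1 / ((P.rho - P.beta * P.rhoF) * P.omega ^ 2) * pd j (pd l (potZ P k₁ k₂)) z) +
    couplingCoeff P k₁ k₂ * pd j (pd l (diffZ k₁ k₂)) z)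

/-- Pressure part of the adjoint conormal derivative of the fundamental solution. -/
def adjPres (m : C3) (z : E3) : ℂ :=
  ∑ j, m j * (-P.beta * (Complex.I * P.omega * P.gam / ((P.lam + 2 * P.mu) * (k₁ ^ 2 - k₂ ^ 2))) *
    pd j (diffZ k₁ k₂) z
    + 1 / (k₁ ^ 2 - k₂ ^ 2) * ((P.kp ^ 2 - k₁ ^ 2) * pd j (helmZ k₁) z
      - (P.kp ^ 2 - k₂ ^ 2) * pd j (helmZ k₂) z))

/-- The Laplacian on the diagonal of `matN22` equals −(k₁²γ_{k₁} − k₂²γ_{k₂}), so it cancels the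
corresponding diagonal term of `matN23`. What survives is 2μ times the field on which the traction
acts, up to a multiple of γ_{k_s} m. -/
lemma matN_mul_normal (m : C3) (l : Fin 3) {z : E3} (hz : z ≠ 0) :
    ∑ j, (matN23 P k₁ k₂ l j z + matN22 P k₁ k₂ l j z) * m j =
      2 * P.mu * adjDisp P k₁ k₂ m l z + P.beta * (helmZ P.ks z * m l) := by
  have h1 : ∀ j, pd j (pd l (potZ P k₁ k₂)) z = pd l (pd j (potZ P k₁ k₂)) z := fun j =>
    pd_comm (contDiffOn_potZ P k₁ k₂) hz j l
  have h2 : ∀ j, pd j (pd l (diffZ k₁ k₂)) z = pd l (pd j (diffZ k₁ k₂)) z := fun j =>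
    pd_comm (contDiffOn_diffZ k₁ k₂) hz j l
  simp only [matN23, matN22, adjDisp, laplacian_diffZ k₁ k₂ hz, Fin.sum_univ_three, h1, h2]
  fin_cases l <;> simp <;> ring

lemma E21_apply (x y : E3) (i : Fin 3) :
    E21 P k₁ k₂ x y i = -couplingCoeff P k₁ k₂ * pd i (diffZ k₁ k₂) (x - y) := by
  simp only [E21, Pi.smul_apply, grad_diff, couplingCoeff, smul_eq_mul]
  ring

lemma E12_apply (x y : E3) (i : Fin 3) :
    E12 P k₁ k₂ x y i = Complex.I * P.omega * P.gam / ((P.lam + 2 * P.mu) * (k₁ ^ 2 - k₂ ^ 2)) *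
      pd i (diffZ k₁ k₂) (x - y) := by
  simp only [E12, Pi.smul_apply, grad_diff, smul_eq_mul]

lemma adjBdryOp_inl (ν : E3 → E3) (y z : E3) (i : Fin 3) :
    adjBdryOp P (ν y) (fun w k => fundSol P k₁ k₂ z w k (Sum.inl i)) y (Sum.inr ()) =
      adjDisp P k₁ k₂ (cvec (ν y)) i (z - y) := by
  have h : ∀ j, pd j (fun w => E21 P k₁ k₂ z w i) y =
      couplingCoeff P k₁ k₂ * pd j (pd i (diffZ k₁ k₂)) (z - y) := by
    intro j
    have : (fun w => E21 P k₁ k₂ z w i) =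
        fun w => -couplingCoeff P k₁ k₂ * pd i (diffZ k₁ k₂) (z - w) :=
      funext fun w => E21_apply P k₁ k₂ z w i
    rw [this, pd_const_mul', pd_comp_sub_left]
    ring
  simp only [adjBdryOp, Sum.elim_inr, fundSol, Matrix.fromBlocks_apply₁₁,
    Matrix.fromBlocks_apply₂₁, Matrix.replicateRow_apply, normalD, grad, dotProduct, adjDisp,
    E11_apply, h, Fin.sum_univ_three]
  fin_cases i <;> simp <;> ring

lemma adjBdryOp_inr (ν : E3 → E3) {y z : E3} (hz : z ≠ y) :
    adjBdryOp P (ν y) (fun w k => fundSol P k₁ k₂ z w k (Sum.inr ())) y (Sum.inr ()) =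
      adjPres P k₁ k₂ (cvec (ν y)) (z - y) := by
  have h : ∀ j, pd j (fun w => E22 P k₁ k₂ z w) y =
      1 / (k₁ ^ 2 - k₂ ^ 2) * ((P.kp ^ 2 - k₁ ^ 2) * pd j (helmZ k₁) (z - y)
      - (P.kp ^ 2 - k₂ ^ 2) * pd j (helmZ k₂) (z - y)) := by
    intro j
    have : (fun w => E22 P k₁ k₂ z w) = fun w => -(1 / (k₁ ^ 2 - k₂ ^ 2)) *
      (fun v => (P.kp ^ 2 - k₁ ^ 2) * helmZ k₁ v - (P.kp ^ 2 - k₂ ^ 2) * helmZ k₂ v) (z - w) := rfl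
    have hd := sub_ne_zero.2 hz
    rw [this, pd_const_mul', pd_comp_sub_left j
      (fun v => (P.kp ^ 2 - k₁ ^ 2) * helmZ k₁ v - (P.kp ^ 2 - k₂ ^ 2) * helmZ k₂ v),
      pd_sub (((isSing_helmZ k₁).differentiableAt hd).const_mul _)
        (((isSing_helmZ k₂).differentiableAt hd).const_mul _), pd_const_mul', pd_const_mul']
    ring
  simp only [adjBdryOp, Sum.elim_inr, fundSol, Matrix.fromBlocks_apply₁₂,
    Matrix.fromBlocks_apply₂₂, Matrix.replicateCol_apply, Matrix.of_apply, normalD, grad,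
    dotProduct, adjPres, E12_apply, h, Fin.sum_univ_three]
  ring

/-- A pressure density selects the last column of the kernel. Because of the transpose, this column
comes from the pressure component of T̃* applied to each column of E. -/
lemma hyperKernel_mulVec (ν : E3 → E3) {x y : E3} (hxy : x ≠ y) (p : ℂ) (l : Fin 3) :
    (hyperKernel P k₁ k₂ ν x y *ᵥ Sum.elim (0 : C3) (fun _ => p)) (Sum.inl l) =
      p * (traction P (ν x) (fun z i => adjDisp P k₁ k₂ (cvec (ν y)) i (z - y)) x l
        - P.alpha * adjPres P k₁ k₂ (cvec (ν y)) (x - y) * cvec (ν x) l) := by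
  have h : hyperKernel P k₁ k₂ ν x y (Sum.inl l) (Sum.inr ()) =
      bdryOp P (ν x) (fun z k => adjBdryOp P (ν y) (fun w k' => fundSol P k₁ k₂ z w k' k) y
        (Sum.inr ())) x (Sum.inl l) := rfl
  have h2 : (hyperKernel P k₁ k₂ ν x y *ᵥ Sum.elim (0 : C3) (fun _ => p)) (Sum.inl l) =
      hyperKernel P k₁ k₂ ν x y (Sum.inl l) (Sum.inr ()) * p := by
    simp [Matrix.mulVec, dotProduct]
  rw [h2, h]
  simp only [bdryOp, Sum.elim_inl, adjBdryOp_inl, adjBdryOp_inr P k₁ k₂ ν hxy, Pi.sub_apply,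
    Pi.smul_apply, smul_eq_mul]
  ring

lemma normalD_helm_comb (n x y : E3) (hxy : x ≠ y) (a b : ℂ) (k l : ℂ) :
    normalD n (fun w => a * helm k x w - b * helm l x w) y =
      -(∑ i, cvec n i * (a * pd i (helmZ k) (x - y) - b * pd i (helmZ l) (x - y))) := by
  have hd := sub_ne_zero.2 hxy
  have h : ∀ i, pd i (fun w => a * helm k x w - b * helm l x w) y =
      -(a * pd i (helmZ k) (x - y) - b * pd i (helmZ l) (x - y)) := by
    intro i
    have : (fun w => a * helm k x w - b * helm l x w) =
      fun w => (fun v => a * helmZ k v - b * helmZ l v) (x - w) := rfl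
    rw [this, pd_comp_sub_left i (fun v => a * helmZ k v - b * helmZ l v),
      pd_sub (((isSing_helmZ k).differentiableAt hd).const_mul _)
        (((isSing_helmZ l).differentiableAt hd).const_mul _), pd_const_mul', pd_const_mul']
  simp only [normalD, grad, dotProduct, h, mul_neg, Finset.sum_neg_distrib]

lemma pd_diffZ {z : E3} (hz : z ≠ 0) (i : Fin 3) :
    pd i (diffZ k₁ k₂) z = pd i (helmZ k₁) z - pd i (helmZ k₂) z :=
  pd_sub ((isSing_helmZ k₁).differentiableAt hz) ((isSing_helmZ k₂).differentiableAt hz) i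

lemma kerN21_apply (ν : E3 → E3) {x y : E3} (hxy : x ≠ y) (l : Fin 3) :
    kerN21 P k₁ k₂ ν x y l =
      -((P.alpha - P.beta) / (k₁ ^ 2 - k₂ ^ 2) * ∑ i, cvec (ν y) i *
        (k₁ ^ 2 * pd i (helmZ k₁) (x - y) - k₂ ^ 2 * pd i (helmZ k₂) (x - y))) * cvec (ν x) l
      + P.beta * ((∑ i, cvec (ν y) i *
          (pd i (helmZ P.ks) (x - y) - pd i (helmZ k₁) (x - y))) * cvec (ν x) l
        - (∑ i, cvec (ν x) i * pd i (helmZ P.ks) (x - y)) * cvec (ν y) l)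
      + ((Complex.I * P.omega * P.gam * P.alpha * P.beta /
            ((k₁ ^ 2 - k₂ ^ 2) * (P.lam + 2 * P.mu))
          - P.beta * (k₂ ^ 2 - P.q) / (k₁ ^ 2 - k₂ ^ 2)) *
        ∑ i, cvec (ν y) i * (pd i (helmZ k₁) (x - y) - pd i (helmZ k₂) (x - y))) * cvec (ν x) l
      - (P.alpha / (k₁ ^ 2 - k₂ ^ 2) * ∑ i, cvec (ν y) i *
        ((P.kp ^ 2 - k₁ ^ 2) * pd i (helmZ k₁) (x - y)
          - (P.kp ^ 2 - k₂ ^ 2) * pd i (helmZ k₂) (x - y))) * cvec (ν x) l := by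
  have hd := sub_ne_zero.2 hxy
  have h1 : ∀ k i, pd i (fun z => helm k z y) x = pd i (helmZ k) (x - y) := fun k i =>
    pd_comp_sub_right i (helmZ k) x y
  simp only [kerN21, normalD_helm_comb _ _ _ hxy, Pi.add_apply, Pi.sub_apply, Pi.smul_apply,
    smul_eq_mul, dotProduct, grad_diff, pd_diffZ _ _ hd]
  simp only [normalD, grad, dotProduct, h1, Fin.sum_univ_three]
  ring

/-- If ρ = βρ_f, then β is real. The denominator of β has imaginary part φ² ≠ 0 while its numerator
is real and nonzero, so comparing imaginary parts gives ρ/ρ_f = 0, hence β = 0 and the numerator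
would vanish. -/
lemma Params.Admissible.ne_zero {P : Params} (hP : P.Admissible) :
    (P.mu : ℂ) ≠ 0 ∧ (P.lam + 2 * P.mu : ℂ) ≠ 0 ∧ (P.rho - P.beta * P.rhoF : ℂ) ≠ 0 ∧
      (P.omega : ℂ) ≠ 0 := by
  have hmu := hP.mu_pos
  have h2 := hP.lame_pos
  have h3 : P.lam + 2 * P.mu ≠ 0 := by
    have : 0 < P.lam + 2 * P.mu := by linarith
    exact this.ne'
  refine ⟨by exact_mod_cast hmu.ne', by exact_mod_cast h3, fun h => ?_, by exact_mod_cast hP.omega_ne⟩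
  have hb : P.beta = ((P.rho / P.rhoF : ℝ) : ℂ) := by
    have hr : (P.rhoF : ℂ) ≠ 0 := by exact_mod_cast hP.rhoF_ne
    push_cast
    field_simp
    linear_combination -h
  have hnum : (P.omega * P.phi ^ 2 * P.rhoF * P.kappa : ℝ) ≠ 0 := by
    have := hP.omega_ne; have := hP.phi_ne; have := hP.rhoF_ne; have := hP.kappa_ne
    positivity
  set den : ℂ := Complex.I * P.phi ^ 2 + P.omega * P.kappa * (P.rhoA + P.phi * P.rhoF) with hden
  have him : den.im = P.phi ^ 2 := by
    have : den = ((P.omega * P.kappa * (P.rhoA + P.phi * P.rhoF) : ℝ) : ℂ)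
      + ((P.phi ^ 2 : ℝ) : ℂ) * Complex.I := by rw [hden]; push_cast; ring
    rw [this, Complex.add_im, Complex.ofReal_im, Complex.im_ofReal_mul, Complex.I_im]
    simp
  have hden0 : den ≠ 0 := fun h0 => hP.phi_ne (by
    rw [h0] at him; simpa using him.symm)
  have hb2 : P.beta * den = ((P.omega * P.phi ^ 2 * P.rhoF * P.kappa : ℝ) : ℂ) := by
    rw [Params.beta, ← hden, div_mul_cancel₀ _ hden0]
    push_cast; ring
  rw [hb] at hb2
  have him2 := congrArg Complex.im hb2
  rw [Complex.im_ofReal_mul, Complex.ofReal_im, him] at him2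
  have hρ : P.rho / P.rhoF = 0 := by
    rcases mul_eq_zero.1 him2 with h0 | h0
    · exact h0
    · exact absurd (pow_eq_zero_iff (by norm_num) |>.1 h0) hP.phi_ne
  rw [hρ] at hb2
  exact hnum (by exact_mod_cast (by simpa using hb2.symm : ((_ : ℝ) : ℂ) = 0))

lemma kp_sq : P.kp ^ 2 = P.omega ^ 2 * ((P.rho - P.beta * P.rhoF) / (P.lam + 2 * P.mu)) := by
  rw [Params.kp, mul_pow, Complex.sqrt, Complex.cpow_ofNat_inv_pow]

lemma ks_sq : P.ks ^ 2 = P.omega ^ 2 * ((P.rho - P.beta * P.rhoF) / P.mu) := by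
  rw [Params.ks, mul_pow, Complex.sqrt, Complex.cpow_ofNat_inv_pow]

/-! ### Reduction of the hyper-singular kernel off the diagonal -/

lemma third_symm {f : E3 → ℂ} (h : ContDiffOn ℝ ∞ f {0}ᶜ) {z : E3} (hz : z ≠ 0) (a b j : Fin 3) :
    pd a (pd j (pd b f)) z = pd b (pd j (pd a f)) z := by
  rw [pd_congr_off (fun w hw => pd_comm h hw j b) hz, pd_comm (contDiffOn_pd h j) hz,
    pd_congr_off (fun w hw => pd_comm h hw a j) hz]

lemma gunterJac_add_smul (n : C3) (a b : ℂ) (J K : Fin 3 → C3) (l : Fin 3) :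
    gunterJac n (fun i c => a * J i c + b * K i c) l =
      a * gunterJac n J l + b * gunterJac n K l := by
  simp only [gunterJac, crossMat, crossProduct, Fin.sum_univ_three]
  fin_cases l <;> simp <;> ring

/-- With s the gradient of γ_{k_s}, this evaluates the Günter derivative of the extra term γ_{k_s} m
in `matN_mul_normal`. -/
lemma gunterJac_tensor (n m s : C3) (l : Fin 3) :
    gunterJac n (fun i c => m i * s c) l = s l * (∑ i, n i * m i) - n l * ∑ i, m i * s i := by
  simp only [gunterJac, crossMat, crossProduct, Fin.sum_univ_three]
  fin_cases l <;> simp <;> ring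

lemma contDiffOn_adjDisp (m : C3) (i : Fin 3) : ContDiffOn ℝ ∞ (adjDisp P k₁ k₂ m i) {0}ᶜ := by
  refine ContDiffOn.sum fun j _ => contDiffOn_const.mul ((contDiffOn_const.mul (ContDiffOn.add ?_
    (contDiffOn_const.mul (contDiffOn_pd (contDiffOn_pd (contDiffOn_potZ P k₁ k₂) i) j)))).add
    (contDiffOn_const.mul (contDiffOn_pd (contDiffOn_pd (contDiffOn_diffZ k₁ k₂) i) j)))
  split_ifs
  · exact contDiffOn_const.mul (contDiffOn_helmZ _)
  · exact contDiffOn_const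

lemma pd_adjDisp (m : C3) (i b : Fin 3) {z : E3} (hz : z ≠ 0) :
    pd b (adjDisp P k₁ k₂ m i) z = -P.beta / P.mu * (m i * pd b (helmZ P.ks) z) +
      ∑ j, m j * (-P.beta * (1 / ((P.rho - P.beta * P.rhoF) * P.omega ^ 2)) *
        pd b (pd j (pd i (potZ P k₁ k₂))) z +
        couplingCoeff P k₁ k₂ * pd b (pd j (pd i (diffZ k₁ k₂))) z) := by
  have e : ∀ w, adjDisp P k₁ k₂ m i w = (-P.beta / P.mu * m i) * helmZ P.ks w + 1 *
      (∑ j, m j * ((-P.beta * (1 / ((P.rho - P.beta * P.rhoF) * P.omega ^ 2))) *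
        pd j (pd i (potZ P k₁ k₂)) w + couplingCoeff P k₁ k₂ * pd j (pd i (diffZ k₁ k₂)) w))
      + 0 * helmZ 0 w := by
    intro w
    simp only [adjDisp, Fin.sum_univ_three]
    fin_cases i <;> simp <;> ring
  have d1 : ∀ j, DifferentiableAt ℝ (pd j (pd i (potZ P k₁ k₂))) z := fun j =>
    differentiableAt_of_contDiffOn (contDiffOn_pd (contDiffOn_pd (contDiffOn_potZ P k₁ k₂) i) j) hz
  have d2 : ∀ j, DifferentiableAt ℝ (pd j (pd i (diffZ k₁ k₂))) z := fun j =>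
    differentiableAt_of_contDiffOn (contDiffOn_pd (contDiffOn_pd (contDiffOn_diffZ k₁ k₂) i) j) hz
  have d3 : ∀ j ∈ Finset.univ, DifferentiableAt ℝ (fun w => m j *
      ((-P.beta * (1 / ((P.rho - P.beta * P.rhoF) * P.omega ^ 2))) *
        pd j (pd i (potZ P k₁ k₂)) w + couplingCoeff P k₁ k₂ * pd j (pd i (diffZ k₁ k₂)) w)) z :=
    fun j _ => (((d1 j).const_mul _).add ((d2 j).const_mul _)).const_mul _
  rw [pd_congr_off (fun w _ => e w) hz, pd_combination ((isSing_helmZ _).differentiableAt hz)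
    (DifferentiableAt.fun_sum d3) ((isSing_helmZ _).differentiableAt hz), pd_sum _ d3]
  simp only [pd_const_mul', pd_add ((d1 _).const_mul _) ((d2 _).const_mul _)]
  ring

/-- The identity `matN_mul_normal` holds on the whole punctured space, so it may be differentiated.
-/
lemma pd_matN (m : C3) (i b : Fin 3) {z : E3} (hz : z ≠ 0) :
    ∑ j, pd b (fun z => matN23 P k₁ k₂ i j z + matN22 P k₁ k₂ i j z) z * m j =
      2 * P.mu * pd b (adjDisp P k₁ k₂ m i) z + P.beta * (m i * pd b (helmZ P.ks) z) := by
  have d1 : ∀ j, DifferentiableAt ℝ (fun z => matN23 P k₁ k₂ i j z + matN22 P k₁ k₂ i j z) z := by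
    intro j
    have c1 : DifferentiableAt ℝ (pd i (pd j (potZ P k₁ k₂))) z :=
      differentiableAt_of_contDiffOn (contDiffOn_pd (contDiffOn_pd (contDiffOn_potZ P k₁ k₂) j) i) hz
    have c2 : ∀ i j, DifferentiableAt ℝ (pd i (pd j (diffZ k₁ k₂))) z := fun i j =>
      differentiableAt_of_contDiffOn (contDiffOn_pd (contDiffOn_pd (contDiffOn_diffZ k₁ k₂) j) i) hz
    have c3 : ∀ k, DifferentiableAt ℝ (helmZ k) z := fun k => (isSing_helmZ k).differentiableAt hz
    refine DifferentiableAt.add (DifferentiableAt.add ((c1.const_mul _).const_mul _ |>.const_mul _) ?_)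
      ((DifferentiableAt.sub (c2 i j) ?_).const_mul _)
    · split_ifs
      · exact ((c3 _).const_mul _).sub ((((c3 _).const_mul _).sub ((c3 _).const_mul _)).const_mul _)
      · exact differentiableAt_const _
    · split_ifs
      · exact DifferentiableAt.fun_sum fun a _ => c2 a a
      · exact differentiableAt_const _
  have h1 : ∀ j, pd b (fun z => matN23 P k₁ k₂ i j z + matN22 P k₁ k₂ i j z) z * m j =
      pd b (fun z => m j * (matN23 P k₁ k₂ i j z + matN22 P k₁ k₂ i j z)) z := fun j => by
    rw [pd_const_mul', mul_comm]
  simp only [h1]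
  rw [← pd_sum _ fun j _ => (d1 j).const_mul _,
    pd_congr_off (g := fun w => (2 * P.mu) * adjDisp P k₁ k₂ m i w + (P.beta * m i) * helmZ P.ks w
      + 0 * helmZ 0 w) (fun w hw => ?_) hz,
    pd_combination (differentiableAt_of_contDiffOn (contDiffOn_adjDisp P k₁ k₂ m i) hz)
      ((isSing_helmZ _).differentiableAt hz) ((isSing_helmZ _).differentiableAt hz)]
  · ring
  · have := matN_mul_normal P k₁ k₂ m i hw
    simp only [mul_comm (m _)]
    rw [this]; ring

/-- Off the diagonal the hyper-singular kernel is the kernel of `N₂¹` plus a Günter derivative. -/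
lemma hyperKernel_eq (hP : P.Admissible) (hk : P.IsWaveNumbers k₁ k₂) (hne : k₁ ^ 2 ≠ k₂ ^ 2)
    (ν : E3 → E3) {x y : E3} (hxy : x ≠ y) (p : ℂ) (l : Fin 3) :
    (hyperKernel P k₁ k₂ ν x y *ᵥ Sum.elim (0 : C3) (fun _ => p)) (Sum.inl l) =
      p * kerN21 P k₁ k₂ ν x y l + p * gunterJac (cvec (ν x)) (fun i b => ∑ j,
        pd b (fun z => matN23 P k₁ k₂ i j z + matN22 P k₁ k₂ i j z) (x - y) * cvec (ν y) j) l := by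
  obtain ⟨hmu, hL, hρ, hω⟩ := hP.ne_zero
  have hD : k₁ ^ 2 - k₂ ^ 2 ≠ 0 := sub_ne_zero.2 hne
  have hd : x - y ≠ 0 := sub_ne_zero.2 hxy
  rw [hyperKernel_mulVec P k₁ k₂ ν hxy, ← mul_add]
  congr 1
  generalize hm : cvec (ν y) = m
  have hJ : ∀ i b, pd b (fun z => adjDisp P k₁ k₂ m i (z - y)) x =
      pd b (adjDisp P k₁ k₂ m i) (x - y) := fun i b => pd_comp_sub_right b _ x y
  have htr : ∑ i, pd i (adjDisp P k₁ k₂ m i) (x - y) = ∑ j, m j *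
      (-P.beta / P.mu * pd j (helmZ P.ks) (x - y)
      + -P.beta * (1 / ((P.rho - P.beta * P.rhoF) * P.omega ^ 2)) *
        (∑ i, pd i (pd j (pd i (potZ P k₁ k₂))) (x - y)) +
        couplingCoeff P k₁ k₂ * ∑ i, pd i (pd j (pd i (diffZ k₁ k₂))) (x - y)) := by
    simp only [pd_adjDisp P k₁ k₂ m _ _ hd, Fin.sum_univ_three]
    ring
  -- The Hessian terms are gradients in the first variable and drop out of the curl by symmetry of
  -- third derivatives; only the multiple of γ_{k_s} m contributes.
  have hcurl : ∀ a b, pd a (adjDisp P k₁ k₂ m b) (x - y) - pd b (adjDisp P k₁ k₂ m a) (x - y) =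
      -P.beta / P.mu * (m b * pd a (helmZ P.ks) (x - y) - m a * pd b (helmZ P.ks) (x - y)) := by
    intro a b
    simp only [pd_adjDisp P k₁ k₂ m _ _ hd, third_symm (contDiffOn_potZ P k₁ k₂) hd a b,
      third_symm (contDiffOn_diffZ k₁ k₂) hd a b]
    ring
  rw [traction_eq]
  simp only [hJ, pd_matN P k₁ k₂ m _ _ hd]
  rw [gunterJac_add_smul, gunterJac_tensor, htr]
  simp only [trace_third_potZ P k₁ k₂ hd, trace_third_diffZ k₁ k₂ hd]
  have hc : crossProduct (cvec (ν x)) (curl (fun z i => adjDisp P k₁ k₂ m i (z - y)) x) l =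
      -P.beta / P.mu * (pd l (helmZ P.ks) (x - y) * (∑ i, cvec (ν x) i * m i)
        - m l * ∑ i, cvec (ν x) i * pd i (helmZ P.ks) (x - y)) := by
    simp only [curl, hJ, hcurl, crossProduct, Fin.sum_univ_three]
    fin_cases l <;> simp <;> ring
  rw [hc, kerN21_apply P k₁ k₂ ν hxy, hm]
  simp only [adjPres, pd_diffZ k₁ k₂ hd, Fin.sum_univ_three, ks_sq, couplingCoeff]
  generalize cvec (ν x) = n
  have hkp := kp_sq P
  have hkp0 : P.kp ^ 2 ≠ 0 := by
    rw [hkp]; exact mul_ne_zero (pow_ne_zero _ hω) (div_ne_zero hρ hL)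
  have hρ2 : (P.rho - P.beta * P.rhoF) * P.omega ^ 2 = P.kp ^ 2 * (P.lam + 2 * P.mu) := by
    rw [hkp]; field_simp
  have hq : P.q = k₁ ^ 2 * k₂ ^ 2 / P.kp ^ 2 := by
    rw [hk.mul, mul_div_assoc, div_self hkp0, mul_one]
  have hρ3 : (P.omega : ℂ) ^ 2 * ((P.rho - P.beta * P.rhoF) / P.mu) =
    P.kp ^ 2 * (P.lam + 2 * P.mu) / P.mu := by rw [← hρ2]; ring
  rw [hq, hρ2, hρ3]
  -- With q and (ρ − βρ_f)ω² expressed through k_p², λ+2μ, k₁² and k₂², the claim is a rational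
  -- identity in which these four can be treated as free nonzero quantities where they occur in
  -- denominators.
  generalize P.kp ^ 2 = K at *
  generalize (P.lam + 2 * P.mu : ℂ) = L at *
  generalize k₁ ^ 2 = a at *
  generalize k₂ ^ 2 = b at *
  field_simp
  ring

/-! ### Graph patches -/

abbrev E2 := EuclideanSpace ℝ (Fin 2)

/-- A compactly supported perturbation of a plane, given as a graph in adapted coordinates. -/
structure GraphPatch where
  center : E3
  b : OrthonormalBasis (Fin 3) ℝ E3
  h : E2 → ℝ
  contDiff : ContDiff ℝ 2 h
  compact : HasCompactSupport h
  h_zero : h 0 = 0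
  fderiv_zero : fderiv ℝ h 0 = 0

namespace GraphPatch

variable (G : GraphPatch)

/-- The embedding of the parameter plane as the tangent plane at the center. -/
def emb : E2 →L[ℝ] E3 :=
  (EuclideanSpace.proj 0 : E2 →L[ℝ] ℝ).smulRight (G.b 0) +
    (EuclideanSpace.proj 1 : E2 →L[ℝ] ℝ).smulRight (G.b 1)

/-- The graph parametrization. -/
def F (u : E2) : E3 := G.center + G.emb u + G.h u • G.b 2

/-- Derivative of the graph parametrization. -/
def DF (u : E2) : E2 →L[ℝ] E3 := G.emb + (fderiv ℝ G.h u).smulRight (G.b 2)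

/-- The linear part of the tangential coordinates. -/
def coordsL : E3 →L[ℝ] E2 :=
  (innerSL ℝ (G.b 0)).smulRight (EuclideanSpace.single 0 1) +
    (innerSL ℝ (G.b 1)).smulRight (EuclideanSpace.single 1 1)

/-- Tangential coordinates. -/
def coords (y : E3) : E2 := G.coordsL (y - G.center)

/-- Height over the graph. -/
def height (y : E3) : ℝ := inner ℝ (G.b 2) (y - G.center) - G.h (G.coords y)

def slope (a : Fin 2) (u : E2) : ℝ := fderiv ℝ G.h u (EuclideanSpace.single a 1)

def normalVec (u : E2) : E3 := G.b 2 - G.slope 0 u • G.b 0 - G.slope 1 u • G.b 1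

def jac (u : E2) : ℝ := √(1 + G.slope 0 u ^ 2 + G.slope 1 u ^ 2)

lemma inner_b (i j : Fin 3) : inner ℝ (G.b i) (G.b j) = if i = j then (1 : ℝ) else 0 :=
  orthonormal_iff_ite.1 G.b.orthonormal i j

lemma emb_apply (u : E2) : G.emb u = u 0 • G.b 0 + u 1 • G.b 1 := by simp [emb]

lemma coordsL_apply (v : E3) (a : Fin 2) :
    G.coordsL v a = inner ℝ (G.b (Fin.castSucc a)) v := by
  fin_cases a <;> simp [coordsL]

lemma coordsL_emb (u : E2) : G.coordsL (G.emb u) = u := by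
  ext a
  rw [coordsL_apply, emb_apply, inner_add_right, inner_smul_right, inner_smul_right, inner_b,
    inner_b]
  fin_cases a <;> simp

lemma coordsL_b2 : G.coordsL (G.b 2) = 0 := by
  ext a
  rw [coordsL_apply, inner_b]
  fin_cases a <;> simp

lemma coords_F (u : E2) : G.coords (G.F u) = u := by
  simp [coords, F, add_assoc, coordsL_emb, coordsL_b2]

lemma inner_b2_emb (u : E2) : inner ℝ (G.b 2) (G.emb u) = (0 : ℝ) := by
  simp [emb_apply, inner_add_right, inner_smul_right]

lemma height_F (u : E2) : G.height (G.F u) = 0 := by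
  simp only [height, coords_F]
  simp [F, add_assoc, inner_add_right, inner_smul_right, inner_b2_emb]

lemma decomp (v : E3) : v = G.emb (G.coordsL v) + (inner ℝ (G.b 2) v : ℝ) • G.b 2 := by
  have := G.b.sum_repr' v
  rw [Fin.sum_univ_three] at this
  rw [emb_apply, coordsL_apply, coordsL_apply]
  exact this.symm

lemma F_coords_of_height {y : E3} (hy : G.height y = 0) : G.F (G.coords y) = y := by
  have := G.decomp (y - G.center)
  rw [height, sub_eq_zero] at hy
  rw [F, ← hy, add_assoc, coords, ← this]
  abel

lemma norm_emb_add_sq (u : E2) (t : ℝ) : ‖G.emb u + t • G.b 2‖ ^ 2 = ‖u‖ ^ 2 + t ^ 2 := by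
  have h := G.b.sum_sq_norm_inner_right (G.emb u + t • G.b 2)
  rw [← h, Fin.sum_univ_three, EuclideanSpace.real_norm_sq_eq, Fin.sum_univ_two]
  simp [emb_apply, inner_add_right, inner_smul_right]

lemma norm_emb (u : E2) : ‖G.emb u‖ = ‖u‖ := by
  have h := G.norm_emb_add_sq u 0
  simp only [zero_smul, add_zero, ne_eq, OfNat.ofNat_ne_zero, not_false_eq_true, zero_pow] at h
  exact (pow_left_inj₀ (norm_nonneg _) (norm_nonneg _) (by norm_num)).1 h

lemma F_sub (u v : E2) : G.F u - G.F v = G.emb (u - v) + (G.h u - G.h v) • G.b 2 := by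
  simp only [F, map_sub, sub_smul]; abel

lemma norm_F_sub_sq (u v : E2) : ‖G.F u - G.F v‖ ^ 2 = ‖u - v‖ ^ 2 + (G.h u - G.h v) ^ 2 := by
  rw [F_sub, norm_emb_add_sq]

lemma norm_sub_le_norm_F_sub (u v : E2) : ‖u - v‖ ≤ ‖G.F u - G.F v‖ := by
  have := G.norm_F_sub_sq u v
  exact (pow_le_pow_iff_left₀ (norm_nonneg _) (norm_nonneg _) two_ne_zero).1
    (by rw [this]; exact le_add_of_nonneg_right (sq_nonneg _))

lemma F_zero : G.F 0 = G.center := by simp [F, G.h_zero]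

lemma contDiff_F : ContDiff ℝ 2 G.F :=
  (contDiff_const.add G.emb.contDiff).add (G.contDiff.smul contDiff_const)

lemma continuous_F : Continuous G.F := G.contDiff_F.continuous

lemma hasFDerivAt_F (u : E2) : HasFDerivAt G.F (G.DF u) u := by
  have h := (G.contDiff.differentiable (by norm_num) u).hasFDerivAt
  exact (G.emb.hasFDerivAt.const_add G.center).add (h.smul_const (G.b 2))

lemma DF_apply (u v : E2) : G.DF u v = G.emb v + fderiv ℝ G.h u v • G.b 2 := by simp [DF]

lemma DF_zero : G.DF 0 = G.emb := by simp [DF, G.fderiv_zero]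

lemma contDiff_DF : ContDiff ℝ 1 G.DF :=
  contDiff_const.add ((G.contDiff.fderiv_right (m := 1) (by norm_num)).smulRight contDiff_const)

lemma contDiff_slope (a : Fin 2) : ContDiff ℝ 1 (G.slope a) :=
  (G.contDiff.fderiv_right (m := 1) (by norm_num)).clm_apply contDiff_const

lemma jac_pos (u : E2) : 0 < G.jac u := Real.sqrt_pos.2 (by positivity)

lemma jac_sq (u : E2) : G.jac u ^ 2 = 1 + G.slope 0 u ^ 2 + G.slope 1 u ^ 2 :=
  Real.sq_sqrt (by positivity)

lemma contDiff_jac : ContDiff ℝ 1 G.jac := by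
  refine ContDiff.sqrt ?_ fun u => by positivity
  exact (contDiff_const.add ((G.contDiff_slope 0).pow 2)).add ((G.contDiff_slope 1).pow 2)

lemma continuous_jac : Continuous G.jac := G.contDiff_jac.continuous

lemma norm_normalVec (u : E2) : ‖G.normalVec u‖ = G.jac u := by
  have h := G.b.sum_sq_norm_inner_right (G.normalVec u)
  rw [Fin.sum_univ_three] at h
  simp [normalVec, inner_sub_right, inner_smul_right] at h
  rw [← pow_left_inj₀ (norm_nonneg _) (G.jac_pos u).le (two_ne_zero), jac_sq, normalVec, ← h]
  ring

lemma contDiff_normalVec : ContDiff ℝ 1 G.normalVec :=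
  (contDiff_const.sub ((G.contDiff_slope 0).smul contDiff_const)).sub
    ((G.contDiff_slope 1).smul contDiff_const)

lemma contDiff_coords : ContDiff ℝ ∞ G.coords :=
  G.coordsL.contDiff.comp (contDiff_id.sub contDiff_const)

lemma hasFDerivAt_coords (y : E3) : HasFDerivAt G.coords G.coordsL y := by
  have := (G.coordsL.hasFDerivAt (x := y - G.center)).comp y
    ((hasFDerivAt_id y).sub_const G.center)
  exact this

lemma continuous_height : Continuous G.height := by
  have := G.contDiff.continuous
  have := G.contDiff_coords.continuous
  unfold height
  fun_prop

lemma fderiv_h_apply (u v : E2) : fderiv ℝ G.h u v = v 0 * G.slope 0 u + v 1 * G.slope 1 u := by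
  have hv : v = v 0 • EuclideanSpace.single 0 (1 : ℝ) + v 1 • EuclideanSpace.single 1 (1 : ℝ) := by
    ext j; fin_cases j <;> simp
  conv_lhs => rw [hv]
  simp [slope]

lemma hasFDerivAt_height (y : E3) :
    HasFDerivAt G.height (innerSL ℝ (G.normalVec (G.coords y))) y := by
  have h1 := (G.contDiff.differentiable (by norm_num) (G.coords y)).hasFDerivAt.comp y
    (G.hasFDerivAt_coords y)
  have h2 : HasFDerivAt (fun y => (inner ℝ (G.b 2) (y - G.center) : ℝ)) (innerSL ℝ (G.b 2)) y := by
    have := ((innerSL ℝ (G.b 2)).hasFDerivAt (x := y - G.center)).comp y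
      ((hasFDerivAt_id y).sub_const G.center)
    exact this
  have h3 := h2.sub h1
  have e : innerSL ℝ (G.b 2) - (fderiv ℝ G.h (G.coords y)).comp G.coordsL =
      innerSL ℝ (G.normalVec (G.coords y)) := by
    ext v
    simp [fderiv_h_apply, normalVec, coordsL_apply]
    ring
  rw [← e]
  exact h3

lemma continuous_normalVec : Continuous G.normalVec := G.contDiff_normalVec.continuous

lemma inner_normalVec_DF (u v : E2) : inner ℝ (G.normalVec u) (G.DF u v) = (0 : ℝ) := by
  simp [normalVec, DF_apply, emb_apply, fderiv_h_apply, inner_sub_left, inner_add_right,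
    inner_smul_left, inner_smul_right]
  ring

end GraphPatch

/-- `G` describes the surface `Γ` and its normal `ν` in the ball of radius `δ`. -/
structure IsChart (Γ : Set E3) (ν : E3 → E3) (G : GraphPatch) (δ : ℝ) : Prop where
  pos : 0 < δ
  cross : crossProduct (cvec (G.b 0)) (cvec (G.b 1)) = cvec (G.b 2)
  mem_iff : ∀ y ∈ Metric.ball G.center δ, y ∈ Γ ↔ G.height y = 0
  normal : ∀ y ∈ Metric.ball G.center δ, y ∈ Γ →
    ν y = (G.jac (G.coords y))⁻¹ • G.normalVec (G.coords y)

/-! ### Existence of charts -/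

/-- Take any unit vector e orthogonal to n and f = n × e; then (e, f, n) is orthonormal and e × f =
n. -/
lemma exists_adapted_basis (n : E3) (hn : ‖n‖ = 1) : ∃ b : OrthonormalBasis (Fin 3) ℝ E3,
    b 2 = n ∧ crossProduct (cvec (b 0)) (cvec (b 1)) = cvec (b 2) := by
  have hn2 : n 0 ^ 2 + n 1 ^ 2 + n 2 ^ 2 = 1 := by
    have := EuclideanSpace.real_norm_sq_eq n
    rw [Fin.sum_univ_three, hn] at this
    linarith
  obtain ⟨e, he, hen⟩ : ∃ e : E3, ‖e‖ = 1 ∧ e 0 * n 0 + e 1 * n 1 + e 2 * n 2 = 0 := by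
    obtain ⟨v, hv, hvn⟩ : ∃ v : E3, v ≠ 0 ∧ v 0 * n 0 + v 1 * n 1 + v 2 * n 2 = 0 := by
      by_cases h : n 0 = 0 ∧ n 1 = 0
      · refine ⟨!₂[1, 0, 0], fun h0 => ?_, by simp [h.1]⟩
        have := congrArg (fun w : E3 => w 0) h0
        simp at this
      · refine ⟨!₂[n 1, -n 0, 0], fun h0 => h ?_, by simp; ring⟩
        have h1 := congrArg (fun w : E3 => w 0) h0
        have h2 := congrArg (fun w : E3 => w 1) h0
        simp at h1 h2
        exact ⟨h2, h1⟩
    refine ⟨‖v‖⁻¹ • v, by rw [norm_smul, norm_inv, norm_norm, inv_mul_cancel₀ (norm_ne_zero_iff.2 hv)], ?_⟩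
    simp only [PiLp.smul_apply, smul_eq_mul]
    linear_combination ‖v‖⁻¹ * hvn
  have he2 : e 0 ^ 2 + e 1 ^ 2 + e 2 ^ 2 = 1 := by
    have := EuclideanSpace.real_norm_sq_eq e
    rw [Fin.sum_univ_three, he] at this
    linarith
  let f : E3 := !₂[n 1 * e 2 - n 2 * e 1, n 2 * e 0 - n 0 * e 2, n 0 * e 1 - n 1 * e 0]
  have hf : f 0 ^ 2 + f 1 ^ 2 + f 2 ^ 2 = 1 := by
    simp [f]
    linear_combination (n 0 ^ 2 + n 1 ^ 2 + n 2 ^ 2) * he2 + hn2 -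
      (e 0 * n 0 + e 1 * n 1 + e 2 * n 2) * hen
  have hortho : Orthonormal ℝ ![e, f, n] := by
    rw [orthonormal_iff_ite]
    intro i j
    rw [PiLp.inner_apply, Fin.sum_univ_three]
    fin_cases i <;> fin_cases j <;> simp [f] <;> simp only [f] at hf <;> simp at hf
    · linarith
    · ring
    · linarith
    · ring
    · linarith
    · ring
    · linarith
    · ring
    · linarith
  let b := (basisOfOrthonormalOfCardEqFinrank hortho (by simp)).toOrthonormalBasis
    (by simpa using hortho)
  have hb : ∀ i, b i = ![e, f, n] i := fun i => by simp [b]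
  refine ⟨b, by simp [hb], ?_⟩
  rw [hb, hb, hb]
  ext i
  have r0 : e 1 * f 2 - e 2 * f 1 = n 0 := by
    simp [f]; linear_combination n 0 * he2 - e 0 * hen
  have r1 : e 2 * f 0 - e 0 * f 2 = n 1 := by
    simp [f]; linear_combination n 1 * he2 - e 1 * hen
  have r2 : e 0 * f 1 - e 1 * f 0 = n 2 := by
    simp [f]; linear_combination n 2 * he2 - e 2 * hen
  clear_value f
  simp only [crossProduct, cvec]
  fin_cases i
  · simp [← r0]; rfl
  · simp [← r1]; rfl
  · simp [← r2]; rfl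

/-- Gradients of two functions with the same negativity set point in the same direction. -/
lemma eq_normalize_of_same_sign {f g : E3 → ℝ} {N m y : E3}
    (hf : HasFDerivAt f (innerSL ℝ N) y) (hg : HasFDerivAt g (innerSL ℝ m) y)
    (hfy : f y = 0) (hgy : g y = 0) (hm : m ≠ 0) (hN : N ≠ 0)
    (h : ∀ᶠ z in 𝓝 y, f z < 0 → g z < 0) : ‖m‖⁻¹ • m = ‖N‖⁻¹ • N := by
  -- If f decreases to first order along w, then f, and with it g, is negative just after y on that
  -- ray. So the open half-space of N lies in the closed half-space of m, which forces m to be a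
  -- positive multiple of N.
  have key : ∀ w : E3, (inner ℝ N w : ℝ) < 0 → (inner ℝ m w : ℝ) ≤ 0 := by
    intro w hw
    have hline : HasDerivAt (fun s : ℝ => y + s • w) w 0 := by
      simpa using ((hasDerivAt_id (0 : ℝ)).smul_const w).const_add y
    have h1 : HasDerivAt (fun s : ℝ => f (y + s • w)) (inner ℝ N w) 0 := by
      have hf' : HasFDerivAt f (innerSL ℝ N) (y + (0 : ℝ) • w) := by simpa using hf
      exact hf'.comp_hasDerivAt 0 hline
    have h2 : HasDerivAt (fun s : ℝ => g (y + s • w)) (inner ℝ m w) 0 := by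
      have hg' : HasFDerivAt g (innerSL ℝ m) (y + (0 : ℝ) • w) := by simpa using hg
      exact hg'.comp_hasDerivAt 0 hline
    have t1 := (hasDerivAt_iff_tendsto_slope_zero.1 h1).mono_left
      (nhdsWithin_mono 0 (s := Set.Ioi 0) fun s hs => ne_of_gt hs)
    have t2 := (hasDerivAt_iff_tendsto_slope_zero.1 h2).mono_left
      (nhdsWithin_mono 0 (s := Set.Ioi 0) fun s hs => ne_of_gt hs)
    have hc : Tendsto (fun s : ℝ => y + s • w) (𝓝[>] 0) (𝓝 y) := by
      have := hline.continuousAt.tendsto.mono_left (nhdsWithin_le_nhds (s := Set.Ioi 0))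
      simpa using this
    refine le_of_tendsto t2 ?_
    filter_upwards [t1.eventually (gt_mem_nhds hw), hc.eventually h, self_mem_nhdsWithin]
      with s hs hs2 hpos
    have hpos : 0 < s := hpos
    simp only [zero_add, zero_smul, add_zero, hfy, hgy, sub_zero, smul_eq_mul] at hs ⊢
    have : f (y + s • w) < 0 := by
      by_contra hcon
      exact absurd hs (not_lt.2 (mul_nonneg (inv_nonneg.2 hpos.le) (not_lt.1 hcon)))
    exact mul_nonpos_of_nonneg_of_nonpos (inv_nonneg.2 hpos.le) (hs2 this).le
  have hNN : 0 < ‖N‖ ^ 2 := by positivity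
  set c : ℝ := inner ℝ N m / ‖N‖ ^ 2 with hc
  set r : E3 := m - c • N with hr
  have hNr : (inner ℝ N r : ℝ) = 0 := by
    rw [hr, inner_sub_right, inner_smul_right, real_inner_self_eq_norm_sq, hc]
    field_simp
    ring
  have hmr : (inner ℝ m r : ℝ) = ‖r‖ ^ 2 := by
    have : m = r + c • N := by rw [hr]; abel
    conv_lhs => rw [this]
    rw [inner_add_left, inner_smul_left, hNr, real_inner_self_eq_norm_sq]
    simp
  have hr0 : r = 0 := by
    by_contra hne
    have hpos : 0 < ‖r‖ ^ 2 := by have := norm_pos_iff.2 hne; positivity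
    -- The test direction r − tN has negative product with N for every t > 0, and for t this small
    -- its product with m is still positive, against `key`.
    obtain ⟨t, ht, ht2⟩ : ∃ t : ℝ, 0 < t ∧ t * inner ℝ m N < ‖r‖ ^ 2 := by
      refine ⟨‖r‖ ^ 2 / (2 * (|inner ℝ m N| + 1)), by positivity, ?_⟩
      have h1 : ‖r‖ ^ 2 / (2 * (|inner ℝ m N| + 1)) * inner ℝ m N ≤
          ‖r‖ ^ 2 / (2 * (|inner ℝ m N| + 1)) * (|inner ℝ m N| + 1) := by
        gcongr
        exact (le_abs_self _).trans (by linarith)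
      have h2 : ‖r‖ ^ 2 / (2 * (|inner ℝ m N| + 1)) * (|inner ℝ m N| + 1) = ‖r‖ ^ 2 / 2 := by
        field_simp
      linarith
    have h1 : (inner ℝ N (r - t • N) : ℝ) < 0 := by
      rw [inner_sub_right, hNr, inner_smul_right, real_inner_self_eq_norm_sq]
      nlinarith
    have h2 := key _ h1
    rw [inner_sub_right, hmr, inner_smul_right] at h2
    linarith
  have hmc : m = c • N := by rw [hr] at hr0; exact sub_eq_zero.1 hr0
  have hc0 : 0 < c := by
    have h1 : (inner ℝ N (-N) : ℝ) < 0 := by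
      rw [inner_neg_right, real_inner_self_eq_norm_sq]; linarith
    have h2 := key _ h1
    rw [hmc, inner_neg_right, inner_smul_left, real_inner_self_eq_norm_sq] at h2
    simp only [conj_trivial] at h2
    have hcne : c ≠ 0 := fun h0 => hm (by rw [hmc, h0, zero_smul])
    have : 0 ≤ c := by
      by_contra hneg
      nlinarith
    exact lt_of_le_of_ne this hcne.symm
  rw [hmc, norm_smul, Real.norm_of_nonneg hc0.le, smul_smul]
  congr 1
  field_simp

namespace GraphPatch

lemma norm_sq_decomp (G : GraphPatch) (v : E3) :
    ‖v‖ ^ 2 = ‖G.coordsL v‖ ^ 2 + (inner ℝ (G.b 2) v : ℝ) ^ 2 := by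
  conv_lhs => rw [G.decomp v]
  rw [norm_emb_add_sq]

lemma norm_coordsL_le (G : GraphPatch) (v : E3) : ‖G.coordsL v‖ ≤ ‖v‖ :=
  (pow_le_pow_iff_left₀ (norm_nonneg _) (norm_nonneg _) two_ne_zero).1
    (by rw [G.norm_sq_decomp v]; exact le_add_of_nonneg_right (sq_nonneg _))

lemma abs_inner_b2_le (G : GraphPatch) (v : E3) : |(inner ℝ (G.b 2) v : ℝ)| ≤ ‖v‖ := by
  refine (pow_le_pow_iff_left₀ (abs_nonneg _) (norm_nonneg _) two_ne_zero).1 ?_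
  rw [G.norm_sq_decomp v, sq_abs]
  exact le_add_of_nonneg_left (sq_nonneg _)

end GraphPatch

/-- A smooth function with nonzero gradient is negative exactly below a graph. -/
lemma exists_graphPatch_of_gradient {x₀ : E3} {ψ : E3 → ℝ} (hψ : ContDiff ℝ ∞ ψ) (h0 : ψ x₀ = 0)
    (b : OrthonormalBasis (Fin 3) ℝ E3) {c : ℝ} (hc : 0 < c) (hgrad : gradient ψ x₀ = c • b 2) :
    ∃ G : GraphPatch, G.center = x₀ ∧ G.b = b ∧ ∀ᶠ y in 𝓝 x₀, (ψ y < 0 ↔ G.height y < 0) := by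
  let e : E2 →L[ℝ] E3 := (EuclideanSpace.proj 0 : E2 →L[ℝ] ℝ).smulRight (b 0) +
    (EuclideanSpace.proj 1 : E2 →L[ℝ] ℝ).smulRight (b 1)
  let A : E2 × ℝ →L[ℝ] E3 := e.comp (ContinuousLinearMap.fst ℝ E2 ℝ) +
    (ContinuousLinearMap.snd ℝ E2 ℝ).smulRight (b 2)
  let Ψ : E2 × ℝ → ℝ := fun v => ψ (x₀ + A v)
  have hΨ : ContDiff ℝ ∞ Ψ := hψ.comp (contDiff_const.add A.contDiff)
  have hΨ0 : Ψ (0, 0) = 0 := by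
    show ψ (x₀ + A (0, 0)) = 0
    rw [show ((0, 0) : E2 × ℝ) = 0 from rfl, map_zero, add_zero, h0]
  have hΨ' : ∀ v, HasFDerivAt Ψ ((fderiv ℝ ψ (x₀ + A v)).comp A) v := fun v =>
    ((hψ.differentiable (by simp) _).hasFDerivAt).comp v (A.hasFDerivAt.const_add x₀)
  have hgr : ∀ w, fderiv ℝ ψ x₀ w = c * inner ℝ (b 2) w := by
    intro w
    have := ((hψ.differentiable (by simp) x₀).hasGradientAt.hasFDerivAt).fderiv
    rw [this, hgrad]
    simp
  have horth : ∀ i j, (inner ℝ (b i) (b j) : ℝ) = if i = j then 1 else 0 :=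
    orthonormal_iff_ite.1 b.orthonormal
  have hf0 : ∀ v : E2 × ℝ, fderiv ℝ Ψ (0, 0) v = c * v.2 := by
    intro v
    rw [(hΨ' _).fderiv, show ((0, 0) : E2 × ℝ) = 0 from rfl, map_zero, add_zero,
      ContinuousLinearMap.comp_apply, hgr]
    simp [A, e, inner_add_right, inner_smul_right]
  have cdf : ContDiffAt ℝ ∞ Ψ (0, 0) := hΨ.contDiffAt
  have hinv : (fderiv ℝ Ψ (0, 0) ∘L .inr ℝ E2 ℝ).IsInvertible := by
    refine ⟨ContinuousLinearEquiv.unitsEquivAut ℝ (Units.mk0 c hc.ne'), ?_⟩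
    ext
    simp [hf0]
  let h₀ := cdf.implicitFunction (by simp) hinv
  have hh0 : h₀ 0 = 0 := cdf.implicitFunction_apply_self (by simp) hinv
  have hh0' : HasFDerivAt h₀ (0 : E2 →L[ℝ] ℝ) 0 := by
    have := (cdf.hasStrictFDerivAt_implicitFunction (by simp) hinv).hasFDerivAt
    convert! this using 1
    have : fderiv ℝ Ψ (0, 0) ∘L .inl ℝ E2 ℝ = 0 := by ext v; simp [hf0]
    rw [this]
    simp
  have hzero : ∀ᶠ u in 𝓝 (0 : E2), Ψ (u, h₀ u) = 0 := by
    have := cdf.eventually_apply_implicitFunction (by simp) hinv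
    rw [hΨ0] at this
    exact this
  have hsm : ContDiffAt ℝ 2 h₀ 0 :=
    (cdf.contDiffAt_implicitFunction (by simp) hinv).of_le (WithTop.coe_le_coe.2 le_top)
  obtain ⟨r, hr, hrb⟩ := Metric.eventually_nhds_iff_ball.1 (hsm.eventually (by simp))
  -- The implicit function is C² only on the ball of radius r. The bump equals 1 near 0 and is
  -- supported well inside that ball, so the product is globally C² with compact support and
  -- describes the same surface near the center.
  let χ : ContDiffBump (0 : E2) := ⟨r / 3, r / 2, by positivity, by linarith⟩
  have hχ1 : ∀ᶠ u in 𝓝 (0 : E2), χ u = 1 := χ.eventuallyEq_one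
  have heq : (fun u => χ u * h₀ u) =ᶠ[𝓝 0] h₀ := by
    filter_upwards [hχ1] with u hu
    rw [hu, one_mul]
  have hts : tsupport (fun u => χ u * h₀ u) ⊆ Metric.closedBall 0 (r / 2) :=
    (tsupport_mul_subset_left).trans χ.tsupport_eq.subset
  let G : GraphPatch :=
    { center := x₀
      b := b
      h := fun u => χ u * h₀ u
      contDiff := contDiff_iff_contDiffAt.2 fun u => by
        by_cases hu : u ∈ tsupport fun u => χ u * h₀ u
        · exact (χ.contDiff.contDiffAt).mul
            (hrb u (Metric.closedBall_subset_ball (by linarith) (hts hu)))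
        · exact contDiffAt_const.congr_of_eventuallyEq
            (notMem_tsupport_iff_eventuallyEq.1 hu)
      compact := (χ.hasCompactSupport).mul_right
      h_zero := by simp [hh0]
      fderiv_zero := by rw [heq.fderiv_eq, hh0'.fderiv] }
  refine ⟨G, rfl, rfl, ?_⟩
  have hder : ∀ᶠ v in 𝓝 ((0, 0) : E2 × ℝ), 0 < fderiv ℝ Ψ v (0, 1) := by
    have hcont : Continuous fun v => fderiv ℝ Ψ v (0, 1) :=
      (hΨ.continuous_fderiv (by simp)).clm_apply continuous_const
    refine hcont.continuousAt.eventually (lt_mem_nhds ?_)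
    simpa [hf0] using hc
  obtain ⟨r₁, hr₁, hball⟩ := Metric.eventually_nhds_iff_ball.1 hder
  have hG0 : G.h 0 = 0 := G.h_zero
  have hsmall : ∀ᶠ u in 𝓝 (0 : E2), Ψ (u, G.h u) = 0 ∧ |G.h u| < r₁ ∧ ‖u‖ < r₁ := by
    have h1 : ∀ᶠ u in 𝓝 (0 : E2), |G.h u| < r₁ := by
      have := G.contDiff.continuous.abs.continuousAt (x := (0 : E2))
      exact this.eventually (gt_mem_nhds (by simpa [hG0] using hr₁))
    have h2 : ∀ᶠ u in 𝓝 (0 : E2), ‖u‖ < r₁ :=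
      continuous_norm.continuousAt.eventually (gt_mem_nhds (by simpa using hr₁))
    filter_upwards [hzero, heq, h1, h2] with u a b c d
    refine ⟨?_, c, d⟩
    have : G.h u = h₀ u := b
    rw [this]; exact a
  have hcoords : Tendsto G.coords (𝓝 x₀) (𝓝 0) := by
    have := G.contDiff_coords.continuous.tendsto x₀
    rwa [show G.coords x₀ = 0 by
      simp [GraphPatch.coords, show G.center = x₀ from rfl]] at this
  have ht : ∀ᶠ y in 𝓝 x₀, ‖y - x₀‖ < r₁ := by
    have : Continuous fun y : E3 => ‖y - x₀‖ := by fun_prop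
    exact this.continuousAt.eventually (gt_mem_nhds (by simpa using hr₁))
  filter_upwards [hcoords.eventually hsmall, ht] with y hy hyt
  obtain ⟨hy1, hy2, hy3⟩ := hy
  set u := G.coords y with hu
  set t : ℝ := inner ℝ (G.b 2) (y - x₀) with htdef
  have htr : |t| < r₁ := (G.abs_inner_b2_le _).trans_lt hyt
  -- Along the normal direction the defining function increases strictly and vanishes at the graph
  -- height, so its sign is the sign of the height over the graph.
  have hmono : StrictMonoOn (fun s => Ψ (u, s)) (Set.Ioo (-r₁) r₁) := by
    have hd : ∀ s, HasDerivAt (fun s => Ψ (u, s)) (fderiv ℝ Ψ (u, s) (0, 1)) s := fun s =>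
      (hΨ.differentiable (by simp) (u, s)).hasFDerivAt.comp_hasDerivAt s
        ((hasDerivAt_const s u).prodMk (hasDerivAt_id s))
    refine strictMonoOn_of_deriv_pos (convex_Ioo _ _)
      (fun s _ => (hd s).continuousAt.continuousWithinAt) fun s hs => ?_
    rw [interior_Ioo] at hs
    rw [(hd s).deriv]
    refine hball _ ?_
    rw [mem_ball_iff_norm, Prod.norm_def]
    simpa using ⟨hy3, abs_lt.2 hs⟩
  have hyA : y = x₀ + A (u, t) := by
    have := G.decomp (y - x₀)
    have h2 : A (u, t) = G.emb (G.coordsL (y - x₀)) + t • G.b 2 := by simp [A, e, G, GraphPatch.emb, hu, GraphPatch.coords]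
    rw [h2, ← this]; abel
  have hψy : ψ y = Ψ (u, t) := by show ψ y = ψ (x₀ + A (u, t)); rw [← hyA]
  have hlt := hmono.lt_iff_lt (a := t) (b := G.h u) (abs_lt.1 htr) (abs_lt.1 hy2)
  simp only [hy1] at hlt
  rw [hψy, hlt]
  show t < G.h u ↔ t - G.h u < 0
  exact sub_neg.symm

/-- Near x₀ the domain is the region below a graph. At another boundary point y of this
neighbourhood, ν(y) comes from a different defining function; both functions are negative exactly on
Ω near y, so their normalized gradients agree by `eq_normalize_of_same_sign`. -/
lemma exists_isChart {Ω : Set E3} (hΩ : IsSmoothBoundedDomain Ω) {ν : E3 → E3}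
    (hν : IsOutwardUnitNormal Ω ν) {x₀ : E3} (hx₀ : x₀ ∈ frontier Ω) :
    ∃ (G : GraphPatch) (δ : ℝ), G.center = x₀ ∧ IsChart (frontier Ω) ν G δ := by
  have psi_zero : ∀ {y : E3} {ψ : E3 → ℝ}, y ∈ frontier Ω → IsLocalDefiningFunction Ω y ψ →
      ψ y = 0 := by
    intro y ψ hy hψ
    have hcont : ContinuousAt ψ y := hψ.1.continuous.continuousAt
    refine le_antisymm ?_ ?_
    · by_contra hpos
      have h1 : ∀ᶠ z in 𝓝 y, 0 < ψ z := hcont.eventually (lt_mem_nhds (not_le.1 hpos))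
      have h2 : ∀ᶠ z in 𝓝 y, z ∉ Ω := by
        filter_upwards [h1, hψ.2.2] with z hz1 hz2 hz
        exact absurd (hz2.1 hz) (not_lt.2 hz1.le)
      have := mem_closure_iff_frequently.1 (frontier_subset_closure hy)
      exact this h2
    · by_contra hneg
      have : y ∈ Ω := hψ.2.2.self_of_nhds.2 (not_le.1 hneg)
      rw [hΩ.isOpen.frontier_eq] at hy
      exact hy.2 this
  obtain ⟨hn, ψ, hψ, hgrad⟩ := hν x₀ hx₀
  obtain ⟨b, hb, hcross⟩ := exists_adapted_basis (ν x₀) hn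
  obtain ⟨G, hGc, hGb, hGψ⟩ := exists_graphPatch_of_gradient hψ.1 (psi_zero hx₀ hψ) b
    (norm_pos_iff.2 hψ.2.1) (by rw [hb]; exact hgrad)
  obtain ⟨δ, hδ, hball⟩ := Metric.eventually_nhds_iff_ball.1 (hGψ.and hψ.2.2)
  have hmem : ∀ y ∈ Metric.ball x₀ δ, (y ∈ Ω ↔ G.height y < 0) := fun y hy =>
    (hball y hy).2.trans (hball y hy).1
  have hnear : ∀ y ∈ Metric.ball x₀ δ, ∀ᶠ z in 𝓝 y, (z ∈ Ω ↔ G.height z < 0) := fun y hy =>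
    Filter.eventually_of_mem (Metric.isOpen_ball.mem_nhds hy) hmem
  have hN : ∀ u, G.normalVec u ≠ 0 := fun u => by
    rw [← norm_ne_zero_iff, G.norm_normalVec]; exact (G.jac_pos u).ne'
  have hfr : ∀ y ∈ Metric.ball x₀ δ, y ∈ frontier Ω → G.height y = 0 := by
    intro y hy hyf
    refine le_antisymm ?_ ?_
    · by_contra hpos
      have h1 : ∀ᶠ z in 𝓝 y, 0 < G.height z :=
        G.continuous_height.continuousAt.eventually (lt_mem_nhds (not_le.1 hpos))
      refine mem_closure_iff_frequently.1 (frontier_subset_closure hyf) ?_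
      filter_upwards [h1, hnear y hy] with z hz1 hz2 hz
      exact absurd (hz2.1 hz) (not_lt.2 hz1.le)
    · rw [hΩ.isOpen.frontier_eq] at hyf
      exact not_lt.1 fun hlt => hyf.2 ((hmem y hy).2 hlt)
  refine ⟨G, δ, hGc, hδ, by rw [hGb]; exact hcross, fun y hy => ?_, fun y hy hyf => ?_⟩
  · rw [hGc] at hy
    refine ⟨hfr y hy, fun h0 => ?_⟩
    rw [hΩ.isOpen.frontier_eq]
    refine ⟨?_, fun hyΩ => absurd ((hmem y hy).1 hyΩ) (by rw [h0]; exact lt_irrefl 0)⟩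
    rw [mem_closure_iff_frequently]
    intro hev
    -- Moving a graph point down by s lowers its height to −s, so y is a limit of points of Ω.
    have hc : Tendsto (fun s : ℝ => y - s • G.b 2) (𝓝[>] 0) (𝓝 y) := by
      have : Continuous fun s : ℝ => y - s • G.b 2 := by fun_prop
      simpa using this.continuousAt.tendsto.mono_left (nhdsWithin_le_nhds (a := (0 : ℝ)))
    obtain ⟨s, ⟨hs1, hs2⟩, hs3⟩ := ((hc.eventually (hev.and (hnear y hy))).and
      self_mem_nhdsWithin).exists
    refine hs1 (hs2.2 ?_)
    have h1 : G.coords (y - s • G.b 2) = G.coords y := by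
      rw [GraphPatch.coords, GraphPatch.coords, sub_right_comm, map_sub, map_smul, G.coordsL_b2]
      simp
    have h2 : G.height (y - s • G.b 2) = G.height y - s := by
      rw [GraphPatch.height, GraphPatch.height, h1, sub_right_comm, inner_sub_right,
        inner_smul_right, G.inner_b]
      simp; ring
    rw [h2, h0]
    simpa using hs3
  · rw [hGc] at hy
    obtain ⟨hny, ψ', hψ', hgrad'⟩ := hν y hyf
    have hm : gradient ψ' y ≠ 0 := hψ'.2.1
    have hg : HasFDerivAt ψ' (innerSL ℝ (gradient ψ' y)) y :=
      (hψ'.1.differentiable (by simp) y).hasGradientAt.hasFDerivAt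
    have := eq_normalize_of_same_sign (G.hasFDerivAt_height y) hg (hfr y hy hyf)
      (psi_zero hyf hψ') hm (hN _) (by
        filter_upwards [hnear y hy, hψ'.2.2] with z h1 h2 h3
        exact h2.1 (h1.2 h3))
    rw [G.norm_normalVec] at this
    rw [← this, hgrad', norm_smul, hny, smul_smul]
    simp [hm]

/-! ### Area formula for graph patches -/

/-- The hypothesis says that f ∘ g⁻¹ is K-Lipschitz on g(s), and two-dimensional Hausdorff measure
grows at most by K² under such a map. -/
lemma euclideanHausdorff_image_le {X : Type*} {f g : X → E3} {s : Set X} {K : NNReal}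
    (hg : Set.InjOn g s) (h : ∀ v ∈ s, ∀ w ∈ s, dist (f v) (f w) ≤ K * dist (g v) (g w)) :
    μHE[2] (f '' s) ≤ (K : ENNReal) ^ 2 * μHE[2] (g '' s) := by
  rcases isEmpty_or_nonempty X with hX | hX
  · simp [Set.eq_empty_of_isEmpty s]
  have hL : LipschitzOnWith K (f ∘ Function.invFunOn g s) (g '' s) := by
    refine LipschitzOnWith.of_dist_le_mul ?_
    rintro _ ⟨v, hv, rfl⟩ _ ⟨w, hw, rfl⟩
    simp only [Function.comp_apply, hg.leftInvOn_invFunOn hv, hg.leftInvOn_invFunOn hw]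
    exact h v hv w hw
  have h1 := hL.hausdorffMeasure_image_le (d := 2) (by norm_num)
  have h2 : (f ∘ Function.invFunOn g s) '' (g '' s) = f '' s := by
    rw [Set.image_image]
    exact Set.image_congr fun v hv => by simp [hg.leftInvOn_invFunOn hv]
  rw [h2] at h1
  simp only [Measure.euclideanHausdorffMeasure_def, Measure.smul_apply, ENNReal.smul_def, smul_eq_mul]
  rw [mul_left_comm]
  gcongr
  simpa using h1

namespace GraphPatch

variable (G : GraphPatch)

lemma injective_F : Function.Injective G.F :=
  Function.LeftInverse.injective (g := G.coords) G.coords_F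

lemma measurableEmbedding_F : MeasurableEmbedding G.F :=
  G.continuous_F.measurableEmbedding G.injective_F

lemma exists_bound_fderiv_h : ∃ K : ℝ, 0 ≤ K ∧ ∀ u, ‖fderiv ℝ G.h u‖ ≤ K := by
  have hc : Continuous (fderiv ℝ G.h) := G.contDiff.continuous_fderiv (by norm_num)
  obtain ⟨C, hC⟩ := (G.compact.fderiv (𝕜 := ℝ)).exists_bound_of_continuous hc
  exact ⟨max C 0, le_max_right _ _, fun u => (hC u).trans (le_max_left _ _)⟩

lemma exists_lipschitz_h : ∃ K : ℝ, 0 ≤ K ∧ ∀ u v, |G.h u - G.h v| ≤ K * ‖u - v‖ := by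
  obtain ⟨K, hK, h⟩ := G.exists_bound_fderiv_h
  refine ⟨K, hK, fun u v => ?_⟩
  exact Convex.norm_image_sub_le_of_norm_fderiv_le (s := Set.univ) (𝕜 := ℝ)
    (fun x _ => G.contDiff.differentiable (by norm_num) x) (fun x _ => h x) convex_univ
    (Set.mem_univ v) (Set.mem_univ u)

lemma exists_lipschitz_F : ∃ K : NNReal, ∀ u v, dist (G.F u) (G.F v) ≤ K * dist u v := by
  obtain ⟨K, hK, h⟩ := G.exists_lipschitz_h
  refine ⟨⟨1 + K, by positivity⟩, fun u v => ?_⟩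
  rw [dist_eq_norm, dist_eq_norm, F_sub]
  have hb : ‖G.b 2‖ = 1 := G.b.orthonormal.1 2
  calc _ ≤ ‖G.emb (u - v)‖ + ‖(G.h u - G.h v) • G.b 2‖ := norm_add_le _ _
    _ ≤ ‖u - v‖ + K * ‖u - v‖ := by
        rw [norm_emb, norm_smul, hb, mul_one, Real.norm_eq_abs]
        gcongr
        exact h u v
    _ = (1 + K) * ‖u - v‖ := by ring

lemma normDet_DF (u : E2) : ((G.DF u : E2 →L[ℝ] E3) : E2 →ₗ[ℝ] E3).normDet = G.jac u := by
  rw [← pow_left_inj₀ (LinearMap.normDet_nonneg _) (G.jac_pos u).le two_ne_zero, G.jac_sq]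
  have := ((G.DF u : E2 →L[ℝ] E3) : E2 →ₗ[ℝ] E3).normDet_sq_eq_det_gram
    (EuclideanSpace.basisFun (Fin 2) ℝ)
  rw [Matrix.det_fin_two] at this
  simp [Matrix.gram, DF_apply, emb_apply, inner_add_left, inner_add_right, inner_smul_left,
    inner_smul_right] at this
  rw [this]
  simp only [slope]
  ring

lemma exists_dist_F_near (u : E2) {ε : ℝ} (hε : 0 < ε) : ∃ r > 0, ∀ v ∈ Metric.closedBall u r,
    ∀ w ∈ Metric.closedBall u r, ‖G.F v - G.F w - G.DF u (v - w)‖ ≤ ε * ‖v - w‖ := by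
  have hs : HasStrictFDerivAt G.F (G.DF u) u :=
    G.contDiff_F.contDiffAt.hasStrictFDerivAt' (G.hasFDerivAt_F u) (by norm_num)
  have := hs.isLittleO.def hε
  obtain ⟨r, hr, h⟩ := Metric.eventually_nhds_iff_ball.1 this
  refine ⟨r / 2, by positivity, fun v hv w hw => h (v, w) ?_⟩
  rw [← ball_prod_same]
  exact ⟨Metric.closedBall_subset_ball (by linarith) hv,
    Metric.closedBall_subset_ball (by linarith) hw⟩

lemma norm_le_norm_DF (u v : E2) : ‖v‖ ≤ ‖G.DF u v‖ := by
  refine (pow_le_pow_iff_left₀ (norm_nonneg _) (norm_nonneg _) two_ne_zero).1 ?_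
  rw [DF_apply, norm_emb_add_sq]
  exact le_add_of_nonneg_right (sq_nonneg _)

lemma euclideanHausdorff_DF_image (u : E2) (s : Set E2) :
    μHE[2] (G.DF u '' s) = ENNReal.ofReal (G.jac u) * volume s := by
  have := ((G.DF u : E2 →L[ℝ] E3) : E2 →ₗ[ℝ] E3).euclideanHausdorffMeasure_image_eq_normDet_mul_volume s
  rw [normDet_DF, finrank_euclideanSpace_fin] at this
  exact this

/-- By strict differentiability F differs from DF(u) by at most ε|v − w| on chords. A graph map and
its derivative never shorten vectors of the plane, so this is a relative error, and each map is
(1+ε)-Lipschitz with respect to the other. -/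
lemma exists_volume_compare (u : E2) {ε : ℝ} (hε : 0 < ε) : ∃ r > 0, ∀ s ⊆ Metric.closedBall u r,
    μHE[2] (G.F '' s) ≤ ENNReal.ofReal (1 + ε) ^ 2 * (ENNReal.ofReal (G.jac u) * volume s) ∧
    ENNReal.ofReal (G.jac u) * volume s ≤ ENNReal.ofReal (1 + ε) ^ 2 * μHE[2] (G.F '' s) := by
  obtain ⟨r, hr, h⟩ := G.exists_dist_F_near u hε
  refine ⟨r, hr, fun s hs => ?_⟩
  rw [← euclideanHausdorff_DF_image]
  have hinj : Function.Injective (G.DF u) := by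
    rw [injective_iff_map_eq_zero]
    intro v hv
    have := G.norm_le_norm_DF u v
    rw [hv, norm_zero] at this
    exact norm_le_zero_iff.1 this
  have hco : (((1 + ε).toNNReal : NNReal) : ℝ) = 1 + ε := Real.coe_toNNReal _ (by positivity)
  constructor
  · refine euclideanHausdorff_image_le (K := (1 + ε).toNNReal) hinj.injOn fun v hv w hw => ?_
    rw [dist_eq_norm, dist_eq_norm, hco, ← map_sub]
    have h1 := h v (hs hv) w (hs hw)
    have h2 := G.norm_le_norm_DF u (v - w)
    have h3 : G.F v - G.F w = (G.F v - G.F w - G.DF u (v - w)) + G.DF u (v - w) := by abel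
    rw [h3]
    refine (norm_add_le _ _).trans ?_
    nlinarith
  · refine euclideanHausdorff_image_le (K := (1 + ε).toNNReal) G.injective_F.injOn
      fun v hv w hw => ?_
    rw [dist_eq_norm, dist_eq_norm, hco, ← map_sub]
    have h1 := h v (hs hv) w (hs hw)
    have h2 := G.norm_sub_le_norm_F_sub v w
    have h3 : G.DF u (v - w) = (G.F v - G.F w) - (G.F v - G.F w - G.DF u (v - w)) := by abel
    rw [h3]
    refine (norm_sub_le _ _).trans ?_
    nlinarith

/-- F is Lipschitz, so the pulled back measure is absolutely continuous and locally finite. Its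
density at almost every point is the limit of its ratios to volume on small balls (Besicovitch
differentiation), and `exists_volume_compare` squeezes this limit to the Jacobian as ε → 0. -/
lemma comap_eq_withDensity : Measure.comap G.F μHE[2] =
    (volume : Measure E2).withDensity fun u => ENNReal.ofReal (G.jac u) := by
  set μ₁ : Measure E2 := Measure.comap G.F μHE[2] with hμ₁
  have happ : ∀ s, μ₁ s = μHE[2] (G.F '' s) := fun s => G.measurableEmbedding_F.comap_apply _ _
  obtain ⟨K, hK⟩ := G.exists_lipschitz_F
  have hle : ∀ s, μ₁ s ≤ (K : ENNReal) ^ 2 * volume s := by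
    intro s
    have h1 : LipschitzOnWith K G.F s := LipschitzOnWith.of_dist_le_mul fun u _ v _ => hK u v
    have h2 := h1.hausdorffMeasure_image_le (d := 2) (by norm_num)
    rw [happ, ← EuclideanSpace.euclideanHausdorffMeasure_eq_volume]
    simp only [Measure.euclideanHausdorffMeasure_def, Measure.smul_apply, ENNReal.smul_def,
      smul_eq_mul]
    rw [mul_left_comm]
    gcongr
    simpa using h2
  have hac : μ₁ ≪ volume := fun s hs => by
    have := hle s
    rw [hs, mul_zero] at this
    exact le_antisymm this zero_le
  have : IsLocallyFiniteMeasure μ₁ := ⟨fun u => ⟨Metric.ball u 1, Metric.ball_mem_nhds u one_pos,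
    (hle _).trans_lt (ENNReal.mul_lt_top (by simp) measure_ball_lt_top)⟩⟩
  have hrn : μ₁.rnDeriv volume =ᵐ[volume] fun u => ENNReal.ofReal (G.jac u) := by
    filter_upwards [Besicovitch.ae_tendsto_rnDeriv μ₁ (volume : Measure E2)] with u hu
    have hpos : ∀ r : ℝ, 0 < r → (volume (Metric.closedBall u r) : ENNReal) ≠ 0 := fun r hr =>
      (Metric.measure_closedBall_pos _ _ hr).ne'
    have hfin : ∀ r : ℝ, (volume (Metric.closedBall u r) : ENNReal) ≠ ⊤ := fun r =>
      measure_closedBall_lt_top.ne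
    have key : ∀ ε : ℝ, 0 < ε →
        μ₁.rnDeriv volume u ≤ ENNReal.ofReal (1 + ε) ^ 2 * ENNReal.ofReal (G.jac u) ∧
        ENNReal.ofReal (G.jac u) ≤ ENNReal.ofReal (1 + ε) ^ 2 * μ₁.rnDeriv volume u := by
      intro ε hε
      obtain ⟨r₀, hr₀, h⟩ := G.exists_volume_compare u hε
      have hev : ∀ᶠ r in 𝓝[>] (0 : ℝ), 0 < r ∧ r < r₀ :=
        Ioo_mem_nhdsGT hr₀
      constructor
      · refine le_of_tendsto hu ?_
        filter_upwards [hev] with r hr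
        rw [ENNReal.div_le_iff (hpos r hr.1) (hfin r), mul_assoc, happ]
        exact (h _ (Metric.closedBall_subset_closedBall hr.2.le)).1
      · have hu' := ENNReal.Tendsto.const_mul (a := ENNReal.ofReal (1 + ε) ^ 2) hu
          (Or.inr (by simp))
        refine ge_of_tendsto hu' ?_
        filter_upwards [hev] with r hr
        rw [← mul_div_assoc, ENNReal.le_div_iff_mul_le (Or.inl (hpos r hr.1)) (Or.inl (hfin r)),
          happ]
        exact (h _ (Metric.closedBall_subset_closedBall hr.2.le)).2
    have hlim : ∀ a : ENNReal, Tendsto (fun ε : ℝ => ENNReal.ofReal (1 + ε) ^ 2 * a) (𝓝[>] 0) (𝓝 a) := by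
      intro a
      have h1 : Tendsto (fun ε : ℝ => ENNReal.ofReal (1 + ε) ^ 2) (𝓝[>] 0) (𝓝 1) := by
        have : Continuous fun ε : ℝ => ENNReal.ofReal (1 + ε) ^ 2 :=
          (ENNReal.continuous_pow 2).comp (ENNReal.continuous_ofReal.comp (by fun_prop))
        simpa using (this.tendsto 0).mono_left nhdsWithin_le_nhds
      simpa using ENNReal.Tendsto.mul_const (b := a) h1 (Or.inl one_ne_zero)
    have hself : ∀ᶠ ε in 𝓝[>] (0 : ℝ), 0 < ε := self_mem_nhdsWithin
    exact le_antisymm (ge_of_tendsto (hlim _) (hself.mono fun ε hε => (key ε hε).1))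
      (ge_of_tendsto (hlim _) (hself.mono fun ε hε => (key ε hε).2))
  rw [← Measure.withDensity_rnDeriv_eq μ₁ volume hac]
  exact withDensity_congr_ae hrn

/-- **Area formula** for a graph patch. -/
lemma restrict_range_eq_map : μHE[2].restrict (Set.range G.F) =
    ((volume : Measure E2).withDensity fun u => ENNReal.ofReal (G.jac u)).map G.F := by
  rw [← comap_eq_withDensity, G.measurableEmbedding_F.map_comap]

end GraphPatch

/-! ### Integrals over the surface in a chart -/

namespace IsChart

variable {Γ : Set E3} {ν : E3 → E3} {G : GraphPatch} {δ : ℝ}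

lemma inter_ball_eq (hG : IsChart Γ ν G δ) :
    Γ ∩ Metric.ball G.center δ = Set.range G.F ∩ Metric.ball G.center δ := by
  ext y
  constructor
  · rintro ⟨hy, hyb⟩
    exact ⟨⟨G.coords y, G.F_coords_of_height ((hG.mem_iff y hyb).1 hy)⟩, hyb⟩
  · rintro ⟨⟨u, rfl⟩, hyb⟩
    exact ⟨(hG.mem_iff _ hyb).2 (G.height_F u), hyb⟩

lemma F_mem (hG : IsChart Γ ν G δ) {u : E2} (hu : G.F u ∈ Metric.ball G.center δ) : G.F u ∈ Γ :=
  (hG.mem_iff _ hu).2 (G.height_F u)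

lemma F_coords (hG : IsChart Γ ν G δ) {y : E3} (hy : y ∈ Metric.ball G.center δ) (hyΓ : y ∈ Γ) :
    G.F (G.coords y) = y := G.F_coords_of_height ((hG.mem_iff y hy).1 hyΓ)

lemma center_mem (hG : IsChart Γ ν G δ) : G.center ∈ Γ := by
  have := hG.F_mem (u := 0) (by rw [G.F_zero]; exact Metric.mem_ball_self hG.pos)
  rwa [G.F_zero] at this

variable {V : Type*} [NormedAddCommGroup V] [NormedSpace ℝ V]

lemma restrict_inter_ball (hG : IsChart Γ ν G δ) :
    (μHE[2].restrict Γ).restrict (Metric.ball G.center δ) =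
      (μHE[2].restrict (Set.range G.F)).restrict (Metric.ball G.center δ) := by
  rw [Measure.restrict_restrict Metric.isOpen_ball.measurableSet,
    Measure.restrict_restrict Metric.isOpen_ball.measurableSet, Set.inter_comm, hG.inter_ball_eq,
    Set.inter_comm]

lemma integrable_iff (hG : IsChart Γ ν G δ) {φ : E3 → V}
    (hφ : ∀ y ∉ Metric.ball G.center δ, φ y = 0) :
    IntegrableOn φ Γ μHE[2] ↔ Integrable (fun u => G.jac u • φ (G.F u)) := by
  have h1 : IntegrableOn φ Γ μHE[2] ↔
      IntegrableOn φ (Metric.ball G.center δ) (μHE[2].restrict Γ) :=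
    (integrableOn_iff_integrable_of_support_subset fun y hy => by
      by_contra h; exact hy (hφ y h)).symm
  have h2 : Integrable φ (μHE[2].restrict (Set.range G.F)) ↔
      IntegrableOn φ (Metric.ball G.center δ) (μHE[2].restrict (Set.range G.F)) :=
    (integrableOn_iff_integrable_of_support_subset fun y hy => by
      by_contra h; exact hy (hφ y h)).symm
  rw [h1, IntegrableOn, hG.restrict_inter_ball, ← IntegrableOn, ← h2, G.restrict_range_eq_map,
    G.measurableEmbedding_F.integrable_map_iff,
    integrable_withDensity_iff_integrable_smul' (by
      exact ENNReal.measurable_ofReal.comp G.continuous_jac.measurable) (by simp)]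
  simp only [ENNReal.toReal_ofReal (G.jac_pos _).le, Function.comp_apply]

lemma integral_eq (hG : IsChart Γ ν G δ) {φ : E3 → V}
    (hφ : ∀ y ∉ Metric.ball G.center δ, φ y = 0) :
    ∫ y in Γ, φ y ∂μHE[2] = ∫ u, G.jac u • φ (G.F u) := by
  have h1 : ∀ μ : Measure E3, ∫ y, φ y ∂μ = ∫ y in Metric.ball G.center δ, φ y ∂μ := fun μ =>
    (setIntegral_eq_integral_of_forall_compl_eq_zero fun y hy => hφ y hy).symm
  rw [h1, hG.restrict_inter_ball, ← h1, G.restrict_range_eq_map,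
    G.measurableEmbedding_F.integral_map, integral_withDensity_eq_integral_toReal_smul
      (f := fun u => ENNReal.ofReal (G.jac u))
      (ENNReal.measurable_ofReal.comp G.continuous_jac.measurable) (by simp)]
  simp only [ENNReal.toReal_ofReal (G.jac_pos _).le]

lemma _root_.Poroelastic.GraphPatch.preimage_ball_subset (G : GraphPatch) (r : ℝ) :
    G.F ⁻¹' Metric.ball G.center r ⊆ Metric.closedBall 0 r := fun u hu => by
  have h1 := G.norm_sub_le_norm_F_sub u 0
  rw [G.F_zero, sub_zero] at h1
  have h2 : ‖G.F u - G.center‖ < r := mem_ball_iff_norm.1 hu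
  exact mem_closedBall_zero_iff.2 (h1.trans h2.le)

lemma measure_ball_lt_top (hG : IsChart Γ ν G δ) {r : ℝ} (hr : r < δ) :
    μHE[2] (Γ ∩ Metric.ball G.center r) < ⊤ := by
  have hsub : Γ ∩ Metric.ball G.center r ⊆ Set.range G.F ∩ Metric.ball G.center r := fun y hy =>
    ⟨(hG.inter_ball_eq.subset ⟨hy.1, Metric.ball_subset_ball hr.le hy.2⟩).1, hy.2⟩
  refine (measure_mono hsub).trans_lt ?_
  have hm : MeasurableSet (Metric.ball G.center r) := Metric.isOpen_ball.measurableSet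
  rw [Set.inter_comm, ← Measure.restrict_apply hm, G.restrict_range_eq_map,
    Measure.map_apply G.continuous_F.measurable hm, withDensity_apply _ (G.continuous_F.measurable hm)]
  have hs := G.preimage_ball_subset r
  refine (lintegral_mono_set hs).trans_lt ?_
  have hi : IntegrableOn G.jac (Metric.closedBall (0 : E2) r) :=
    G.continuous_jac.continuousOn.integrableOn_compact (isCompact_closedBall (0 : E2) r)
  exact Integrable.lintegral_lt_top hi

end IsChart

/-! ### Compact surfaces covered by graph charts -/

/-- A compact surface with charts at all of its points. -/
structure IsChartedSurface (Γ : Set E3) (ν : E3 → E3) : Prop where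
  isCompact : IsCompact Γ
  exists_chart : ∀ x ∈ Γ, ∃ (G : GraphPatch) (δ : ℝ), G.center = x ∧ IsChart Γ ν G δ

lemma IsSmoothBoundedDomain.isChartedSurface {Ω : Set E3} (hΩ : IsSmoothBoundedDomain Ω)
    {ν : E3 → E3} (hν : IsOutwardUnitNormal Ω ν) : IsChartedSurface (frontier Ω) ν :=
  ⟨hΩ.isBounded.isCompact_closure.of_isClosed_subset isClosed_frontier frontier_subset_closure,
    fun _ hx => exists_isChart hΩ hν hx⟩

namespace IsChartedSurface

variable {Γ : Set E3} {ν : E3 → E3}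

lemma measurableSet (hS : IsChartedSurface Γ ν) : MeasurableSet Γ :=
  hS.isCompact.isClosed.measurableSet

lemma measure_lt_top (hS : IsChartedSurface Γ ν) : μHE[2] Γ < ⊤ := by
  refine hS.isCompact.measure_lt_top_of_nhdsWithin fun x hx => ?_
  obtain ⟨G, δ, rfl, hG⟩ := hS.exists_chart x hx
  refine ⟨Γ ∩ Metric.ball G.center (δ / 2), ?_, hG.measure_ball_lt_top (by linarith [hG.pos])⟩
  exact inter_mem_nhdsWithin _ (Metric.ball_mem_nhds _ (by linarith [hG.pos]))

/-- Either the two-dimensional measure of a set vanishes or its zero-dimensional measure is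
infinite, and the latter fails for a point. -/
lemma measure_singleton (x : E3) : μHE[2] ({x} : Set E3) = 0 := by
  simp only [Measure.euclideanHausdorffMeasure_def, Measure.smul_apply, ENNReal.smul_def, smul_eq_mul]
  have := Measure.hausdorffMeasure_zero_or_top (X := E3) (d₁ := 0) (d₂ := 2) (by norm_num) {x}
  rcases this with h | h
  · have h2 : (μH[((2 : ℕ) : ℝ)] : Measure E3) {x} = 0 := by exact_mod_cast h
    rw [h2, mul_zero]
  · simp at h

end IsChartedSurface

/-! ### Integration in the plane with a point singularity -/

lemma locallyIntegrable_inv_norm : LocallyIntegrable (fun u : E2 => ‖u‖⁻¹) := by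
  refine locallyIntegrable_of_norm_le_rpow (C := 1) (α := 1) (by simp) (by simp)
    (Eventually.of_forall fun u => ?_) (measurable_norm.inv.aestronglyMeasurable)
  rw [Real.rpow_neg_one, one_mul, norm_inv, norm_norm]

lemma aestronglyMeasurable_of_continuousOn_compl {X V : Type*} [TopologicalSpace X] [T1Space X]
    [MeasurableSpace X] [OpensMeasurableSpace X] [SecondCountableTopology X]
    [TopologicalSpace V] [TopologicalSpace.PseudoMetrizableSpace V]
    {μ : Measure X} {c : X} (hμ : μ {c} = 0) {g : X → V} (hg : ContinuousOn g {c}ᶜ) :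
    AEStronglyMeasurable g μ := by
  have h : AEStronglyMeasurable g (μ.restrict {c}ᶜ) :=
    hg.aestronglyMeasurable (measurableSet_singleton c).compl
  rwa [Measure.restrict_eq_self_of_ae_mem (by
    show {c}ᶜ ∈ ae μ; exact compl_mem_ae_iff.2 hμ)] at h

lemma integrable_of_le_inv_norm {V : Type*} [NormedAddCommGroup V] {g : E2 → V} {c : E2}
    {C R : ℝ} (hg : ContinuousOn g {c}ᶜ) (hb : ∀ u ≠ c, ‖g u‖ ≤ C / ‖u - c‖)
    (hs : ∀ u, R ≤ ‖u - c‖ → g u = 0) : Integrable g := by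
  have h1 : IntegrableOn (fun u : E2 => C * ‖u‖⁻¹) (Metric.closedBall 0 R) :=
    ((locallyIntegrable_inv_norm.integrableOn_isCompact (isCompact_closedBall 0 R))).const_mul C
  rw [← integrable_indicator_iff Metric.isClosed_closedBall.measurableSet] at h1
  have h2 := h1.comp_sub_right c
  refine h2.mono' (aestronglyMeasurable_of_continuousOn_compl (by simp) hg) ?_
  have hc : ∀ᵐ u : E2, u ≠ c := by
    rw [ae_iff]; simp
  filter_upwards [hc] with u hu
  by_cases hR : R ≤ ‖u - c‖
  · rw [hs u hR, norm_zero]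
    by_cases hm : u - c ∈ Metric.closedBall (0 : E2) R
    · rw [Set.indicator_of_mem hm, ← div_eq_mul_inv]
      exact (norm_nonneg _).trans (hb u hu)
    · rw [Set.indicator_of_notMem hm]
  · rw [Set.indicator_of_mem (by simpa using (not_le.1 hR).le), ← div_eq_mul_inv]
    exact hb u hu

/-- The integral of a derivative of a compactly supported function vanishes, even if the function
has a bounded singularity at one point. -/
lemma integral_fderiv_eq_zero_of_punctured {f : E2 → ℂ} {c v : E2} {M R : ℝ}
    (hd : ∀ u ≠ c, DifferentiableAt ℝ f u) (hb : ∀ u, ‖f u‖ ≤ M)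
    (hs : ∀ u, R ≤ ‖u - c‖ → f u = 0) (hi : Integrable fun u => fderiv ℝ f u v) :
    ∫ u, fderiv ℝ f u v = 0 := by
  let χ : ContDiffBump (0 : E2) := ⟨1, 2, one_pos, one_lt_two⟩
  have hχd : ContDiff ℝ 1 χ := χ.contDiff
  obtain ⟨K, hK⟩ := (χ.hasCompactSupport.fderiv (𝕜 := ℝ)).exists_bound_of_continuous
    (hχd.continuous_fderiv (by norm_num))
  -- The cut-off removes the ε-disc around the singular point, which makes integration by parts
  -- legitimate; its gradient is O(1/ε) and lives in the disc of radius 2ε.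
  let η : ℝ → E2 → ℝ := fun ε u => 1 - χ (ε⁻¹ • (u - c))
  have hηd : ∀ ε u, HasFDerivAt (η ε) (-(ε⁻¹ • fderiv ℝ χ (ε⁻¹ • (u - c)))) u := by
    intro ε u
    have h1 : HasFDerivAt (fun u : E2 => ε⁻¹ • (u - c)) (ε⁻¹ • ContinuousLinearMap.id ℝ E2) u :=
      ((hasFDerivAt_id u).sub_const c).const_smul ε⁻¹
    have h2 := ((hχd.differentiable (by norm_num) (ε⁻¹ • (u - c))).hasFDerivAt.comp u h1).const_sub 1
    refine h2.congr_fderiv ?_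
    ext w; simp
  have hη0 : ∀ ε > 0, ∀ u, ‖u - c‖ ≤ ε → η ε u = 0 := by
    intro ε hε u hu
    have : χ (ε⁻¹ • (u - c)) = 1 := χ.one_of_mem_closedBall (by
      rw [mem_closedBall_zero_iff, norm_smul, norm_inv, Real.norm_of_nonneg hε.le]
      show ε⁻¹ * ‖u - c‖ ≤ 1
      rw [inv_mul_le_iff₀ hε, mul_one]; exact hu)
    simp only [η, this, sub_self]
  have hη1 : ∀ ε u, |η ε u| ≤ 1 := fun ε u => by
    rw [abs_le]; constructor <;> simp only [η] <;> linarith [χ.nonneg (x := ε⁻¹ • (u - c)), χ.le_one (x := ε⁻¹ • (u - c))]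
  have hηts : ∀ ε > 0, ∀ u ∈ tsupport (η ε), u ≠ c := by
    rintro ε hε u hu rfl
    refine notMem_tsupport_iff_eventuallyEq.2 ?_ hu
    filter_upwards [Metric.closedBall_mem_nhds u hε] with w hw
    exact hη0 ε hε w (mem_closedBall_iff_norm.1 hw)
  have hηfar : ∀ ε > 0, ∀ u, 2 * ε < ‖u - c‖ → fderiv ℝ (η ε) u = 0 := by
    intro ε hε u hu
    have : η ε =ᶠ[𝓝 u] fun _ => 1 := by
      have hopen : IsOpen {w : E2 | 2 * ε < ‖w - c‖} :=
        isOpen_lt continuous_const (by fun_prop)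
      filter_upwards [hopen.mem_nhds hu] with w hw
      have : χ (ε⁻¹ • (w - c)) = 0 := χ.zero_of_le_dist (by
        rw [dist_zero_right, norm_smul, norm_inv, Real.norm_of_nonneg hε.le]
        show 2 ≤ ε⁻¹ * ‖w - c‖
        rw [le_inv_mul_iff₀ hε, mul_comm]; exact hw.le)
      simp only [η, this, sub_zero]
    rw [this.fderiv_eq]
    simp
  have hfm : AEStronglyMeasurable f volume := aestronglyMeasurable_of_continuousOn_compl (c := c)
    (by simp) fun u hu => (hd u hu).continuousAt.continuousWithinAt
  have hM : 0 ≤ M := (norm_nonneg _).trans (hb 0)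
  have hcs : HasCompactSupport f := HasCompactSupport.intro (isCompact_closedBall c R) fun u hu =>
    hs u (by rw [mem_closedBall_iff_norm] at hu; exact (not_le.1 hu).le)
  have hfi : Integrable f := by
    have h0 : IntegrableOn f (Metric.closedBall c R) :=
      Measure.integrableOn_of_bounded (M := M) measure_closedBall_lt_top.ne hfm
        (Eventually.of_forall hb)
    exact (integrableOn_iff_integrable_of_support_subset fun u hu => by
      by_contra h
      exact hu (hs u (by rw [mem_closedBall_iff_norm] at h; exact (not_le.1 h).le))).1 h0
  have hηc : ∀ ε, Continuous (η ε) := fun ε =>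
    continuous_iff_continuousAt.2 fun u => (hηd ε u).continuousAt
  have hηfc : ∀ ε, Continuous fun u => fderiv ℝ (η ε) u v := fun ε => by
    have : (fun u => fderiv ℝ (η ε) u v) = fun u => -(ε⁻¹ • fderiv ℝ χ (ε⁻¹ • (u - c)) v) := by
      funext u; rw [(hηd ε u).fderiv]; simp
    rw [this]
    have h3 := hχd.continuous_fderiv (by norm_num)
    exact (((h3.comp (by fun_prop)).clm_apply continuous_const).const_smul ε⁻¹).neg
  have hKb : ∀ ε > 0, ∀ u, ‖fderiv ℝ (η ε) u v‖ ≤ ε⁻¹ * K * ‖v‖ := by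
    intro ε hε u
    rw [(hηd ε u).fderiv, neg_apply, norm_neg, smul_apply, norm_smul, norm_inv,
      Real.norm_of_nonneg hε.le, mul_assoc]
    gcongr
    exact (ContinuousLinearMap.le_opNorm _ _).trans (by gcongr; exact hK _)
  have hint1 : ∀ ε > 0, Integrable fun u => fderiv ℝ (η ε) u v • f u := fun ε hε =>
    hfi.bdd_smul (ε⁻¹ * K * ‖v‖) ((hηfc ε).aestronglyMeasurable)
      (Eventually.of_forall (hKb ε hε))
  have hparts : ∀ ε > 0, ∫ u, η ε u • fderiv ℝ f u v = -∫ u, fderiv ℝ (η ε) u v • f u := by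
    intro ε hε
    refine integral_smul_fderiv_eq_neg_fderiv_smul_of_integrable (hint1 ε hε) ?_ ?_ ?_ ?_
    · have h1 : Integrable (fun u => η ε u • fderiv ℝ f u v) := hi.bdd_smul 1 ((hηc ε).aestronglyMeasurable) (Eventually.of_forall (hη1 ε))
      exact h1
    · have h1 : Integrable (fun u => η ε u • f u) := hfi.bdd_smul 1 ((hηc ε).aestronglyMeasurable) (Eventually.of_forall (hη1 ε))
      exact h1
    · exact fun u _ => (hηd ε u).differentiableAt
    · exact fun u hu => hd u (hηts ε hε u hu)
  have hK0 : 0 ≤ K := (norm_nonneg _).trans (hK 0)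
  -- The bound K‖v‖M/ε on the integrand times the area 4πε² of the disc.
  have hbound : ∀ ε > 0, ‖∫ u, fderiv ℝ (η ε) u v • f u‖ ≤ ε * (4 * Real.pi * K * ‖v‖ * M) := by
    intro ε hε
    have h0 : ∫ u, fderiv ℝ (η ε) u v • f u =
        ∫ u in Metric.closedBall c (2 * ε), fderiv ℝ (η ε) u v • f u :=
      (setIntegral_eq_integral_of_forall_compl_eq_zero fun u hu => by
        rw [mem_closedBall_iff_norm] at hu
        rw [hηfar ε hε u (not_le.1 hu)]; simp).symm
    rw [h0]
    refine (norm_setIntegral_le_of_norm_le_const (C := ε⁻¹ * K * ‖v‖ * M) measure_closedBall_lt_top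
      fun u _ => ?_).trans (le_of_eq ?_)
    · rw [norm_smul]
      exact mul_le_mul (hKb ε hε u) (hb u) (norm_nonneg _) (by positivity)
    · rw [Measure.real, EuclideanSpace.volume_closedBall_fin_two, ENNReal.toReal_mul,
        ENNReal.toReal_pow, ENNReal.toReal_ofReal (by positivity),
        ENNReal.toReal_ofReal Real.pi_pos.le]
      field_simp
      ring
  have hlim1 : Tendsto (fun ε => ∫ u, η ε u • fderiv ℝ f u v) (𝓝[>] 0)
      (𝓝 (∫ u, fderiv ℝ f u v)) := by
    refine tendsto_integral_filter_of_dominated_convergence (fun u => ‖fderiv ℝ f u v‖) ?_ ?_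
      hi.norm ?_
    · exact Eventually.of_forall fun ε => (hηc ε).aestronglyMeasurable.smul hi.aestronglyMeasurable
    · refine Eventually.of_forall fun ε => Eventually.of_forall fun u => ?_
      rw [norm_smul]
      exact mul_le_of_le_one_left (norm_nonneg _) (hη1 ε u)
    · have hc : ∀ᵐ u : E2, u ≠ c := by rw [ae_iff]; simp
      filter_upwards [hc] with u hu
      refine tendsto_const_nhds.congr' ?_
      have hpos : 0 < ‖u - c‖ / 2 := by
        have := norm_pos_iff.2 (sub_ne_zero.2 hu); positivity
      filter_upwards [Ioo_mem_nhdsGT hpos] with ε hε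
      have : χ (ε⁻¹ • (u - c)) = 0 := χ.zero_of_le_dist (by
        rw [dist_zero_right, norm_smul, norm_inv, Real.norm_of_nonneg hε.1.le]
        show 2 ≤ ε⁻¹ * ‖u - c‖
        rw [le_inv_mul_iff₀ hε.1]; linarith [hε.2])
      simp only [η, this, sub_zero, one_smul]
  have hlim2 : Tendsto (fun ε => ∫ u, η ε u • fderiv ℝ f u v) (𝓝[>] 0) (𝓝 0) := by
    have h0 : Tendsto (fun ε : ℝ => ε * (4 * Real.pi * K * ‖v‖ * M)) (𝓝[>] 0) (𝓝 0) := by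
      have : Continuous fun ε : ℝ => ε * (4 * Real.pi * K * ‖v‖ * M) := by fun_prop
      simpa using (this.tendsto 0).mono_left nhdsWithin_le_nhds
    refine squeeze_zero_norm' ?_ h0
    filter_upwards [self_mem_nhdsWithin] with ε hε
    rw [hparts ε hε, norm_neg]
    exact hbound ε hε
  exact tendsto_nhds_unique hlim1 hlim2

/-! ### Functions with a mild point singularity -/

/-- `f` is `C¹` away from `z`, bounded near `z`, and its derivative is `O(1/|y - z|)`. -/
structure IsMild {E : Type*} [NormedAddCommGroup E] [NormedSpace ℝ E] (z : E) (f : E → ℂ) :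
    Prop where
  contDiffOn : ContDiffOn ℝ 1 f {z}ᶜ
  bound : ∀ R : ℝ, ∃ C, 0 ≤ C ∧ ∀ y ≠ z, ‖y - z‖ ≤ R →
    ‖f y‖ ≤ C ∧ ‖fderiv ℝ f y‖ ≤ C / ‖y - z‖

namespace IsMild

section

variable {E : Type*} [NormedAddCommGroup E] [NormedSpace ℝ E] {z : E} {f g : E → ℂ}

lemma differentiableAt (hf : IsMild z f) {y : E} (hy : y ≠ z) : DifferentiableAt ℝ f y :=
  (hf.contDiffOn.contDiffAt (isOpen_compl_singleton.mem_nhds hy)).differentiableAt (by norm_num)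

lemma continuousOn_fderiv (hf : IsMild z f) : ContinuousOn (fderiv ℝ f) {z}ᶜ :=
  hf.contDiffOn.continuousOn_fderiv_of_isOpen isOpen_compl_singleton (by norm_num)

lemma mul (hf : IsMild z f) (hg : IsMild z g) : IsMild z fun y => f y * g y := by
  refine ⟨hf.contDiffOn.mul hg.contDiffOn, fun R => ?_⟩
  obtain ⟨C, hC, h⟩ := hf.bound R
  obtain ⟨D, hD, h'⟩ := hg.bound R
  refine ⟨2 * (C * D), by positivity, fun y hy hyR => ?_⟩
  obtain ⟨h1, h2⟩ := h y hy hyR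
  obtain ⟨h3, h4⟩ := h' y hy hyR
  constructor
  · rw [norm_mul]
    calc _ ≤ C * D := by gcongr
      _ ≤ _ := by nlinarith [mul_nonneg hC hD]
  · rw [fderiv_fun_mul (hf.differentiableAt hy) (hg.differentiableAt hy)]
    refine (norm_add_le _ _).trans ?_
    rw [norm_smul, norm_smul]
    calc _ ≤ C * (D / ‖y - z‖) + D * (C / ‖y - z‖) := by gcongr
      _ = _ := by ring

lemma of_contDiff [FiniteDimensional ℝ E] (hf : ContDiff ℝ 1 f) (z : E) : IsMild z f := by
  refine ⟨hf.contDiffOn, fun R => ?_⟩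
  have : ProperSpace E := FiniteDimensional.proper ℝ E
  obtain ⟨C, hC⟩ := (isCompact_closedBall z R).exists_bound_of_continuousOn hf.continuous.continuousOn
  obtain ⟨D, hD⟩ := (isCompact_closedBall z R).exists_bound_of_continuousOn
    (hf.continuous_fderiv (by norm_num)).continuousOn
  refine ⟨max C 0 + max D 0 * max R 0, by positivity, fun y hy hyR => ?_⟩
  have hym : y ∈ Metric.closedBall z R := mem_closedBall_iff_norm.2 hyR
  have hpos : 0 < ‖y - z‖ := norm_pos_iff.2 (sub_ne_zero.2 hy)
  constructor
  · have h1 := hC y hym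
    have h2 : 0 ≤ max D 0 * max R 0 := by positivity
    linarith [le_max_left C 0]
  · rw [le_div_iff₀ hpos]
    have h1 : ‖fderiv ℝ f y‖ * ‖y - z‖ ≤ max D 0 * max R 0 := by
      gcongr
      · exact (hD y hym).trans (le_max_left _ _)
      · exact hyR.trans (le_max_left _ _)
    linarith [le_max_right C 0]

end

section plane

variable {f : E2 → ℂ} {c : E2} {R : ℝ}

lemma fderiv_eq_zero_of_far (hs : ∀ u, R ≤ ‖u - c‖ → f u = 0) (u : E2) (hu : R + 1 ≤ ‖u - c‖) :
    fderiv ℝ f u = 0 := by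
  have : f =ᶠ[𝓝 u] fun _ => 0 := by
    have ho : IsOpen {w : E2 | R < ‖w - c‖} := isOpen_lt continuous_const (by fun_prop)
    filter_upwards [ho.mem_nhds (show R < ‖u - c‖ by linarith)] with w hw
    exact hs w (le_of_lt hw)
  rw [this.fderiv_eq]; simp

lemma integrable_fderiv (hf : IsMild c f) (hs : ∀ u, R ≤ ‖u - c‖ → f u = 0) (v : E2) :
    Integrable fun u => fderiv ℝ f u v := by
  obtain ⟨C, hC, h⟩ := hf.bound (R + 1)
  refine integrable_of_le_inv_norm (c := c) (C := C * ‖v‖) (R := R + 1) ?_ ?_ ?_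
  · exact hf.continuousOn_fderiv.clm_apply continuousOn_const
  · intro u hu
    by_cases hR : ‖u - c‖ ≤ R + 1
    · refine (ContinuousLinearMap.le_opNorm _ _).trans ?_
      rw [mul_div_right_comm]
      gcongr
      exact (h u hu hR).2
    · rw [fderiv_eq_zero_of_far hs u (not_le.1 hR).le]
      simp only [zero_apply, norm_zero]
      positivity
  · intro u hu
    rw [fderiv_eq_zero_of_far hs u hu]; rfl

lemma integral_fderiv (hf : IsMild c f) (hs : ∀ u, R ≤ ‖u - c‖ → f u = 0) (v : E2) :
    ∫ u, fderiv ℝ f u v = 0 := by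
  obtain ⟨C, hC, h⟩ := hf.bound R
  refine integral_fderiv_eq_zero_of_punctured (c := c) (M := max C ‖f c‖) (R := R)
    (fun u hu => hf.differentiableAt hu) (fun u => ?_) hs (hf.integrable_fderiv hs v)
  by_cases hu : u = c
  · rw [hu]; exact le_max_right _ _
  by_cases hR : ‖u - c‖ ≤ R
  · exact (h u hu hR).1.trans (le_max_left _ _)
  · rw [hs u (not_le.1 hR).le, norm_zero]; exact hC.trans (le_max_left _ _)

end plane

end IsMild

namespace GraphPatch

variable (G : GraphPatch)

lemma norm_sub_coords_le (u : E2) (z : E3) : ‖u - G.coords z‖ ≤ ‖G.F u - z‖ := by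
  have h := G.norm_coordsL_le (G.F u - z)
  have e : G.coordsL (G.F u - z) = u - G.coords z := by
    conv_rhs => rw [← G.coords_F u]
    simp only [coords, ← map_sub]
    congr 1
    abel
  rwa [e] at h

lemma F_ne_of_ne_coords {u : E2} {z : E3} (hu : u ≠ G.coords z) : G.F u ≠ z := by
  rintro rfl
  exact hu (G.coords_F u).symm

lemma exists_bound_DF : ∃ K : ℝ, 0 ≤ K ∧ ∀ u, ‖G.DF u‖ ≤ K := by
  obtain ⟨K, hK, h⟩ := G.exists_bound_fderiv_h
  refine ⟨1 + K, by positivity, fun u => ContinuousLinearMap.opNorm_le_bound _ (by positivity) fun v => ?_⟩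
  have hb : ‖G.b 2‖ = 1 := G.b.orthonormal.1 2
  rw [DF_apply, add_mul, one_mul]
  refine (norm_add_le _ _).trans ?_
  rw [norm_emb, norm_smul, hb, mul_one]
  gcongr
  exact (ContinuousLinearMap.le_opNorm _ _).trans (by gcongr; exact h u)

lemma norm_F_sub_le_of_far (z : E3) : ∃ K : ℝ, 0 ≤ K ∧ ∀ u, ‖G.F u - z‖ ≤ K * ‖u - G.coords z‖ + ‖G.F (G.coords z) - z‖ := by
  obtain ⟨K, hK⟩ := G.exists_lipschitz_F
  refine ⟨K, K.2, fun u => ?_⟩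
  have h1 := hK u (G.coords z)
  rw [dist_eq_norm, dist_eq_norm] at h1
  have : G.F u - z = (G.F u - G.F (G.coords z)) + (G.F (G.coords z) - z) := by abel
  rw [this]
  exact (norm_add_le _ _).trans (by gcongr)

end GraphPatch

/-- The point z need not lie on the graph: in the plane the pole moves to its tangential
coordinates, and `norm_sub_coords_le` shows that the singularity does not get worse. -/
lemma IsMild.comp_F {z : E3} {f : E3 → ℂ} (hf : IsMild z f) (G : GraphPatch) :
    IsMild (G.coords z) fun u => f (G.F u) := by
  have hmaps : Set.MapsTo G.F {G.coords z}ᶜ {z}ᶜ := fun u hu => G.F_ne_of_ne_coords hu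
  refine ⟨hf.contDiffOn.comp (G.contDiff_F.of_le (by norm_num)).contDiffOn hmaps, fun R => ?_⟩
  obtain ⟨K, hK, hKb⟩ := G.norm_F_sub_le_of_far z
  obtain ⟨D, hD, hDb⟩ := G.exists_bound_DF
  obtain ⟨C, hC, h⟩ := hf.bound (K * R + ‖G.F (G.coords z) - z‖)
  refine ⟨C * (1 + D), by positivity, fun u hu huR => ?_⟩
  have hpos : 0 < ‖u - G.coords z‖ := norm_pos_iff.2 (sub_ne_zero.2 hu)
  obtain ⟨h1, h2⟩ := h (G.F u) (hmaps hu) ((hKb u).trans (by gcongr))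
  constructor
  · nlinarith
  · have hd : HasFDerivAt (fun u => f (G.F u)) ((fderiv ℝ f (G.F u)).comp (G.DF u)) u :=
      (hf.differentiableAt (hmaps hu)).hasFDerivAt.comp u (G.hasFDerivAt_F u)
    rw [hd.fderiv]
    calc _ ≤ ‖fderiv ℝ f (G.F u)‖ * ‖G.DF u‖ := ContinuousLinearMap.opNorm_comp_le _ _
      _ ≤ C / ‖G.F u - z‖ * D := by gcongr; exact hDb u
      _ ≤ C / ‖u - G.coords z‖ * (1 + D) := by
          have := G.norm_sub_coords_le u z
          gcongr
          linarith
      _ = _ := by ring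

/-! ### The surface Stokes theorem -/

/-- After b₂ = b₀ × b₁ is inserted, the triple products reduce by the orthonormality of b₀ and b₁.
The orientation of the chart enters the Stokes theorem here. -/
lemma IsChart.cross_tangents {Γ : Set E3} {ν : E3 → E3} {G : GraphPatch} {δ : ℝ}
    (hG : IsChart Γ ν G δ) (u : E2) :
    crossProduct (cvec (G.DF u (EuclideanSpace.single 0 1)))
      (cvec (G.DF u (EuclideanSpace.single 1 1))) = cvec (G.normalVec u) := by
  have hc := hG.cross
  have hn : ∀ i j : Fin 3, G.b i 0 * G.b j 0 + G.b i 1 * G.b j 1 + G.b i 2 * G.b j 2 =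
      if i = j then (1 : ℝ) else 0 := fun i j => by
    rw [← G.inner_b i j, PiLp.inner_apply, Fin.sum_univ_three]
    simp [mul_comm]
  have h00 := hn 0 0
  have h11 := hn 1 1
  have h01 := hn 0 1
  simp at h00 h11 h01
  have c0 := congrFun hc 0
  have c1 := congrFun hc 1
  have c2 := congrFun hc 2
  simp [crossProduct, cvec] at c0 c1 c2
  norm_cast at c0 c1 c2
  simp only [GraphPatch.DF_apply, GraphPatch.emb_apply, GraphPatch.fderiv_h_apply,
    GraphPatch.normalVec]
  ext i
  fin_cases i
  · simp [crossProduct, cvec]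
    norm_cast
    rw [← c0, ← c1, ← c2]
    generalize G.slope 0 u = s
    generalize G.slope 1 u = t
    linear_combination s * G.b 1 0 * h01 - s * G.b 0 0 * h11 + t * G.b 0 0 * h01 - t * G.b 1 0 * h00
  · simp [crossProduct, cvec]
    norm_cast
    rw [← c0, ← c1, ← c2]
    generalize G.slope 0 u = s
    generalize G.slope 1 u = t
    linear_combination s * G.b 1 1 * h01 - s * G.b 0 1 * h11 + t * G.b 0 1 * h01 - t * G.b 1 1 * h00
  · simp [crossProduct, cvec]
    norm_cast
    rw [← c0, ← c1, ← c2]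
    generalize G.slope 0 u = s
    generalize G.slope 1 u = t
    linear_combination s * G.b 1 2 * h01 - s * G.b 0 2 * h11 + t * G.b 0 2 * h01 - t * G.b 1 2 * h00

lemma cross_cross_apply (a b g : C3) (k : Fin 3) : crossProduct (crossProduct a b) g k =
    (a ⬝ᵥ g) * b k - (b ⬝ᵥ g) * a k := by
  fin_cases k <;> simp [crossProduct, dotProduct, Fin.sum_univ_three] <;> ring

lemma cvec_dotProduct_grad (v : E3) (f : E3 → ℂ) (z : E3) :
    cvec v ⬝ᵥ grad f z = fderiv ℝ f z v := by
  rw [fderiv_apply_eq_sum_pd]; rfl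

lemma cvec_smul (t : ℝ) (v : E3) : cvec (t • v) = (t : ℂ) • cvec v := by
  ext i; simp [cvec]

namespace GraphPatch

variable (G : GraphPatch)

/-- A coordinate of a tangent vector field. -/
def tangent (v : E2) (k : Fin 3) (u : E2) : ℂ := cvec (G.DF u v) k

lemma contDiff_tangent (v : E2) (k : Fin 3) : ContDiff ℝ 1 (G.tangent v k) := by
  have h1 : ContDiff ℝ 1 fun u => G.DF u v := G.contDiff_DF.clm_apply contDiff_const
  have h2 : ContDiff ℝ 1 fun u => G.DF u v k :=
    (EuclideanSpace.proj k : E3 →L[ℝ] ℝ).contDiff.comp h1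
  exact Complex.ofRealCLM.contDiff.comp h2

lemma fderiv_tangent_symm (v w : E2) (k : Fin 3) (u : E2) :
    fderiv ℝ (G.tangent v k) u w = fderiv ℝ (G.tangent w k) u v := by
  have key : ∀ v w : E2, fderiv ℝ (G.tangent v k) u w =
      ((fderiv ℝ (fderiv ℝ G.h) u w v * G.b 2 k : ℝ) : ℂ) := by
    intro v w
    have h1 : HasFDerivAt (fderiv ℝ G.h) (fderiv ℝ (fderiv ℝ G.h) u) u :=
      ((G.contDiff.fderiv_right (m := 1) (by norm_num)).differentiable (by norm_num) u).hasFDerivAt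
    have h2 := ((h1.clm_apply (hasFDerivAt_const v u)).mul_const (G.b 2 k)).const_add (G.emb v k)
    have h3 := Complex.ofRealCLM.hasFDerivAt.comp u h2
    have e : G.tangent v k = Complex.ofRealCLM ∘ fun u => G.emb v k + fderiv ℝ G.h u v * G.b 2 k := by
      funext u; simp [tangent, cvec, DF_apply]
    rw [e, h3.fderiv]
    simp [mul_comm]
  rw [key, key, (G.contDiff.contDiffAt.isSymmSndFDerivAt (by simp)).eq]

end GraphPatch

lemma fderiv_eq_zero_of_notMem_closedBall {f : E3 → ℂ} {x : E3} {r : ℝ}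
    (hs : ∀ y ∉ Metric.ball x r, f y = 0) {y : E3} (hy : y ∉ Metric.closedBall x r) :
    fderiv ℝ f y = 0 := by
  have : f =ᶠ[𝓝 y] fun _ => 0 := by
    filter_upwards [Metric.isClosed_closedBall.isOpen_compl.mem_nhds hy] with w hw
    exact hs w fun h => hw (Metric.ball_subset_closedBall h)
  rw [this.fderiv_eq]; simp

lemma cross_grad_eq_zero {f : E3 → ℂ} {n y : E3} (h : fderiv ℝ f y = 0) (k : Fin 3) :
    crossProduct (cvec n) (grad f y) k = 0 := by
  have : grad f y = 0 := by ext i; simp [grad, pd, h]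
  rw [this, map_zero]; rfl

namespace IsChart

variable {Γ : Set E3} {ν : E3 → E3} {G : GraphPatch} {δ : ℝ}

/-- In the chart, the Jacobian times ν × ∇f is (F₀ × F₁) × ∇f = ∂₀(f∘F) F₁ − ∂₁(f∘F) F₀, where F₀,
F₁ are the partial derivatives of F. By symmetry of second derivatives this is ∂₀(f F₁) − ∂₁(f F₀),
and both terms integrate to zero because f F_a is mild with compact support. -/
lemma integral_cross_grad (hG : IsChart Γ ν G δ) {z : E3} {f : E3 → ℂ} (hf : IsMild z f) {r : ℝ}
    (hr : r < δ) (hs : ∀ y ∉ Metric.ball G.center r, f y = 0) (k : Fin 3) :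
    IntegrableOn (fun y => crossProduct (cvec (ν y)) (grad f y) k) Γ μHE[2] ∧
      ∫ y in Γ, crossProduct (cvec (ν y)) (grad f y) k ∂μHE[2] = 0 := by
  set c := G.coords z with hc
  set φ : E3 → ℂ := fun y => crossProduct (cvec (ν y)) (grad f y) k with hφ
  have hφ0 : ∀ y ∉ Metric.ball G.center δ, φ y = 0 := fun y hy =>
    cross_grad_eq_zero (fderiv_eq_zero_of_notMem_closedBall hs
      fun h => hy (Metric.closedBall_subset_ball hr h)) k
  let e : Fin 2 → E2 := fun a => EuclideanSpace.single a 1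
  let A : Fin 2 → E2 → ℂ := fun a u => f (G.F u) * G.tangent (e a) k u
  have hA : ∀ a, IsMild c (A a) := fun a =>
    (hf.comp_F G).mul (IsMild.of_contDiff (G.contDiff_tangent _ k) c)
  have hAs : ∀ a u, r + ‖c‖ ≤ ‖u - c‖ → A a u = 0 := by
    intro a u hu
    have h1 : r ≤ ‖u‖ := by linarith [norm_sub_le u c]
    have h2 := G.norm_sub_le_norm_F_sub u 0
    rw [G.F_zero, sub_zero] at h2
    simp only [A]
    rw [hs _ (by rw [mem_ball_iff_norm, not_lt]; exact h1.trans h2), zero_mul]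
  have hpt : ∀ u ≠ c, G.jac u • φ (G.F u) =
      fderiv ℝ (A 1) u (e 0) - fderiv ℝ (A 0) u (e 1) := by
    intro u hu
    have h1 : G.jac u • φ (G.F u) =
        crossProduct (cvec (G.normalVec u)) (grad f (G.F u)) k := by
      by_cases hb : G.F u ∈ Metric.ball G.center δ
      · have hj : (G.jac u : ℂ) ≠ 0 := Complex.ofReal_ne_zero.2 (G.jac_pos u).ne'
        simp only [hφ]
        rw [hG.normal _ hb (hG.F_mem hb), G.coords_F, cvec_smul, map_smul, LinearMap.smul_apply,
          Pi.smul_apply, smul_eq_mul, Complex.real_smul, Complex.ofReal_inv,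
          mul_inv_cancel_left₀ hj]
      · rw [hφ0 _ hb, smul_zero, cross_grad_eq_zero]
        exact fderiv_eq_zero_of_notMem_closedBall hs
          fun h => hb (Metric.closedBall_subset_ball hr h)
    have hd : DifferentiableAt ℝ f (G.F u) := hf.differentiableAt (G.F_ne_of_ne_coords hu)
    have hd1 : HasFDerivAt (fun u => f (G.F u)) ((fderiv ℝ f (G.F u)).comp (G.DF u)) u :=
      hd.hasFDerivAt.comp u (G.hasFDerivAt_F u)
    have hAd : ∀ a v, fderiv ℝ (A a) u v = f (G.F u) * fderiv ℝ (G.tangent (e a) k) u v +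
        G.tangent (e a) k u * fderiv ℝ f (G.F u) (G.DF u v) := by
      intro a v
      have h2 := hd1.mul ((G.contDiff_tangent (e a) k).differentiable (by norm_num) u).hasFDerivAt
      have h3 : fderiv ℝ (A a) u = _ := h2.fderiv
      rw [h3]
      simp
    rw [h1, ← hG.cross_tangents, cross_cross_apply, cvec_dotProduct_grad, cvec_dotProduct_grad,
      hAd, hAd, G.fderiv_tangent_symm (e 0) (e 1)]
    simp only [GraphPatch.tangent, e]
    ring
  have hae : (fun u => G.jac u • φ (G.F u)) =ᵐ[volume]
      fun u => fderiv ℝ (A 1) u (e 0) - fderiv ℝ (A 0) u (e 1) := by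
    have : ∀ᵐ u : E2, u ≠ c := by rw [ae_iff]; simp
    filter_upwards [this] with u hu using hpt u hu
  have hi1 := (hA 1).integrable_fderiv (hAs 1) (e 0)
  have hi0 := (hA 0).integrable_fderiv (hAs 0) (e 1)
  refine ⟨(hG.integrable_iff hφ0).2 ((hi1.sub hi0).congr hae.symm), ?_⟩
  rw [hG.integral_eq hφ0, integral_congr_ae hae, integral_sub hi1 hi0,
    (hA 1).integral_fderiv (hAs 1), (hA 0).integral_fderiv (hAs 0), sub_zero]

end IsChart

namespace IsChartedSurface

variable {Γ : Set E3} {ν : E3 → E3}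

lemma cross_grad_mul_add {f χ : E3 → ℂ} {y n : E3} (hf : DifferentiableAt ℝ f y)
    (hχ : DifferentiableAt ℝ χ y) (k : Fin 3) :
    crossProduct (cvec n) (grad f y) k = crossProduct (cvec n) (grad (fun w => χ w * f w) y) k +
      crossProduct (cvec n) (grad (fun w => (1 - χ w) * f w) y) k := by
  have : grad f y = grad (fun w => χ w * f w) y + grad (fun w => (1 - χ w) * f w) y := by
    ext i
    simp only [grad, pd, Pi.add_apply]
    rw [fderiv_fun_mul hχ hf, fderiv_fun_mul (hχ.const_sub 1) hf, fderiv_const_sub]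
    simp
    ring
  rw [this, map_add]; rfl

/-- A complex-valued smooth bump function. -/
lemma exists_bump (x : E3) {δ : ℝ} (hδ : 0 < δ) : ∃ χ : E3 → ℂ, ContDiff ℝ ∞ χ ∧
    (∀ y ∈ Metric.ball x (δ / 2), χ y = 1) ∧ (∀ y ∉ Metric.ball x (3 * δ / 4), χ y = 0) ∧
    ∀ y, ‖χ y‖ ≤ 1 := by
  let χ : ContDiffBump x := ⟨δ / 2, 3 * δ / 4, by positivity, by linarith⟩
  refine ⟨fun y => (χ y : ℂ), Complex.ofRealCLM.contDiff.comp χ.contDiff, fun y hy => ?_,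
    fun y hy => ?_, fun y => ?_⟩
  · simp only [χ.one_of_mem_closedBall (Metric.ball_subset_closedBall hy), Complex.ofReal_one]
  · simp only [χ.zero_of_le_dist (not_lt.1 hy), Complex.ofReal_zero]
  · rw [Complex.norm_real, Real.norm_of_nonneg χ.nonneg]; exact χ.le_one

/-- The surface integral of `ν × ∇ f` vanishes, also for `f` with a mild point singularity. -/
lemma integral_cross_grad (hS : IsChartedSurface Γ ν) {z : E3} {f : E3 → ℂ} (hf : IsMild z f)
    (k : Fin 3) :
    IntegrableOn (fun y => crossProduct (cvec (ν y)) (grad f y) k) Γ μHE[2] ∧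
      ∫ y in Γ, crossProduct (cvec (ν y)) (grad f y) k ∂μHE[2] = 0 := by
  choose! G δ hGc hG using hS.exists_chart
  obtain ⟨t, htΓ, ht⟩ := hS.isCompact.elim_nhds_subcover (fun x => Metric.ball x (δ x / 2))
    fun x hx => Metric.ball_mem_nhds x (half_pos (hG x hx).pos)
  have hne : ∀ᵐ y ∂(μHE[2].restrict Γ), y ≠ z := by
    refine ae_restrict_of_ae ?_
    rw [ae_iff]; simpa using measure_singleton z
  -- In place of a partition of unity, f is peeled one chart at a time: `s` indexes the balls of the
  -- cover on which f may still be nonzero, and (1 − χ)f vanishes on one ball more.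
  suffices H : ∀ s : Finset E3, s ⊆ t → ∀ f : E3 → ℂ, IsMild z f →
      (∀ y ∈ (⋃ x ∈ t \ s, Metric.ball x (δ x / 2)), f y = 0) →
      IntegrableOn (fun y => crossProduct (cvec (ν y)) (grad f y) k) Γ μHE[2] ∧
      ∫ y in Γ, crossProduct (cvec (ν y)) (grad f y) k ∂μHE[2] = 0 from
    H t subset_rfl f hf (by simp)
  intro s
  induction s using Finset.induction_on with
  | empty =>
    intro _ f hf h0
    rw [Finset.sdiff_empty] at h0
    have hz : ∀ y ∈ Γ, crossProduct (cvec (ν y)) (grad f y) k = 0 := by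
      intro y hy
      refine cross_grad_eq_zero ?_ k
      have ho : IsOpen (⋃ x ∈ t, Metric.ball x (δ x / 2)) :=
        isOpen_biUnion fun _ _ => Metric.isOpen_ball
      have : f =ᶠ[𝓝 y] fun _ => 0 := by
        filter_upwards [ho.mem_nhds (ht hy)] with w hw using h0 w hw
      rw [this.fderiv_eq]; simp
    refine ⟨?_, setIntegral_eq_zero_of_forall_eq_zero hz⟩
    exact integrableOn_zero.congr_fun (fun y hy => (hz y hy).symm) hS.measurableSet
  | insert x s hx ih =>
    intro hst f hf h0
    have hxt : x ∈ t := hst (Finset.mem_insert_self x s)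
    have hGx := hG x (htΓ x hxt)
    obtain ⟨χ, hχ, hχ1, hχ0, -⟩ := exists_bump x hGx.pos
    have hχ' : ContDiff ℝ 1 χ := hχ.of_le (by exact_mod_cast le_top)
    have i1 := hGx.integral_cross_grad ((IsMild.of_contDiff hχ' z).mul hf)
      (r := 3 * δ x / 4) (by linarith [hGx.pos])
      (fun y hy => by rw [hχ0 y (by rwa [hGc x (htΓ x hxt)] at hy), zero_mul]) k
    have i2 := ih ((Finset.subset_insert x s).trans hst) (fun y => (1 - χ y) * f y)
      ((IsMild.of_contDiff (contDiff_const.sub hχ') z).mul hf) (fun y hy => by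
        simp only [Set.mem_iUnion, Finset.mem_sdiff, exists_prop] at hy h0
        obtain ⟨w, ⟨hw, hws⟩, hyw⟩ := hy
        by_cases hwx : w = x
        · rw [hχ1 y (hwx ▸ hyw), sub_self, zero_mul]
        · rw [h0 y ⟨w, ⟨hw, by simp [hwx, hws]⟩, hyw⟩, mul_zero])
    have hae : (fun y => crossProduct (cvec (ν y)) (grad f y) k) =ᵐ[μHE[2].restrict Γ]
        fun y => crossProduct (cvec (ν y)) (grad (fun w => χ w * f w) y) k +
          crossProduct (cvec (ν y)) (grad (fun w => (1 - χ w) * f w) y) k := by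
      filter_upwards [hne] with y hy
      exact cross_grad_mul_add (hf.differentiableAt hy) (hχ'.differentiable (by norm_num) y) k
    refine ⟨(i1.1.add i2.1).congr hae.symm, ?_⟩
    rw [integral_congr_ae hae, integral_add i1.1 i2.1, i1.2, i2.2, add_zero]

/-! ### Weak singularities are integrable -/

lemma continuousOn_normal (hS : IsChartedSurface Γ ν) : ContinuousOn ν Γ := by
  intro x hx
  obtain ⟨G, δ, rfl, hG⟩ := hS.exists_chart x hx
  have hc : Continuous fun y => (G.jac (G.coords y))⁻¹ • G.normalVec (G.coords y) := by
    have h1 := G.contDiff_coords.continuous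
    exact ((G.continuous_jac.comp h1).inv₀ fun y => (G.jac_pos _).ne').smul
      (G.continuous_normalVec.comp h1)
  refine hc.continuousWithinAt.congr_of_eventuallyEq ?_
    (hG.normal _ (Metric.mem_ball_self hG.pos) hx)
  filter_upwards [inter_mem_nhdsWithin Γ (Metric.ball_mem_nhds G.center hG.pos)] with y hy
  exact hG.normal y hy.2 hy.1

lemma norm_normal (hS : IsChartedSurface Γ ν) {x : E3} (hx : x ∈ Γ) : ‖ν x‖ = 1 := by
  obtain ⟨G, δ, rfl, hG⟩ := hS.exists_chart x hx
  rw [hG.normal _ (Metric.mem_ball_self hG.pos) hx, norm_smul, G.norm_normalVec, norm_inv,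
    Real.norm_of_nonneg (G.jac_pos _).le, inv_mul_cancel₀ (G.jac_pos _).ne']

lemma integrableOn_inv_norm_sub (hS : IsChartedSurface Γ ν) {z : E3} (hz : z ∈ Γ) :
    IntegrableOn (fun y => ‖y - z‖⁻¹) Γ μHE[2] := by
  obtain ⟨G, δ, rfl, hG⟩ := hS.exists_chart z hz
  have hm : Measurable fun y : E3 => ‖y - G.center‖⁻¹ := by fun_prop
  have hball := Metric.isOpen_ball (x := G.center) (ε := δ / 2)
  have h1 : IntegrableOn ((Metric.ball G.center (δ / 2)).indicator fun y => ‖y - G.center‖⁻¹) Γ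
      μHE[2] := by
    rw [hG.integrable_iff fun y hy => Set.indicator_of_notMem
      (fun h => hy (Metric.ball_subset_ball (by linarith [hG.pos]) h)) _]
    obtain ⟨J, hJ⟩ := (isCompact_closedBall (0 : E2) (δ / 2)).exists_bound_of_continuousOn
      G.continuous_jac.continuousOn
    have h2 : IntegrableOn (fun u : E2 => J * ‖u‖⁻¹) (Metric.closedBall 0 (δ / 2)) :=
      (locallyIntegrable_inv_norm.integrableOn_isCompact (isCompact_closedBall _ _)).const_mul J
    rw [← integrable_indicator_iff Metric.isClosed_closedBall.measurableSet] at h2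
    refine h2.mono' ?_ (Eventually.of_forall fun u => ?_)
    · exact (G.continuous_jac.measurable.smul ((hm.indicator hball.measurableSet).comp
        G.continuous_F.measurable)).aestronglyMeasurable
    · by_cases hu : G.F u ∈ Metric.ball G.center (δ / 2)
      · have hu' := G.preimage_ball_subset _ hu
        rw [Set.indicator_of_mem hu, Set.indicator_of_mem hu', norm_smul, norm_inv, norm_norm]
        have h3 := G.norm_sub_le_norm_F_sub u 0
        rw [G.F_zero, sub_zero] at h3
        by_cases h0 : u = 0
        · simp [h0, G.F_zero]
        have := norm_pos_iff.2 h0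
        gcongr
        · exact (norm_nonneg _).trans (hJ u hu')
        · exact hJ u hu'
      · rw [Set.indicator_of_notMem hu, smul_zero, norm_zero]
        refine Set.indicator_nonneg (fun w hw => ?_) u
        exact mul_nonneg ((norm_nonneg _).trans (hJ w hw)) (by positivity)
  have h2 : IntegrableOn ((Metric.ball G.center (δ / 2))ᶜ.indicator fun y => ‖y - G.center‖⁻¹) Γ
      μHE[2] := by
    refine Measure.integrableOn_of_bounded (M := (δ / 2)⁻¹) hS.measure_lt_top.ne
      (hm.indicator hball.measurableSet.compl).aestronglyMeasurable
      (Eventually.of_forall fun y => ?_)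
    have hp := hG.pos
    by_cases hy : y ∈ Metric.ball G.center (δ / 2)
    · rw [Set.indicator_of_notMem (by simpa using hy), norm_zero]
      positivity
    · rw [Set.indicator_of_mem (by simpa using hy), norm_inv, norm_norm]
      rw [mem_ball_iff_norm, not_lt] at hy
      gcongr
  have h3 := h1.add h2
  rwa [Set.indicator_self_add_compl] at h3

end IsChartedSurface

/-! ### Local estimates for singular kernels on a graph patch -/

lemma tendsto_setIntegral_punctured {X V : Type*} [MeasurableSpace X] [NormedAddCommGroup V]
    [NormedSpace ℝ V] {μ : Measure X} {c : X} (hc : ∀ᵐ x ∂μ, x ≠ c) {g : X → V}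
    (hg : Integrable g μ) {S : ℝ → Set X} (hS : ∀ ε, MeasurableSet (S ε))
    (hev : ∀ x ≠ c, ∀ᶠ ε in 𝓝[>] (0 : ℝ), x ∈ S ε) :
    Tendsto (fun ε => ∫ x in S ε, g x ∂μ) (𝓝[>] 0) (𝓝 (∫ x, g x ∂μ)) := by
  simp_rw [← integral_indicator (hS _)]
  refine tendsto_integral_filter_of_dominated_convergence (fun x => ‖g x‖) ?_ ?_ hg.norm ?_
  · exact Eventually.of_forall fun ε => hg.aestronglyMeasurable.indicator (hS ε)
  · exact Eventually.of_forall fun ε => Eventually.of_forall fun x => norm_indicator_le_norm_self _ _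
  · filter_upwards [hc] with x hx
    refine tendsto_const_nhds.congr' ?_
    filter_upwards [hev x hx] with ε hε
    rw [Set.indicator_of_mem hε]

lemma IsSing.contDiffOn {m : ℕ} {H : E3 → ℂ} (hH : IsSing m H) : ContDiffOn ℝ ∞ H {0}ᶜ := hH.1

lemma IsSing.continuousOn_fderiv {m : ℕ} {H : E3 → ℂ} (hH : IsSing m H) :
    ContinuousOn (fderiv ℝ H) {0}ᶜ :=
  hH.contDiffOn.continuousOn_fderiv_of_isOpen isOpen_compl_singleton (by simp)

/-- Mean value inequality; the segment has to keep the distance r from the singularity, since the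
derivative is only bounded by r^{-(m+1)} there. -/
lemma IsSing.exists_lipschitz_segment {m : ℕ} {H : E3 → ℂ} (hH : IsSing m H) (R : ℝ) :
    ∃ C, 0 ≤ C ∧ ∀ r > 0, ∀ p q : E3, (∀ z ∈ segment ℝ p q, r ≤ ‖z‖ ∧ ‖z‖ ≤ R) →
      ‖H p - H q‖ ≤ C / r ^ (m + 1) * ‖p - q‖ := by
  obtain ⟨C, hC, h⟩ := hH.bound_fderiv R
  refine ⟨C, hC, fun r hr p q hpq => ?_⟩
  have hne : ∀ z ∈ segment ℝ p q, z ≠ 0 := fun z hz h0 => by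
    have := (hpq z hz).1
    rw [h0, norm_zero] at this
    linarith
  refine Convex.norm_image_sub_le_of_norm_fderiv_le (𝕜 := ℝ) (s := segment ℝ p q)
    (fun z hz => hH.differentiableAt (hne z hz)) (fun z hz => ?_) (convex_segment p q)
    (right_mem_segment ℝ p q) (left_mem_segment ℝ p q)
  refine (h z (hne z hz) (hpq z hz).2).trans ?_
  gcongr
  exact (hpq z hz).1

lemma norm_clm_le_sum (T : E3 →L[ℝ] ℂ) : ‖T‖ ≤ ∑ i, ‖T (EuclideanSpace.single i 1)‖ := by
  have h := norm_fderiv_le_sum_pd T 0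
  rw [T.fderiv] at h
  simpa only [pd, T.fderiv] using h

lemma IsSing.exists_lipschitz_segment_fderiv {m : ℕ} {H : E3 → ℂ} (hH : IsSing m H) (R : ℝ) :
    ∃ C, 0 ≤ C ∧ ∀ r > 0, ∀ p q : E3, (∀ z ∈ segment ℝ p q, r ≤ ‖z‖ ∧ ‖z‖ ≤ R) →
      ‖fderiv ℝ H p - fderiv ℝ H q‖ ≤ C / r ^ (m + 2) * ‖p - q‖ := by
  choose C hC h using fun i => (hH.pd i).exists_lipschitz_segment R
  refine ⟨∑ i, C i, Finset.sum_nonneg fun i _ => hC i, fun r hr p q hpq => ?_⟩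
  refine (norm_clm_le_sum _).trans ?_
  rw [Finset.sum_div, Finset.sum_mul]
  exact Finset.sum_le_sum fun i _ => h i r hr p q hpq

lemma fderiv_neg_of_even {H : E3 → ℂ} (he : ∀ z, H (-z) = H z) (z : E3) :
    fderiv ℝ H (-z) = -fderiv ℝ H z := by
  have h1 : (fun z => H (-z)) = H := funext he
  have h2 : ∀ i, pd i H (-z) = -pd i H z := fun i => by
    have := pd_comp_neg i H z
    rw [h1] at this
    rw [this, neg_neg]
  ext v
  rw [neg_apply, fderiv_apply_eq_sum_pd, fderiv_apply_eq_sum_pd, ← Finset.sum_neg_distrib]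
  exact Finset.sum_congr rfl fun i _ => by rw [h2, mul_neg]

namespace GraphPatch

variable (G : GraphPatch)

lemma _root_.Poroelastic.exists_lipschitz_of_hasCompactSupport {E V : Type*}
    [NormedAddCommGroup E] [NormedSpace ℝ E] [NormedAddCommGroup V] [NormedSpace ℝ V] {g : E → V}
    (hg : ContDiff ℝ 1 g) (hc : HasCompactSupport g) :
    ∃ K : ℝ, 0 ≤ K ∧ (∀ u, ‖fderiv ℝ g u‖ ≤ K) ∧ ∀ u v, ‖g u - g v‖ ≤ K * ‖u - v‖ := by
  obtain ⟨C, hC⟩ := (hc.fderiv (𝕜 := ℝ)).exists_bound_of_continuous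
    (hg.continuous_fderiv (by norm_num))
  have hC' : ∀ u, ‖fderiv ℝ g u‖ ≤ max C 0 := fun u => (hC u).trans (le_max_left _ _)
  exact ⟨max C 0, le_max_right _ _, hC', fun u v =>
    Convex.norm_image_sub_le_of_norm_fderiv_le (s := Set.univ) (𝕜 := ℝ)
    (fun x _ => hg.differentiable (by norm_num) x) (fun x _ => hC' x)
    convex_univ (Set.mem_univ v) (Set.mem_univ u)⟩

lemma exists_lipschitz_fderiv_h :
    ∃ K : ℝ, 0 ≤ K ∧ ∀ u v, ‖fderiv ℝ G.h u - fderiv ℝ G.h v‖ ≤ K * ‖u - v‖ := by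
  obtain ⟨K, hK, -, h⟩ := exists_lipschitz_of_hasCompactSupport
    (G.contDiff.fderiv_right (m := 1) (by norm_num)) (G.compact.fderiv (𝕜 := ℝ))
  exact ⟨K, hK, h⟩

lemma exists_lipschitz_DF : ∃ K : ℝ, 0 ≤ K ∧ ∀ u v, ‖G.DF u - G.DF v‖ ≤ K * ‖u - v‖ := by
  obtain ⟨K, hK, h⟩ := G.exists_lipschitz_fderiv_h
  refine ⟨K, hK, fun u v => ?_⟩
  have e : G.DF u - G.DF v = (fderiv ℝ G.h u - fderiv ℝ G.h v).smulRight (G.b 2) := by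
    ext1 w; simp [DF_apply, sub_smul]
  rw [e, ContinuousLinearMap.norm_smulRight_apply, G.b.orthonormal.1 2, mul_one]
  exact h u v

lemma exists_quadratic_h : ∃ K : ℝ, 0 ≤ K ∧ ∀ u, |G.h u| ≤ K * ‖u‖ ^ 2 := by
  obtain ⟨K, hK, h⟩ := G.exists_lipschitz_fderiv_h
  refine ⟨K, hK, fun u => ?_⟩
  have h1 := Convex.norm_image_sub_le_of_norm_fderiv_le (𝕜 := ℝ) (f := G.h)
    (s := Metric.closedBall 0 ‖u‖) (C := K * ‖u‖) (x := 0) (y := u)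
    (fun x _ => G.contDiff.differentiable (by norm_num) x) (fun x hx => ?_)
    (convex_closedBall 0 ‖u‖) (by simp) (by simp)
  · rw [G.h_zero, sub_zero, sub_zero] at h1
    rw [sq, ← mul_assoc]; exact h1
  · have h2 := h x 0
    rw [G.fderiv_zero, sub_zero, sub_zero] at h2
    exact h2.trans (by gcongr; simpa using hx)

lemma F_zero_sub (w : E2) : G.F 0 - G.F w = G.emb (-w) + (-G.h w) • G.b 2 := by
  rw [F_sub, G.h_zero, zero_sub, zero_sub]

lemma F_neg_sub_zero (w : E2) : G.F (-w) - G.F 0 = G.emb (-w) + G.h (-w) • G.b 2 := by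
  rw [F_sub, G.h_zero, sub_zero, sub_zero]

/-- Such a segment is vertical over one point w of the tangent plane, hence it stays away from the
origin by at least |w|. -/
lemma segment_bounds {w : E2} {s t T : ℝ} (hs : |s| ≤ T) (ht : |t| ≤ T) {z : E3}
    (hz : z ∈ segment ℝ (G.emb w + s • G.b 2) (G.emb w + t • G.b 2)) :
    ‖w‖ ≤ ‖z‖ ∧ ‖z‖ ≤ ‖w‖ + T := by
  obtain ⟨a, b, ha, hb, hab, rfl⟩ := hz
  have e : a • (G.emb w + s • G.b 2) + b • (G.emb w + t • G.b 2) =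
      G.emb w + (a * s + b * t) • G.b 2 := by
    have : b = 1 - a := by linarith
    subst this
    module
  rw [e]
  have hb2 : ‖G.b 2‖ = 1 := G.b.orthonormal.1 2
  constructor
  · refine (pow_le_pow_iff_left₀ (norm_nonneg _) (norm_nonneg _) two_ne_zero).1 ?_
    rw [norm_emb_add_sq]
    exact le_add_of_nonneg_right (sq_nonneg _)
  · refine (norm_add_le _ _).trans ?_
    rw [norm_emb, norm_smul, hb2, mul_one, Real.norm_eq_abs]
    gcongr
    calc _ ≤ |a * s| + |b * t| := abs_add_le _ _
      _ = a * |s| + b * |t| := by rw [abs_mul, abs_mul, abs_of_nonneg ha, abs_of_nonneg hb]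
      _ ≤ a * T + b * T := by gcongr
      _ = T := by rw [← add_mul, hab, one_mul]

/-- The kernel `H` against a density, in the parameter plane, with pole at the center. -/
def polarized (H : E3 → ℂ) (ρ : E2 → ℂ) (w : E2) : ℂ := H (G.F 0 - G.F w) * ρ w

variable {G} {H : E3 → ℂ} {ρ : E2 → ℂ}

lemma F_sub_ne_zero {u v : E2} (h : u ≠ v) : G.F u - G.F v ≠ 0 :=
  sub_ne_zero.2 fun e => h (G.injective_F e)

lemma hasFDerivAt_polarized {m : ℕ} (hH : IsSing m H) (hρ : ContDiff ℝ 1 ρ) {w : E2} (hw : w ≠ 0) :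
    HasFDerivAt (G.polarized H ρ) (H (G.F 0 - G.F w) • fderiv ℝ ρ w -
      ρ w • (fderiv ℝ H (G.F 0 - G.F w)).comp (G.DF w)) w := by
  have h1 := (hH.differentiableAt (F_sub_ne_zero (G := G) hw.symm)).hasFDerivAt.comp w
    ((G.hasFDerivAt_F w).const_sub (G.F 0))
  have h2 := h1.mul (hρ.differentiable (by norm_num) w).hasFDerivAt
  refine h2.congr_fderiv ?_
  ext v
  simp
  ring

lemma contDiffOn_polarized {m : ℕ} (hH : IsSing m H) (hρ : ContDiff ℝ 1 ρ) :
    ContDiffOn ℝ 1 (G.polarized H ρ) {0}ᶜ := by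
  have h1 : ContDiff ℝ 1 fun w => G.F 0 - G.F w :=
    contDiff_const.sub (G.contDiff_F.of_le (by norm_num))
  exact ((hH.contDiffOn.of_le (by exact_mod_cast le_top)).comp h1.contDiffOn
    fun w hw => F_sub_ne_zero (Ne.symm hw)).mul hρ.contDiffOn

lemma exists_bounds_density (hρ : ContDiff ℝ 1 ρ) (hρc : HasCompactSupport ρ) :
    ∃ M : ℝ, 0 ≤ M ∧ (∀ u, ‖ρ u‖ ≤ M) ∧ (∀ u, ‖fderiv ℝ ρ u‖ ≤ M) ∧
      ∀ u v, ‖ρ u - ρ v‖ ≤ M * ‖u - v‖ := by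
  obtain ⟨A, hA⟩ := hρc.exists_bound_of_continuous hρ.continuous
  obtain ⟨B, hB0, hB, hBl⟩ := exists_lipschitz_of_hasCompactSupport hρ hρc
  refine ⟨max A B, hB0.trans (le_max_right _ _), fun u => (hA u).trans (le_max_left _ _),
    fun u => (hB u).trans (le_max_right _ _), fun u v => (hBl u v).trans ?_⟩
  gcongr
  exact le_max_right _ _

lemma norm_F_sub_le_mul : ∃ K : ℝ, 0 ≤ K ∧ ∀ u v, ‖G.F u - G.F v‖ ≤ K * ‖u - v‖ := by
  obtain ⟨K, hK⟩ := G.exists_lipschitz_F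
  exact ⟨K, K.2, fun u v => by simpa only [dist_eq_norm] using hK u v⟩

lemma exists_bound_fderiv_polarized (hH : IsSing 1 H) (hρ : ContDiff ℝ 1 ρ)
    (hρc : HasCompactSupport ρ) (R : ℝ) : ∃ C, 0 ≤ C ∧ ∀ w ≠ 0, ‖w‖ ≤ R →
      ‖fderiv ℝ (G.polarized H ρ) w‖ ≤ C / ‖w‖ ^ 2 := by
  obtain ⟨M, hM, hM1, hM2, -⟩ := exists_bounds_density hρ hρc
  obtain ⟨K, hK, hKF⟩ := norm_F_sub_le_mul (G := G)
  obtain ⟨D, hD, hDF⟩ := G.exists_bound_DF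
  obtain ⟨A, hA, hAb⟩ := hH.bound (K * R)
  obtain ⟨B, hB, hBb⟩ := hH.bound_fderiv (K * R)
  refine ⟨|R| * A * M + M * B * D, by positivity, fun w hw hwR => ?_⟩
  have hpos : 0 < ‖w‖ := norm_pos_iff.2 hw
  have hne := F_sub_ne_zero (G := G) hw.symm
  have h1 : ‖G.F 0 - G.F w‖ ≤ K * R := (hKF 0 w).trans (by rw [zero_sub, norm_neg]; gcongr)
  have h2 : ‖w‖ ≤ ‖G.F 0 - G.F w‖ := by simpa using G.norm_sub_le_norm_F_sub 0 w
  rw [(hasFDerivAt_polarized hH hρ hw).fderiv]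
  refine (norm_sub_le _ _).trans ?_
  rw [norm_smul, norm_smul, add_div]
  gcongr ?_ + ?_
  · calc _ ≤ A / ‖w‖ ^ 1 * M := by
          gcongr
          · exact (hAb _ hne h1).trans (by gcongr)
          · exact hM2 w
      _ = ‖w‖ * A * M / ‖w‖ ^ 2 := by field_simp
      _ ≤ _ := by gcongr; exact hwR.trans (le_abs_self R)
  · calc _ ≤ M * (B / ‖w‖ ^ 2 * D) := by
          gcongr
          · exact hM1 w
          · refine (ContinuousLinearMap.opNorm_comp_le _ _).trans ?_
            gcongr
            · exact (hBb _ hne h1).trans (by gcongr)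
            · exact hDF w
      _ = _ := by ring

/-- The odd part of the singularity of an even kernel on a graph is mild. -/
lemma isMild_polarized_sub (hH : IsSing 1 H) (he : ∀ z, H (-z) = H z) (hρ : ContDiff ℝ 1 ρ)
    (hρc : HasCompactSupport ρ) :
    IsMild 0 fun w => G.polarized H ρ w - G.polarized H ρ (-w) := by
  have hA := contDiffOn_polarized (G := G) hH hρ
  refine ⟨hA.sub (hA.comp contDiff_neg.contDiffOn fun w hw => by simpa using hw), fun R => ?_⟩
  obtain ⟨M, hM, hM1, hM2, hM3⟩ := exists_bounds_density hρ hρc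
  obtain ⟨K, hK, hKF⟩ := norm_F_sub_le_mul (G := G)
  obtain ⟨D, hD, hDF⟩ := G.exists_bound_DF
  obtain ⟨D2, hD2, hDF2⟩ := G.exists_lipschitz_DF
  obtain ⟨Q, hQ, hQh⟩ := G.exists_quadratic_h
  set R' := |R| + Q * R ^ 2 with hR'
  obtain ⟨A, hA, hAb⟩ := hH.bound R'
  obtain ⟨B, hB, hBb⟩ := hH.bound_fderiv R'
  obtain ⟨A2, hA2, hAl⟩ := hH.exists_lipschitz_segment R'
  obtain ⟨B2, hB2, hBl⟩ := hH.exists_lipschitz_segment_fderiv R'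
  -- The first bracket is the bound for the value; the remaining summands bound the four pieces of
  -- the derivative.
  refine ⟨(A2 * (2 * Q) * M + A * (2 * M)) +
    (2 * (A * M) + (B2 * (2 * Q) * D * M + B * (2 * D2) * M + B * D * (2 * M))), by positivity,
    fun w hw hwR => ?_⟩
  rw [sub_zero] at hwR ⊢
  have hpos : 0 < ‖w‖ := norm_pos_iff.2 hw
  have hRpos : 0 ≤ R := hpos.le.trans hwR
  set p := G.F 0 - G.F w with hp
  set q := G.F (-w) - G.F 0 with hq
  have hseg : ∀ z ∈ segment ℝ p q, ‖w‖ ≤ ‖z‖ ∧ ‖z‖ ≤ R' := by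
    intro z hz
    rw [hp, hq, F_zero_sub, F_neg_sub_zero] at hz
    have h1 : |-G.h w| ≤ Q * R ^ 2 := by rw [abs_neg]; exact (hQh w).trans (by gcongr)
    have h2 : |G.h (-w)| ≤ Q * R ^ 2 := (hQh (-w)).trans (by rw [norm_neg]; gcongr)
    have h3 := G.segment_bounds h1 h2 hz
    rw [norm_neg] at h3
    exact ⟨h3.1, h3.2.trans (by rw [hR']; gcongr; exact hwR.trans (le_abs_self R))⟩
  -- The chords from F(w) to F(0) and from F(0) to F(−w) have the same tangential part and differ
  -- only by heights, which are quadratic. This gains one power of |w| against the singularity of H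
  -- and of its derivative.
  have hpq : ‖p - q‖ ≤ 2 * Q * ‖w‖ ^ 2 := by
    have e : p - q = -(G.h w + G.h (-w)) • G.b 2 := by
      rw [hp, hq, F_zero_sub, F_neg_sub_zero]; module
    rw [e, norm_smul, G.b.orthonormal.1 2, mul_one, norm_neg, Real.norm_eq_abs]
    have h1 := hQh w
    have h2 := hQh (-w)
    rw [norm_neg] at h2
    linarith [abs_add_le (G.h w) (G.h (-w))]
  have hpb := hseg p (left_mem_segment ℝ p q)
  have hqb := hseg q (right_mem_segment ℝ p q)
  have hp0 : p ≠ 0 := F_sub_ne_zero hw.symm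
  have hq0 : q ≠ 0 := F_sub_ne_zero (neg_ne_zero.2 hw)
  have hHq : ‖H q‖ ≤ A / ‖w‖ := by
    refine (hAb q hq0 hqb.2).trans ?_
    rw [pow_one]; gcongr; exact hqb.1
  have hHp : ‖H p‖ ≤ A / ‖w‖ := by
    refine (hAb p hp0 hpb.2).trans ?_
    rw [pow_one]; gcongr; exact hpb.1
  have hDq : ‖fderiv ℝ H q‖ ≤ B / ‖w‖ ^ 2 := by
    refine (hBb q hq0 hqb.2).trans ?_
    gcongr
    exact hqb.1
  have hHpq : ‖H p - H q‖ ≤ A2 * (2 * Q) := by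
    refine (hAl _ hpos p q hseg).trans ?_
    calc _ ≤ A2 / ‖w‖ ^ 2 * (2 * Q * ‖w‖ ^ 2) := by gcongr
      _ = _ := by field_simp
  have hDpq : ‖fderiv ℝ H p - fderiv ℝ H q‖ ≤ B2 * (2 * Q) / ‖w‖ := by
    refine (hBl _ hpos p q hseg).trans ?_
    calc _ ≤ B2 / ‖w‖ ^ 3 * (2 * Q * ‖w‖ ^ 2) := by gcongr
      _ = _ := by field_simp
  have hww : ‖w - -w‖ = 2 * ‖w‖ := by
    rw [sub_neg_eq_add, ← two_smul ℝ w, norm_smul]; norm_num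
  have hρw : ‖ρ w - ρ (-w)‖ ≤ M * (2 * ‖w‖) := (hM3 w (-w)).trans (by rw [hww])
  have hDw : ‖G.DF w - G.DF (-w)‖ ≤ D2 * (2 * ‖w‖) := (hDF2 w (-w)).trans (by rw [hww])
  have hFneg : G.F 0 - G.F (-w) = -q := by rw [hq, neg_sub]
  constructor
  · have e : G.polarized H ρ w - G.polarized H ρ (-w) =
        (H p - H q) * ρ w + H q * (ρ w - ρ (-w)) := by
      simp only [polarized]
      rw [hFneg, he, ← hp]; ring
    rw [e]
    refine (norm_add_le _ _).trans ?_
    rw [norm_mul, norm_mul]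
    calc _ ≤ A2 * (2 * Q) * M + A / ‖w‖ * (M * (2 * ‖w‖)) := by gcongr; exact hM1 w
      _ = A2 * (2 * Q) * M + A * (2 * M) := by field_simp
      _ ≤ _ := le_add_of_nonneg_right (by positivity)
  · have h1 := hasFDerivAt_polarized (G := G) hH hρ hw
    have h2 := hasFDerivAt_polarized (G := G) hH hρ (neg_ne_zero.2 hw)
    have h3 := h1.sub (h2.comp w (hasFDerivAt_id w).neg)
    have h4 : fderiv ℝ (fun w => G.polarized H ρ w - G.polarized H ρ (-w)) w = _ := h3.fderiv
    rw [h4, hFneg, he, fderiv_neg_of_even he, ← hp]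
    -- Evenness of H makes its derivative odd, so the two terms with the derivative of H subtract.
    -- The difference telescopes over the three factors, each of which changes little between w and
    -- −w.
    have e : (H p • fderiv ℝ ρ w - ρ w • (fderiv ℝ H p).comp (G.DF w)) -
        (H q • fderiv ℝ ρ (-w) - ρ (-w) • (-fderiv ℝ H q).comp (G.DF (-w))).comp
          (-ContinuousLinearMap.id ℝ E2) =
        (H p • fderiv ℝ ρ w + H q • fderiv ℝ ρ (-w)) -
        (ρ w • (fderiv ℝ H p - fderiv ℝ H q).comp (G.DF w) +
          ρ w • (fderiv ℝ H q).comp (G.DF w - G.DF (-w)) +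
          (ρ w - ρ (-w)) • (fderiv ℝ H q).comp (G.DF (-w))) := by
      ext v
      simp
      ring
    rw [e]
    have b1 : ‖H p • fderiv ℝ ρ w + H q • fderiv ℝ ρ (-w)‖ ≤ 2 * (A * M) / ‖w‖ := by
      refine (norm_add_le _ _).trans ?_
      rw [norm_smul, norm_smul]
      calc _ ≤ A / ‖w‖ * M + A / ‖w‖ * M := by gcongr <;> exact hM2 _
        _ = _ := by ring
    have b2 : ‖ρ w • (fderiv ℝ H p - fderiv ℝ H q).comp (G.DF w)‖ ≤
        B2 * (2 * Q) * D * M / ‖w‖ := by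
      rw [norm_smul]
      calc _ ≤ M * (B2 * (2 * Q) / ‖w‖ * D) := by
            gcongr
            · exact hM1 w
            · refine (ContinuousLinearMap.opNorm_comp_le _ _).trans ?_
              gcongr
              exact hDF w
        _ = _ := by ring
    have b3 : ‖ρ w • (fderiv ℝ H q).comp (G.DF w - G.DF (-w))‖ ≤ B * (2 * D2) * M / ‖w‖ := by
      rw [norm_smul]
      calc _ ≤ M * (B / ‖w‖ ^ 2 * (D2 * (2 * ‖w‖))) := by
            gcongr
            · exact hM1 w
            · refine (ContinuousLinearMap.opNorm_comp_le _ _).trans ?_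
              gcongr
        _ = _ := by field_simp
    have b4 : ‖(ρ w - ρ (-w)) • (fderiv ℝ H q).comp (G.DF (-w))‖ ≤ B * D * (2 * M) / ‖w‖ := by
      rw [norm_smul]
      calc _ ≤ M * (2 * ‖w‖) * (B / ‖w‖ ^ 2 * D) := by
            gcongr
            refine (ContinuousLinearMap.opNorm_comp_le _ _).trans ?_
            gcongr
            exact hDF _
        _ = _ := by field_simp
    refine (norm_sub_le _ _).trans ?_
    have b5 := norm_add₃_le (a := ρ w • (fderiv ℝ H p - fderiv ℝ H q).comp (G.DF w))
      (b := ρ w • (fderiv ℝ H q).comp (G.DF w - G.DF (-w)))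
      (c := (ρ w - ρ (-w)) • (fderiv ℝ H q).comp (G.DF (-w)))
    have b6 : 0 ≤ (A2 * (2 * Q) * M + A * (2 * M)) / ‖w‖ := by positivity
    simp only [add_div]
    simp only [add_div] at b6
    linarith

end GraphPatch

namespace GraphPatch

/-! ### Differentiation of weakly singular integrals on a graph patch -/

variable (G : GraphPatch)

/-- Derivative at `v` of the density `H (F v - F (v + w)) * ρ (v + w)`. -/
def movedDeriv (H : E3 → ℂ) (ρ : E2 → ℂ) (v w : E2) : E2 →L[ℝ] ℂ :=
  ρ (v + w) • (fderiv ℝ H (G.F v - G.F (v + w))).comp (G.DF v - G.DF (v + w)) +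
    H (G.F v - G.F (v + w)) • fderiv ℝ ρ (v + w)

variable {G} {H : E3 → ℂ} {ρ : E2 → ℂ}

lemma add_ne_self_of_ne {v w : E2} (hw : w ≠ 0) : v ≠ v + w := by
  intro h; exact hw (by simpa using h.symm)

lemma hasFDerivAt_moved {m : ℕ} (hH : IsSing m H) (hρ : ContDiff ℝ 1 ρ) {w : E2} (hw : w ≠ 0)
    (v : E2) : HasFDerivAt (fun v => H (G.F v - G.F (v + w)) * ρ (v + w))
      (G.movedDeriv H ρ v w) v := by
  have hs : HasFDerivAt (fun v : E2 => v + w) (ContinuousLinearMap.id ℝ E2) v :=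
    (hasFDerivAt_id v).add_const w
  have h0 : HasFDerivAt (fun v => G.F v - G.F (v + w)) (G.DF v - G.DF (v + w)) v := by
    have := (G.hasFDerivAt_F v).sub ((G.hasFDerivAt_F (v + w)).comp v hs)
    rwa [ContinuousLinearMap.comp_id] at this
  have h1 := (hH.differentiableAt
    (F_sub_ne_zero (G := G) (add_ne_self_of_ne (v := v) hw))).hasFDerivAt.comp v h0
  have h2 := h1.mul ((hρ.differentiable (by norm_num) (v + w)).hasFDerivAt.comp v hs)
  refine h2.congr_fderiv ?_
  ext a
  simp [movedDeriv]
  ring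

lemma continuousOn_moved {m : ℕ} (hH : IsSing m H) (hρ : ContDiff ℝ 1 ρ) (v : E2) :
    ContinuousOn (fun w => H (G.F v - G.F (v + w)) * ρ (v + w)) {0}ᶜ := by
  have h1 : Continuous fun w => G.F v - G.F (v + w) :=
    continuous_const.sub (G.continuous_F.comp (by fun_prop))
  exact (hH.contDiffOn.continuousOn.comp h1.continuousOn
    fun w hw => F_sub_ne_zero (add_ne_self_of_ne hw)).mul
      (hρ.continuous.comp (by fun_prop)).continuousOn

lemma continuousOn_movedDeriv {m : ℕ} (hH : IsSing m H) (hρ : ContDiff ℝ 1 ρ) (v : E2) :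
    ContinuousOn (G.movedDeriv H ρ v) {0}ᶜ := by
  have h1 : Continuous fun w => G.F v - G.F (v + w) :=
    continuous_const.sub (G.continuous_F.comp (by fun_prop))
  have hm : Set.MapsTo (fun w => G.F v - G.F (v + w)) {0}ᶜ {0}ᶜ :=
    fun w hw => F_sub_ne_zero (add_ne_self_of_ne hw)
  have h2 : Continuous fun w => G.DF v - G.DF (v + w) :=
    continuous_const.sub (G.contDiff_DF.continuous.comp (by fun_prop))
  have h3 : Continuous fun w => fderiv ℝ ρ (v + w) :=
    (hρ.continuous_fderiv (by norm_num)).comp (by fun_prop)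
  exact ((hρ.continuous.comp (by fun_prop)).continuousOn.smul
    ((hH.continuousOn_fderiv.comp h1.continuousOn hm).clm_comp h2.continuousOn)).add
    ((hH.contDiffOn.continuousOn.comp h1.continuousOn hm).smul h3.continuousOn)

lemma exists_support_radius (hρc : HasCompactSupport ρ) : ∃ R : ℝ, 0 ≤ R ∧
    ∀ u, R < ‖u‖ → ρ u = 0 ∧ fderiv ℝ ρ u = 0 := by
  obtain ⟨R, hR⟩ := hρc.isCompact.isBounded.subset_closedBall (0 : E2)
  refine ⟨max R 0, le_max_right _ _, fun u hu => ?_⟩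
  have hn : u ∉ tsupport ρ := fun h => by
    have h1 := mem_closedBall_zero_iff.1 (hR h)
    linarith [le_max_left R 0]
  exact ⟨image_eq_zero_of_notMem_tsupport hn, fderiv_of_notMem_tsupport ℝ hn⟩

/-- In the moved kernel the derivative of H, of size |w|⁻², is applied to DF(v) − DF(v+w) = O(|w|),
so the derivative in v is no more singular than the kernel. For |v| < 1 everything vanishes once |w|
exceeds the support radius of ρ by 1. -/
lemma exists_bound_moved (hH : IsSing 1 H) (hρ : ContDiff ℝ 1 ρ) (hρc : HasCompactSupport ρ) :
    ∃ C R : ℝ, 0 ≤ C ∧ ∀ v ∈ Metric.ball (0 : E2) 1, ∀ w ≠ 0,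
      ‖H (G.F v - G.F (v + w)) * ρ (v + w)‖ ≤ C / ‖w‖ ∧ ‖G.movedDeriv H ρ v w‖ ≤ C / ‖w‖ ∧
      (R ≤ ‖w‖ → H (G.F v - G.F (v + w)) * ρ (v + w) = 0 ∧ G.movedDeriv H ρ v w = 0) := by
  obtain ⟨M, hM, hM1, hM2, -⟩ := exists_bounds_density hρ hρc
  obtain ⟨K, hK, hKF⟩ := norm_F_sub_le_mul (G := G)
  obtain ⟨D2, hD2, hDF2⟩ := G.exists_lipschitz_DF
  obtain ⟨R, hR, hRs⟩ := exists_support_radius hρc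
  obtain ⟨A, hA, hAb⟩ := hH.bound (K * (R + 1))
  obtain ⟨B, hB, hBb⟩ := hH.bound_fderiv (K * (R + 1))
  refine ⟨M * B * D2 + A * M, R + 1, by positivity, fun v hv w hw => ?_⟩
  have hpos : 0 < ‖w‖ := norm_pos_iff.2 hw
  have hfar : R + 1 ≤ ‖w‖ →
      H (G.F v - G.F (v + w)) * ρ (v + w) = 0 ∧ G.movedDeriv H ρ v w = 0 := by
    intro h
    have hvn : ‖v‖ < 1 := mem_ball_zero_iff.1 hv
    have h1 : R < ‖v + w‖ := by
      have := norm_sub_le (v + w) v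
      rw [add_sub_cancel_left] at this
      linarith
    obtain ⟨h2, h3⟩ := hRs _ h1
    exact ⟨by rw [h2, mul_zero], by ext b; simp [movedDeriv, h2, h3]⟩
  by_cases hwR : R + 1 ≤ ‖w‖
  · obtain ⟨h1, h2⟩ := hfar hwR
    exact ⟨by rw [h1, norm_zero]; positivity, by rw [h2, norm_zero]; positivity, hfar⟩
  have hwR' := (not_le.1 hwR).le
  have hne := F_sub_ne_zero (G := G) (add_ne_self_of_ne (v := v) hw)
  have hvw : ‖v - (v + w)‖ = ‖w‖ := by rw [sub_add_cancel_left, norm_neg]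
  have h1 : ‖G.F v - G.F (v + w)‖ ≤ K * (R + 1) := (hKF _ _).trans (by rw [hvw]; gcongr)
  have h2 : ‖w‖ ≤ ‖G.F v - G.F (v + w)‖ := by
    rw [← hvw]; exact G.norm_sub_le_norm_F_sub v (v + w)
  have hHb : ‖H (G.F v - G.F (v + w))‖ ≤ A / ‖w‖ := by
    refine (hAb _ hne h1).trans ?_
    rw [pow_one]; gcongr
  refine ⟨?_, ?_, hfar⟩
  · rw [norm_mul]
    calc _ ≤ A / ‖w‖ * M := by gcongr; exact hM1 _
      _ = A * M / ‖w‖ := by ring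
      _ ≤ _ := by gcongr; exact le_add_of_nonneg_left (by positivity)
  · refine (norm_add_le _ _).trans ?_
    rw [norm_smul, norm_smul, add_div]
    gcongr ?_ + ?_
    · calc _ ≤ M * (B / ‖w‖ ^ 2 * (D2 * ‖w‖)) := by
            gcongr
            · exact hM1 _
            · refine (ContinuousLinearMap.opNorm_comp_le _ _).trans ?_
              gcongr
              · exact (hBb _ hne h1).trans (by gcongr)
              · rw [← hvw]; exact hDF2 _ _
        _ = _ := by field_simp
    · calc _ ≤ A / ‖w‖ * M := by gcongr; exact hM2 _
        _ = _ := by ring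

lemma ae_ne_zero : ∀ᵐ w : E2, w ≠ 0 := by rw [ae_iff]; simp

lemma integrable_movedDeriv (hH : IsSing 1 H) (hρ : ContDiff ℝ 1 ρ) (hρc : HasCompactSupport ρ) :
    Integrable (G.movedDeriv H ρ 0) := by
  obtain ⟨C, R, hC, h⟩ := exists_bound_moved (G := G) hH hρ hρc
  have h0 : (0 : E2) ∈ Metric.ball (0 : E2) 1 := Metric.mem_ball_self one_pos
  refine integrable_of_le_inv_norm (c := 0) (C := C) (R := max R 1)
    (continuousOn_movedDeriv hH hρ 0) ?_ ?_
  · intro u hu; rw [sub_zero]; exact (h 0 h0 u hu).2.1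
  · intro u hu
    rw [sub_zero] at hu
    refine ((h 0 h0 u ?_).2.2 ((le_max_left _ _).trans hu)).2
    exact norm_pos_iff.1 (one_pos.trans_le ((le_max_right _ _).trans hu))

/-- The substitution u = v + w fixes the singularity at w = 0 for all v, after which
`exists_bound_moved` gives an integrable majorant for differentiation under the integral. -/
lemma hasFDerivAt_potential (hH : IsSing 1 H) (hρ : ContDiff ℝ 1 ρ) (hρc : HasCompactSupport ρ) :
    HasFDerivAt (fun v => ∫ u, H (G.F v - G.F u) * ρ u) (∫ w, G.movedDeriv H ρ 0 w) 0 := by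
  obtain ⟨C, R, hC, h⟩ := exists_bound_moved (G := G) hH hρ hρc
  have h0 : (0 : E2) ∈ Metric.ball (0 : E2) 1 := Metric.mem_ball_self one_pos
  have hshift : (fun v => ∫ u, H (G.F v - G.F u) * ρ u) =
      fun v => ∫ w, H (G.F v - G.F (v + w)) * ρ (v + w) := by
    funext v
    exact (integral_add_left_eq_self (fun u => H (G.F v - G.F u) * ρ u) v).symm
  rw [hshift]
  have hm0 : (volume : Measure E2) {0} = 0 := by simp
  have hbi : Integrable ((Metric.closedBall (0 : E2) R).indicator fun w => C * ‖w‖⁻¹) := by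
    rw [integrable_indicator_iff Metric.isClosed_closedBall.measurableSet]
    exact (locallyIntegrable_inv_norm.integrableOn_isCompact (isCompact_closedBall _ _)).const_mul C
  have hbound : ∀ (V : Type) [NormedAddCommGroup V] (w : E2) (a : V), ‖a‖ ≤ C / ‖w‖ →
      (R ≤ ‖w‖ → a = 0) → ‖a‖ ≤ (Metric.closedBall (0 : E2) R).indicator
        (fun w => C * ‖w‖⁻¹) w := by
    intro V _ w a h1 h2
    by_cases hw : w ∈ Metric.closedBall (0 : E2) R
    · rw [Set.indicator_of_mem hw, ← div_eq_mul_inv]; exact h1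
    · rw [Set.indicator_of_notMem hw, h2 (not_le.1 (by simpa using hw)).le, norm_zero]
  refine hasFDerivAt_integral_of_dominated_of_fderiv_le (Metric.ball_mem_nhds 0 one_pos)
    (Eventually.of_forall fun v => aestronglyMeasurable_of_continuousOn_compl hm0
      (continuousOn_moved hH hρ v)) ?_
    (aestronglyMeasurable_of_continuousOn_compl hm0 (continuousOn_movedDeriv hH hρ 0)) ?_ hbi ?_
  · refine hbi.mono' (aestronglyMeasurable_of_continuousOn_compl hm0
      (continuousOn_moved hH hρ 0)) ?_
    filter_upwards [ae_ne_zero] with w hw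
    exact hbound ℂ w _ (h 0 h0 w hw).1 fun hR => ((h 0 h0 w hw).2.2 hR).1
  · filter_upwards [ae_ne_zero] with w hw v hv
    exact hbound _ w _ (h v hv w hw).2.1 fun hR => ((h v hv w hw).2.2 hR).2
  · filter_upwards [ae_ne_zero] with w hw v _
    exact hasFDerivAt_moved hH hρ hw v

/-! ### The principal value -/

variable (G) in
/-- Points of the parameter plane whose images are at distance at least `ε` from the center. -/
def outer (ε : ℝ) : Set E2 := {w | ε ≤ ‖G.F w - G.F 0‖}

lemma measurableSet_outer (ε : ℝ) : MeasurableSet (G.outer ε) :=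
  (isClosed_le continuous_const (G.continuous_F.sub continuous_const).norm).measurableSet

lemma ne_zero_of_mem_outer {ε : ℝ} (hε : 0 < ε) {w : E2} (hw : w ∈ G.outer ε) : w ≠ 0 := by
  rintro rfl
  simp [outer] at hw
  linarith

lemma fderiv_polarized_eq_zero (hH : IsSing 1 H) (hρ : ContDiff ℝ 1 ρ) {R : ℝ}
    (hR : ∀ u, R < ‖u‖ → ρ u = 0 ∧ fderiv ℝ ρ u = 0) {w : E2} (hw : w ≠ 0) (hwR : R < ‖w‖) :
    fderiv ℝ (G.polarized H ρ) w = 0 := by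
  rw [(hasFDerivAt_polarized hH hρ hw).fderiv, (hR w hwR).1, (hR w hwR).2]
  ext b; simp

lemma integrableOn_outer (hH : IsSing 1 H) (hρ : ContDiff ℝ 1 ρ) (hρc : HasCompactSupport ρ)
    (a : E2) {ε : ℝ} (hε : 0 < ε) :
    IntegrableOn (fun w => fderiv ℝ (G.polarized H ρ) w a) (G.outer ε) := by
  obtain ⟨R, hR, hRs⟩ := exists_support_radius hρc
  obtain ⟨C, hC, h⟩ := exists_bound_fderiv_polarized (G := G) hH hρ hρc R
  obtain ⟨K, hK, hKF⟩ := norm_F_sub_le_mul (G := G)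
  rw [← integrable_indicator_iff (measurableSet_outer ε)]
  have hb : Integrable ((Metric.closedBall (0 : E2) R).indicator
      fun _ => C * K ^ 2 / ε ^ 2 * ‖a‖) := by
    rw [integrable_indicator_iff Metric.isClosed_closedBall.measurableSet]
    exact integrableOn_const measure_closedBall_lt_top.ne
  refine hb.mono' ?_ (Eventually.of_forall fun w => ?_)
  · refine AEStronglyMeasurable.indicator ?_ (measurableSet_outer ε)
    refine aestronglyMeasurable_of_continuousOn_compl (c := 0) (by simp) ?_
    exact ((contDiffOn_polarized hH hρ).continuousOn_fderiv_of_isOpen isOpen_compl_singleton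
      (by norm_num)).clm_apply continuousOn_const
  · by_cases hw : w ∈ G.outer ε
    · have hw0 := ne_zero_of_mem_outer hε hw
      have hpos := norm_pos_iff.2 hw0
      rw [Set.indicator_of_mem hw]
      by_cases hwR : ‖w‖ ≤ R
      · rw [Set.indicator_of_mem (by simpa using hwR)]
        refine (ContinuousLinearMap.le_opNorm _ _).trans ?_
        gcongr
        refine (h w hw0 hwR).trans ?_
        rw [div_le_div_iff₀ (by positivity) (by positivity), mul_assoc, ← mul_pow]
        have h1 : ε ≤ K * ‖w‖ := by
          have := hKF w 0
          rw [sub_zero] at this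
          exact le_trans hw this
        gcongr
      · rw [fderiv_polarized_eq_zero hH hρ hRs hw0 (not_le.1 hwR), zero_apply, norm_zero]
        exact Set.indicator_nonneg (fun _ _ => by positivity) _
    · rw [Set.indicator_of_notMem hw, norm_zero]
      exact Set.indicator_nonneg (fun _ _ => by positivity) _

/-- Truncating by distance in space or in the parameter plane makes no difference in the limit: the
two regions differ by a set of area O(ε⁴), on which the integrand is O(ε⁻²). -/
lemma tendsto_integral_outer_sub (hH : IsSing 1 H) (hρ : ContDiff ℝ 1 ρ)
    (hρc : HasCompactSupport ρ) (a : E2) :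
    Tendsto (fun ε => ∫ w in G.outer ε \ {w | ε ≤ ‖w‖}, fderiv ℝ (G.polarized H ρ) w a)
      (𝓝[>] 0) (𝓝 0) := by
  obtain ⟨C, hC, h⟩ := exists_bound_fderiv_polarized (G := G) hH hρ hρc 1
  obtain ⟨Q, hQ, hQh⟩ := G.exists_quadratic_h
  have hlim : Tendsto (fun ε : ℝ => 2 * C * ‖a‖ * (Real.pi * Q ^ 2) * ε ^ 2) (𝓝[>] 0) (𝓝 0) := by
    have : Continuous fun ε : ℝ => 2 * C * ‖a‖ * (Real.pi * Q ^ 2) * ε ^ 2 := by fun_prop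
    simpa using (this.tendsto 0).mono_left nhdsWithin_le_nhds
  refine squeeze_zero_norm' ?_ hlim
  have hsmall : ∀ᶠ ε : ℝ in 𝓝[>] 0, Q ^ 2 * ε ^ 2 < 1 / 2 := by
    have : Continuous fun ε : ℝ => Q ^ 2 * ε ^ 2 := by fun_prop
    have h2 : Tendsto (fun ε : ℝ => Q ^ 2 * ε ^ 2) (𝓝[>] 0) (𝓝 0) := by
      simpa using (this.tendsto 0).mono_left nhdsWithin_le_nhds
    exact h2.eventually (gt_mem_nhds (by norm_num))
  filter_upwards [hsmall, Ioo_mem_nhdsGT (one_pos : (0 : ℝ) < 1)] with ε hε hε1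
  obtain ⟨hεp, hε1⟩ := hε1
  -- For |w| < ε the height is at most Qε², so a chord of length at least ε forces |w| ≥ r. Since
  -- Q²ε² < 1/2, also r² ≥ ε²/2, which is the source of the factor 2 in 2C/ε².
  set r := √(ε ^ 2 - Q ^ 2 * ε ^ 4) with hr
  have hε2 : 0 < ε ^ 2 := by positivity
  have hr2 : r ^ 2 = ε ^ 2 - Q ^ 2 * ε ^ 4 := Real.sq_sqrt (by nlinarith)
  have hr0 : 0 ≤ r := Real.sqrt_nonneg _
  have hrε : r ≤ ε := by
    refine (pow_le_pow_iff_left₀ hr0 hεp.le two_ne_zero).1 ?_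
    rw [hr2]; linarith [show 0 ≤ Q ^ 2 * ε ^ 4 by positivity]
  have hsub : G.outer ε \ {w | ε ≤ ‖w‖} ⊆ Metric.ball 0 ε \ Metric.ball 0 r := by
    rintro w ⟨hw, hwε⟩
    have hw1 : ‖w‖ < ε := not_le.1 hwε
    refine ⟨mem_ball_zero_iff.2 hw1, ?_⟩
    rw [mem_ball_zero_iff, not_lt]
    refine (pow_le_pow_iff_left₀ hr0 (norm_nonneg _) two_ne_zero).1 ?_
    have h1 := G.norm_F_sub_sq w 0
    rw [G.h_zero, sub_zero, sub_zero] at h1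
    have h2 : ε ^ 2 ≤ ‖G.F w - G.F 0‖ ^ 2 := by
      have hw : ε ≤ ‖G.F w - G.F 0‖ := hw
      gcongr
    have h3 : G.h w ^ 2 ≤ (Q * ε ^ 2) ^ 2 := by
      rw [← sq_abs (G.h w)]
      have := hQh w
      gcongr
      exact this.trans (by gcongr)
    rw [hr2]
    nlinarith
  have hvol : volume.real (Metric.ball (0 : E2) ε \ Metric.ball 0 r) = Real.pi * Q ^ 2 * ε ^ 4 := by
    have hb : ∀ s : ℝ, 0 ≤ s → volume.real (Metric.ball (0 : E2) s) = s ^ 2 * Real.pi := by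
      intro s hs
      rw [Measure.real, EuclideanSpace.volume_ball_fin_two, ENNReal.toReal_mul,
        ENNReal.toReal_pow, ENNReal.toReal_ofReal hs, ENNReal.toReal_ofReal Real.pi_pos.le]
    rw [measureReal_sdiff (Metric.ball_subset_ball hrε) Metric.isOpen_ball.measurableSet
      measure_ball_lt_top.ne, hb _ hεp.le, hb _ hr0, hr2]
    ring
  have hfin : volume (Metric.ball (0 : E2) ε \ Metric.ball 0 r) < ⊤ :=
    (measure_mono Set.sdiff_subset).trans_lt measure_ball_lt_top
  calc _ ≤ 2 * C / ε ^ 2 * ‖a‖ * volume.real (G.outer ε \ {w | ε ≤ ‖w‖}) := by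
        refine norm_setIntegral_le_of_norm_le_const ((measure_mono hsub).trans_lt hfin)
          fun w hw => ?_
        have hw0 := ne_zero_of_mem_outer hεp hw.1
        have hpos := norm_pos_iff.2 hw0
        have hw' := hsub hw
        have h1 : ‖w‖ < ε := mem_ball_zero_iff.1 hw'.1
        have h2 : r ≤ ‖w‖ := by simpa using hw'.2
        refine (ContinuousLinearMap.le_opNorm _ _).trans ?_
        gcongr
        refine (h w hw0 (h1.le.trans hε1.le)).trans ?_
        rw [div_le_div_iff₀ (by positivity) (by positivity)]
        have h3 : r ^ 2 ≤ ‖w‖ ^ 2 := by gcongr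
        have h4 : ε ^ 2 ≤ 2 * ‖w‖ ^ 2 := by nlinarith
        nlinarith
    _ ≤ 2 * C / ε ^ 2 * ‖a‖ * (Real.pi * Q ^ 2 * ε ^ 4) := by
        rw [← hvol]
        gcongr
        exact hfin.ne
    _ = _ := by field_simp

/-- On the symmetric region |w| ≥ ε the integral is half that of the derivative of A(w) − A(−w),
where A is the polarized kernel. This function is mild by `isMild_polarized_sub`, so the integral of
its derivative converges absolutely and is zero. -/
lemma tendsto_integral_fderiv_outer (hH : IsSing 1 H) (he : ∀ z, H (-z) = H z)
    (hρ : ContDiff ℝ 1 ρ) (hρc : HasCompactSupport ρ) (a : E2) :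
    Tendsto (fun ε => ∫ w in G.outer ε, fderiv ℝ (G.polarized H ρ) w a) (𝓝[>] 0) (𝓝 0) := by
  have hB := isMild_polarized_sub (G := G) hH he hρ hρc
  obtain ⟨R, hR, hRs⟩ := exists_support_radius hρc
  have hBs : ∀ u : E2, R + 1 ≤ ‖u - 0‖ → G.polarized H ρ u - G.polarized H ρ (-u) = 0 := by
    intro u hu
    rw [sub_zero] at hu
    simp only [polarized]
    rw [(hRs u (by linarith)).1, (hRs (-u) (by rw [norm_neg]; linarith)).1]; ring
  set g : E2 → ℂ := fun w => fderiv ℝ (G.polarized H ρ) w a with hg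
  let T : ℝ → Set E2 := fun ε => {w | ε ≤ ‖w‖}
  have hT : ∀ ε, MeasurableSet (T ε) := fun ε =>
    (isClosed_le continuous_const continuous_norm).measurableSet
  have hTS : ∀ ε, T ε ⊆ G.outer ε := fun ε w hw => by
    have := G.norm_sub_le_norm_F_sub w 0
    rw [sub_zero] at this
    exact le_trans hw this
  have hgneg : ∀ ε > 0, IntegrableOn (fun w => g (-w)) (T ε) ∧
      ∫ w in T ε, g (-w) = ∫ w in T ε, g w := by
    intro ε hε
    have e : (T ε).indicator (fun w => g (-w)) = fun w => (T ε).indicator g (-w) := by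
      funext w
      by_cases hw : w ∈ T ε
      · rw [Set.indicator_of_mem hw, Set.indicator_of_mem (by simpa [T] using hw)]
      · rw [Set.indicator_of_notMem hw, Set.indicator_of_notMem (by simpa [T] using hw)]
    constructor
    · rw [← integrable_indicator_iff (hT ε), e]
      exact ((integrable_indicator_iff (hT ε)).2
        ((integrableOn_outer hH hρ hρc a hε).mono_set (hTS ε))).comp_neg
    · rw [← integral_indicator (hT ε), ← integral_indicator (hT ε), e]
      exact integral_neg_eq_self _ _
  have hBd : ∀ w ≠ 0, fderiv ℝ (fun w => G.polarized H ρ w - G.polarized H ρ (-w)) w a =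
      g w + g (-w) := by
    intro w hw
    have h1 := (hasFDerivAt_polarized (G := G) hH hρ hw).differentiableAt.hasFDerivAt
    have h2 := (hasFDerivAt_polarized (G := G) hH hρ
      (neg_ne_zero.2 hw)).differentiableAt.hasFDerivAt
    have h3 : fderiv ℝ (fun w => G.polarized H ρ w - G.polarized H ρ (-w)) w = _ :=
      (h1.sub (h2.comp w (hasFDerivAt_id w).neg)).fderiv
    rw [h3]
    simp [hg]
  have hBT : ∀ ε > 0, ∫ w in T ε, fderiv ℝ (fun w => G.polarized H ρ w - G.polarized H ρ (-w)) w a =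
      2 * ∫ w in T ε, g w := by
    intro ε hε
    rw [setIntegral_congr_fun (hT ε) fun w hw => hBd w
      (norm_pos_iff.1 (hε.trans_le hw)), integral_add
        ((integrableOn_outer hH hρ hρc a hε).mono_set (hTS ε)) (hgneg ε hε).1, (hgneg ε hε).2]
    ring
  have hlim1 : Tendsto (fun ε => ∫ w in T ε,
      fderiv ℝ (fun w => G.polarized H ρ w - G.polarized H ρ (-w)) w a) (𝓝[>] 0) (𝓝 0) := by
    rw [← hB.integral_fderiv hBs a]
    refine tendsto_setIntegral_punctured ae_ne_zero (hB.integrable_fderiv hBs a) hT fun w hw => ?_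
    filter_upwards [Ioo_mem_nhdsGT (norm_pos_iff.2 hw)] with ε hε using hε.2.le
  have hlim2 := tendsto_integral_outer_sub (G := G) hH hρ hρc a
  have hsum := hlim2.add (hlim1.const_mul (1 / 2 : ℂ))
  rw [mul_zero, add_zero] at hsum
  refine hsum.congr' ?_
  filter_upwards [self_mem_nhdsWithin] with ε hε
  rw [hBT ε hε, setIntegral_sdiff (hT ε) (integrableOn_outer hH hρ hρc a hε) (hTS ε)]
  ring

/-- At v = 0 the integrand `movedDeriv` is the principal value integrand plus the w-derivative of
the polarized kernel; the first is absolutely integrable and the integrals of the last tend to zero.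
-/
lemma tendsto_principal_value (hH : IsSing 1 H) (he : ∀ z, H (-z) = H z)
    (hρ : ContDiff ℝ 1 ρ) (hρc : HasCompactSupport ρ) (a : E2) :
    Tendsto (fun ε => ∫ w in G.outer ε, fderiv ℝ H (G.F 0 - G.F w) (G.DF 0 a) * ρ w) (𝓝[>] 0)
      (𝓝 ((∫ w, G.movedDeriv H ρ 0 w) a)) := by
  have hi := integrable_movedDeriv (G := G) hH hρ hρc
  have hia : Integrable fun w => G.movedDeriv H ρ 0 w a := hi.apply_continuousLinearMap a
  rw [ContinuousLinearMap.integral_apply hi]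
  have h1 := tendsto_setIntegral_punctured (S := G.outer) ae_ne_zero hia measurableSet_outer
    fun w hw => by
      have hpos : 0 < ‖G.F w - G.F 0‖ := norm_pos_iff.2 (F_sub_ne_zero hw)
      filter_upwards [Ioo_mem_nhdsGT hpos] with ε hε using hε.2.le
  have h2 := h1.sub (tendsto_integral_fderiv_outer (G := G) hH he hρ hρc a)
  rw [sub_zero] at h2
  refine h2.congr' ?_
  filter_upwards [self_mem_nhdsWithin] with ε hε
  rw [← integral_sub hia.integrableOn (integrableOn_outer hH hρ hρc a hε)]
  refine setIntegral_congr_fun (measurableSet_outer ε) fun w hw => ?_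
  rw [(hasFDerivAt_polarized hH hρ (ne_zero_of_mem_outer hε hw)).fderiv]
  simp [movedDeriv]
  ring

end GraphPatch

/-! ### Tangential derivatives of weakly singular surface potentials -/

namespace GraphPatch

variable (G : GraphPatch)

lemma coords_center : G.coords G.center = 0 := by rw [← G.F_zero, G.coords_F]

lemma normalVec_zero : G.normalVec 0 = G.b 2 := by simp [normalVec, slope, G.fderiv_zero]

lemma jac_zero : G.jac 0 = 1 := by simp [jac, slope, G.fderiv_zero]

lemma DF_zero_coordsL {a : E3} (ha : inner ℝ (G.b 2) a = (0 : ℝ)) : G.DF 0 (G.coordsL a) = a := by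
  have := G.decomp a
  rw [ha, zero_smul, add_zero] at this
  rw [DF_zero, ← this]

end GraphPatch

lemma IsChart.normal_center {Γ : Set E3} {ν : E3 → E3} {G : GraphPatch} {δ : ℝ}
    (hG : IsChart Γ ν G δ) : ν G.center = G.b 2 := by
  rw [hG.normal _ (Metric.mem_ball_self hG.pos) hG.center_mem, G.coords_center, G.normalVec_zero,
    G.jac_zero, inv_one, one_smul]

namespace IsChartedSurface

variable {Γ : Set E3} {ν : E3 → E3}

lemma ae_ne (z : E3) : ∀ᵐ y ∂(μHE[2].restrict Γ), y ≠ z :=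
  ae_restrict_of_ae (by rw [ae_iff]; simpa using measure_singleton z)

lemma exists_norm_sub_le (hS : IsChartedSurface Γ ν) (x : E3) : ∃ R, ∀ y ∈ Γ, ‖x - y‖ ≤ R := by
  obtain ⟨R, hR⟩ := hS.isCompact.exists_bound_of_continuousOn
    (f := fun y => x - y) (by fun_prop)
  exact ⟨R, hR⟩

lemma aestronglyMeasurable_of_punctured {V : Type*} [NormedAddCommGroup V]
    (hS : IsChartedSurface Γ ν) {g : E3 → V} {z : E3} (hg : ContinuousOn g (Γ \ {z})) :
    AEStronglyMeasurable g (μHE[2].restrict Γ) := by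
  have h := hg.aestronglyMeasurable (μ := (μHE[2] : Measure E3))
    (hS.measurableSet.diff (measurableSet_singleton z))
  have h2 : (μHE[2].restrict Γ).restrict {z}ᶜ = μHE[2].restrict Γ :=
    Measure.restrict_eq_self_of_ae_mem (ae_ne z)
  rwa [← h2, Measure.restrict_restrict (measurableSet_singleton z).compl, Set.inter_comm,
    ← Set.sdiff_eq]

lemma continuousOn_sing_mul {m : ℕ} {H f : E3 → ℂ} (hH : IsSing m H) (hf : ContinuousOn f Γ)
    (z : E3) : ContinuousOn (fun y => H (z - y) * f y) (Γ \ {z}) := by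
  have hm : Set.MapsTo (fun y => z - y) (Γ \ {z}) {0}ᶜ := fun y hy =>
    sub_ne_zero.2 (Ne.symm hy.2)
  exact (hH.contDiffOn.continuousOn.comp (by fun_prop) hm).mul (hf.mono Set.sdiff_subset)

lemma integrableOn_of_bound (hS : IsChartedSurface Γ ν) {V : Type*} [NormedAddCommGroup V]
    {g : E3 → V} {z : E3} (hz : z ∈ Γ) (hg : ContinuousOn g (Γ \ {z})) {C : ℝ}
    (hb : ∀ y ∈ Γ, y ≠ z → ‖g y‖ ≤ C / ‖y - z‖) : IntegrableOn g Γ μHE[2] := by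
  refine Integrable.mono' ((hS.integrableOn_inv_norm_sub hz).const_mul C)
    (hS.aestronglyMeasurable_of_punctured hg) ?_
  filter_upwards [ae_ne z, ae_restrict_mem hS.measurableSet] with y hy hyΓ
  rw [← div_eq_mul_inv]
  exact hb y hyΓ hy

lemma integrableOn_sing (hS : IsChartedSurface Γ ν) {H f : E3 → ℂ} (hH : IsSing 1 H)
    (hf : ContinuousOn f Γ) {z : E3} (hz : z ∈ Γ) :
    IntegrableOn (fun y => H (z - y) * f y) Γ μHE[2] := by
  obtain ⟨R, hR⟩ := hS.exists_norm_sub_le z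
  obtain ⟨C, hC, h⟩ := hH.bound R
  obtain ⟨M, hM⟩ := hS.isCompact.exists_bound_of_continuousOn hf
  refine hS.integrableOn_of_bound (C := C * M) hz (continuousOn_sing_mul hH hf z)
    fun y hy hyz => ?_
  rw [norm_mul, mul_div_right_comm, norm_sub_rev y z]
  have h1 := h (z - y) (sub_ne_zero.2 hyz.symm) (hR y hy)
  rw [pow_one] at h1
  exact mul_le_mul h1 (hM y hy) (norm_nonneg _) (by positivity)

lemma integrableOn_truncated (hS : IsChartedSurface Γ ν) {V : Type*} [NormedAddCommGroup V]
    {g : E3 → V} {x : E3} (hg : ContinuousOn g (Γ \ {x})) {ε : ℝ} (hε : 0 < ε) :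
    IntegrableOn g (Γ \ Metric.ball x ε) μHE[2] := by
  have hc : IsCompact (Γ \ Metric.ball x ε) := hS.isCompact.diff Metric.isOpen_ball
  have hsub : Γ \ Metric.ball x ε ⊆ Γ \ {x} := fun y hy => ⟨hy.1, fun h => hy.2 (by
    rw [h]; exact Metric.mem_ball_self hε)⟩
  obtain ⟨M, hM⟩ := hc.exists_bound_of_continuousOn (hg.mono hsub)
  refine Integrable.mono' (integrableOn_const (C := M)
    ((measure_mono Set.sdiff_subset).trans_lt hS.measure_lt_top).ne) ?_ ?_
  · exact (hg.mono hsub).aestronglyMeasurable hc.isClosed.measurableSet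
  · exact (ae_restrict_mem hc.isClosed.measurableSet).mono hM

lemma continuousOn_fderiv_mul {m : ℕ} {H f : E3 → ℂ} (hH : IsSing m H) (hf : ContinuousOn f Γ)
    (x a : E3) : ContinuousOn (fun y => fderiv ℝ H (x - y) a * f y) (Γ \ {x}) := by
  have hm : Set.MapsTo (fun y => x - y) (Γ \ {x}) {0}ᶜ := fun y hy =>
    sub_ne_zero.2 (Ne.symm hy.2)
  exact ((hH.continuousOn_fderiv.comp (by fun_prop) hm).clm_apply continuousOn_const).mul
    (hf.mono Set.sdiff_subset)

/-- Differentiation of a potential whose density vanishes near the point. -/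
lemma hasFDerivAt_far (hS : IsChartedSurface Γ ν) {m : ℕ} {H f : E3 → ℂ} (hH : IsSing m H)
    (hf : Continuous f) {x : E3} {r : ℝ} (hr : 0 < r) (h0 : ∀ y ∈ Metric.ball x r, f y = 0) :
    ∃ L : E3 →L[ℝ] ℂ, HasFDerivAt (fun z => ∫ y in Γ, H (z - y) * f y ∂μHE[2]) L x ∧
      ∀ a, Tendsto (fun ε => ∫ y in Γ \ Metric.ball x ε, fderiv ℝ H (x - y) a * f y ∂μHE[2])
        (𝓝[>] 0) (𝓝 (L a)) := by
  obtain ⟨R, hR⟩ := hS.exists_norm_sub_le x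
  obtain ⟨C, hC, hCb⟩ := hH.bound (R + r)
  obtain ⟨D, hD, hDb⟩ := hH.bound_fderiv (R + r)
  obtain ⟨M, hM⟩ := hS.isCompact.exists_bound_of_continuousOn hf.continuousOn
  have hfin : μHE[2] Γ ≠ ⊤ := hS.measure_lt_top.ne
  -- Where the density lives, z − y keeps a distance r/2 from the singularity for all z near x, so
  -- all bounds are uniform constants.
  have hdist : ∀ z ∈ Metric.ball x (r / 2), ∀ y ∈ Γ, f y ≠ 0 →
      r / 2 ≤ ‖z - y‖ ∧ ‖z - y‖ ≤ R + r := by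
    intro z hz y hy hfy
    have h1 : r ≤ ‖x - y‖ := by
      by_contra h
      exact hfy (h0 y (by rw [mem_ball_iff_norm, norm_sub_rev]; exact not_le.1 h))
    have h2 : ‖z - x‖ < r / 2 := mem_ball_iff_norm.1 hz
    have h3 : z - y = (z - x) + (x - y) := by abel
    have h4 : x - y = (z - y) - (z - x) := by abel
    constructor
    · have := norm_sub_le (z - y) (z - x)
      rw [← h4] at this
      linarith
    · rw [h3]
      have := norm_add_le (z - x) (x - y)
      linarith [hR y hy]
  have hmeas : ∀ z, AEStronglyMeasurable (fun y => H (z - y) * f y) (μHE[2].restrict Γ) := fun z =>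
    hS.aestronglyMeasurable_of_punctured (continuousOn_sing_mul hH hf.continuousOn z)
  have hx : x ∈ Metric.ball x (r / 2) := Metric.mem_ball_self (by positivity)
  let F' : E3 → E3 → E3 →L[ℝ] ℂ := fun z y => f y • fderiv ℝ H (z - y)
  have hF'm : AEStronglyMeasurable (F' x) (μHE[2].restrict Γ) := by
    have hm : Set.MapsTo (fun y => x - y) (Γ \ {x}) {0}ᶜ := fun y hy =>
      sub_ne_zero.2 (Ne.symm hy.2)
    exact hS.aestronglyMeasurable_of_punctured
      (hf.continuousOn.smul (hH.continuousOn_fderiv.comp (by fun_prop) hm))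
  have hne : ∀ z ∈ Metric.ball x (r / 2), ∀ y ∈ Γ, f y ≠ 0 → z - y ≠ 0 := fun z hz y hy hfy h => by
    have := (hdist z hz y hy hfy).1
    rw [h, norm_zero] at this
    linarith
  have hF'b : ∀ y ∈ Γ, ∀ z ∈ Metric.ball x (r / 2),
      ‖F' z y‖ ≤ |M| * (D / (r / 2) ^ (m + 1)) := by
    intro y hy z hz
    by_cases hfy : f y = 0
    · have h1 : F' z y = 0 := by ext b; simp [F', hfy]
      rw [h1, norm_zero]; positivity
    obtain ⟨h1, h2⟩ := hdist z hz y hy hfy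
    rw [norm_smul]
    gcongr
    · exact (hM y hy).trans (le_abs_self M)
    · refine (hDb _ (hne z hz y hy hfy) h2).trans ?_
      gcongr
  have key := hasFDerivAt_integral_of_dominated_of_fderiv_le (𝕜 := ℝ) (μ := μHE[2].restrict Γ)
    (F := fun z y => H (z - y) * f y) (F' := F') (x₀ := x)
    (bound := fun _ => |M| * (D / (r / 2) ^ (m + 1)))
    (Metric.ball_mem_nhds x (half_pos hr)) (Eventually.of_forall hmeas)
    ((integrableOn_const (C := C / (r / 2) ^ m * |M|) hfin).mono' (hmeas x) (by
      filter_upwards [ae_restrict_mem hS.measurableSet] with y hy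
      by_cases hfy : f y = 0
      · rw [hfy, mul_zero, norm_zero]; positivity
      obtain ⟨h1, h2⟩ := hdist x hx y hy hfy
      rw [norm_mul]
      gcongr
      · refine (hCb _ (hne x hx y hy hfy) h2).trans ?_
        gcongr
      · exact (hM y hy).trans (le_abs_self M))) hF'm
    ((ae_restrict_mem hS.measurableSet).mono hF'b)
    (integrableOn_const hfin)
    ((ae_restrict_mem hS.measurableSet).mono fun y hy z hz => by
      by_cases hfy : f y = 0
      · have h1 : F' z y = 0 := by ext b; simp [F', hfy]
        simp only [h1, hfy, mul_zero]
        exact hasFDerivAt_const (0 : ℂ) z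
      have h1 := (hH.differentiableAt (hne z hz y hy hfy)).hasFDerivAt.comp z
        ((hasFDerivAt_id z).sub_const y)
      refine (h1.mul_const (f y)).congr_fderiv ?_
      rfl)
  have hF'i : Integrable (F' x) (μHE[2].restrict Γ) :=
    (integrableOn_const (C := |M| * (D / (r / 2) ^ (m + 1))) hfin).mono' hF'm
      ((ae_restrict_mem hS.measurableSet).mono fun y hy => hF'b y hy x hx)
  refine ⟨_, key, fun a => ?_⟩
  -- For ε < r the removed ball meets only points with zero density, so the truncated integral is
  -- constant in ε.
  refine tendsto_const_nhds.congr' ?_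
  filter_upwards [Ioo_mem_nhdsGT hr] with ε hε
  rw [ContinuousLinearMap.integral_apply hF'i,
    ← setIntegral_eq_of_subset_of_forall_sdiff_eq_zero hS.measurableSet
      (s := Γ \ Metric.ball x ε) Set.sdiff_subset]
  · refine integral_congr_ae (Eventually.of_forall fun y => ?_)
    simp [F', mul_comm]
  · intro y hy
    have : y ∈ Metric.ball x ε := by
      by_contra h; exact hy.2 ⟨hy.1, h⟩
    simp [h0 y (Metric.ball_subset_ball hε.2.le this)]

end IsChartedSurface

namespace IsChart

variable {Γ : Set E3} {ν : E3 → E3} {G : GraphPatch} {δ : ℝ}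

/-- Differentiation of a potential whose density is supported in a chart. -/
lemma hasFDerivWithinAt_near (hG : IsChart Γ ν G δ) {H f : E3 → ℂ} (hH : IsSing 1 H)
    (he : ∀ z, H (-z) = H z) (hf : ContDiff ℝ 1 f) {r : ℝ} (hr : r < δ)
    (h0 : ∀ y ∉ Metric.ball G.center r, f y = 0) :
    ∃ L : E3 →L[ℝ] ℂ,
      HasFDerivWithinAt (fun z => ∫ y in Γ, H (z - y) * f y ∂μHE[2]) L Γ G.center ∧
      ∀ a, inner ℝ (ν G.center) a = (0 : ℝ) →
      Tendsto (fun ε => ∫ y in Γ \ Metric.ball G.center ε, fderiv ℝ H (G.center - y) a * f y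
        ∂μHE[2]) (𝓝[>] 0) (𝓝 (L a)) := by
  have hball : Metric.ball G.center r ⊆ Metric.ball G.center δ := Metric.ball_subset_ball hr.le
  let ρ : E2 → ℂ := fun u => (G.jac u : ℂ) * f (G.F u)
  have hρ : ContDiff ℝ 1 ρ := (Complex.ofRealCLM.contDiff.comp G.contDiff_jac).mul
    (hf.comp (G.contDiff_F.of_le (by norm_num)))
  have hρc : HasCompactSupport ρ := by
    refine HasCompactSupport.intro (isCompact_closedBall (0 : E2) r) fun u hu => ?_
    simp only [ρ]
    rw [h0 _ fun h => hu (G.preimage_ball_subset r h), mul_zero]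
  have hW := GraphPatch.hasFDerivAt_potential (G := G) hH hρ hρc
  set L₀ := ∫ w, G.movedDeriv H ρ 0 w with hL₀
  -- On Γ near the center the potential is a function of the tangential coordinates alone. The
  -- derivative chosen here vanishes in the normal direction, so it matches principal values for
  -- tangential a only.
  refine ⟨L₀.comp G.coordsL, ?_, fun a ha => ?_⟩
  · rw [← G.coords_center] at hW
    have hcomp := (hW.comp G.center (G.hasFDerivAt_coords G.center)).hasFDerivWithinAt (s := Γ)
    have hpt : ∀ z ∈ Γ ∩ Metric.ball G.center δ, ∫ y in Γ, H (z - y) * f y ∂μHE[2] =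
        ((fun v => ∫ u, H (G.F v - G.F u) * ρ u) ∘ G.coords) z := by
      intro z hz
      rw [hG.integral_eq fun y hy => by rw [h0 y fun h => hy (hball h), mul_zero]]
      simp only [Function.comp_apply, hG.F_coords hz.2 hz.1]
      refine integral_congr_ae (Eventually.of_forall fun u => ?_)
      simp only [ρ, Complex.real_smul]
      ring
    refine hcomp.congr_of_eventuallyEq ?_
      (hpt _ ⟨hG.center_mem, Metric.mem_ball_self hG.pos⟩)
    filter_upwards [inter_mem_nhdsWithin Γ (Metric.ball_mem_nhds G.center hG.pos)] with z hz
      using hpt z hz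
  · rw [hG.normal_center] at ha
    have hpv := GraphPatch.tendsto_principal_value (G := G) hH he hρ hρc (G.coordsL a)
    rw [G.DF_zero_coordsL ha] at hpv
    refine hpv.congr fun ε => ?_
    rw [← integral_indicator (GraphPatch.measurableSet_outer ε), Set.sdiff_eq, Set.inter_comm,
      ← Measure.restrict_restrict Metric.isOpen_ball.measurableSet.compl,
      ← integral_indicator Metric.isOpen_ball.measurableSet.compl, hG.integral_eq]
    · refine integral_congr_ae (Eventually.of_forall fun u => ?_)
      by_cases hu : u ∈ G.outer ε
      · have hu' : G.F u ∈ (Metric.ball G.center ε)ᶜ := by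
          rw [Set.mem_compl_iff, mem_ball_iff_norm, not_lt, ← G.F_zero]; exact hu
        simp only [Set.indicator_of_mem hu, Set.indicator_of_mem hu', G.F_zero, ρ,
          Complex.real_smul]
        ring
      · have hu' : G.F u ∉ (Metric.ball G.center ε)ᶜ := by
          rw [Set.mem_compl_iff, mem_ball_iff_norm, not_lt, ← G.F_zero]; exact hu
        simp only [Set.indicator_of_notMem hu, Set.indicator_of_notMem hu', smul_zero]
    · intro y hy
      rw [Set.indicator_apply_eq_zero]
      intro _
      rw [h0 y fun h => hy (hball h), mul_zero]

end IsChart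

namespace IsChartedSurface

variable {Γ : Set E3} {ν : E3 → E3}

/-- The potential of an even weakly singular kernel with a `C¹` density is differentiable along
the surface; its tangential derivatives are principal values. -/
theorem hasFDerivWithinAt_potential (hS : IsChartedSurface Γ ν) {H f : E3 → ℂ} (hH : IsSing 1 H)
    (he : ∀ z, H (-z) = H z) (hf : ContDiff ℝ 1 f) {x : E3} (hx : x ∈ Γ) :
    ∃ L : E3 →L[ℝ] ℂ,
      HasFDerivWithinAt (fun z => ∫ y in Γ, H (z - y) * f y ∂μHE[2]) L Γ x ∧
      ∀ a, inner ℝ (ν x) a = (0 : ℝ) →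
      Tendsto (fun ε => ∫ y in Γ \ Metric.ball x ε, fderiv ℝ H (x - y) a * f y ∂μHE[2])
        (𝓝[>] 0) (𝓝 (L a)) := by
  obtain ⟨G, δ, rfl, hG⟩ := hS.exists_chart x hx
  obtain ⟨χ, hχ, hχ1, hχ0, -⟩ := exists_bump G.center hG.pos
  have hχ' : ContDiff ℝ 1 χ := hχ.of_le (by exact_mod_cast le_top)
  have hf1 : ContDiff ℝ 1 fun y => χ y * f y := hχ'.mul hf
  have hf2 : ContDiff ℝ 1 fun y => (1 - χ y) * f y := (contDiff_const.sub hχ').mul hf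
  obtain ⟨L₁, hL₁, hT₁⟩ := hG.hasFDerivWithinAt_near hH he hf1
    (r := 3 * δ / 4) (by linarith [hG.pos]) fun y hy => by rw [hχ0 y hy, zero_mul]
  obtain ⟨L₂, hL₂, hT₂⟩ := hS.hasFDerivAt_far hH hf2.continuous (half_pos hG.pos)
    fun y hy => by rw [hχ1 y hy, sub_self, zero_mul]
  refine ⟨L₁ + L₂, ?_, fun a ha => ?_⟩
  · have hpt : ∀ z ∈ Γ, ∫ y in Γ, H (z - y) * f y ∂μHE[2] =
        ∫ y in Γ, H (z - y) * (χ y * f y) ∂μHE[2] +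
          ∫ y in Γ, H (z - y) * ((1 - χ y) * f y) ∂μHE[2] := by
      intro z hz
      rw [← integral_add (hS.integrableOn_sing hH hf1.continuous.continuousOn hz)
        (hS.integrableOn_sing hH hf2.continuous.continuousOn hz)]
      refine integral_congr_ae (Eventually.of_forall fun y => ?_)
      simp only
      ring
    exact (hL₁.add hL₂.hasFDerivWithinAt).congr hpt (hpt _ hx)
  · refine ((hT₁ a ha).add (hT₂ a)).congr' ?_
    filter_upwards [self_mem_nhdsWithin] with ε hε
    rw [← integral_add
      (hS.integrableOn_truncated (continuousOn_fderiv_mul hH hf1.continuous.continuousOn _ a) hε)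
      (hS.integrableOn_truncated (continuousOn_fderiv_mul hH hf2.continuous.continuousOn _ a) hε)]
    refine integral_congr_ae (Eventually.of_forall fun y => ?_)
    simp only
    ring

end IsChartedSurface

namespace IsChartedSurface

variable {Γ : Set E3} {ν : E3 → E3}

/-! ### Extension of functions on the surface -/

lemma exists_extension {f : E3 → ℂ} (hΓ : IsClosed Γ)
    (h : ∀ x ∈ Γ, ∃ U ∈ 𝓝 x, ∃ g : E3 → ℂ, ContDiffOn ℝ 1 g U ∧ ∀ y ∈ U, y ∈ Γ → g y = f y) :
    ∃ g : E3 → ℂ, ContDiff ℝ 1 g ∧ ∀ y ∈ Γ, g y = f y := by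
  -- The prescribed values form a single point over Γ and the whole plane ℂ elsewhere. Both are
  -- convex, so local extensions can be glued by a partition of unity.
  obtain ⟨g, hg⟩ := exists_contMDiffMap_forall_mem_convex_of_local (modelWithCornersSelf ℝ E3)
    (M := E3) (F := ℂ) (n := 1) (t := fun y => {w | y ∈ Γ → w = f y}) (fun y => by
      by_cases hy : y ∈ Γ
      · simp [hy]
      · simp [hy, convex_univ]) (fun x => by
      by_cases hx : x ∈ Γ
      · obtain ⟨U, hU, g, hg, hgf⟩ := h x hx
        exact ⟨U, hU, g, hg.contMDiffOn, hgf⟩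
      · exact ⟨Γᶜ, hΓ.isOpen_compl.mem_nhds hx, fun _ => 0, contMDiffOn_const,
          fun y hy hyΓ => absurd hyΓ hy⟩)
  exact ⟨g, g.contMDiff.contDiff, hg⟩

/-- Locally p ∘ F ∘ `coords` is constant along the chart's vertical direction and agrees with p on
Γ. -/
lemma exists_extension_of_contDiffOn (hS : IsChartedSurface Γ ν) {p : E3 → ℂ}
    (hp : ContDiffOn ℝ 1 p Γ) : ∃ g : E3 → ℂ, ContDiff ℝ 1 g ∧ ∀ y ∈ Γ, g y = p y := by
  refine exists_extension hS.isCompact.isClosed fun x hx => ?_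
  obtain ⟨G, δ, rfl, hG⟩ := hS.exists_chart x hx
  have hU : IsOpen (G.F ⁻¹' Metric.ball G.center δ) := Metric.isOpen_ball.preimage G.continuous_F
  have h1 : ContDiffOn ℝ 1 (p ∘ G.F) (G.F ⁻¹' Metric.ball G.center δ) :=
    hp.comp (G.contDiff_F.of_le (by norm_num)).contDiffOn fun u hu => hG.F_mem hu
  have h2 : ContDiffOn ℝ 1 ((p ∘ G.F) ∘ G.coords) (G.coords ⁻¹' (G.F ⁻¹' Metric.ball G.center δ)) :=
    h1.comp (G.contDiff_coords.of_le (by exact_mod_cast le_top)).contDiffOn fun _ h => h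
  refine ⟨Metric.ball G.center δ ∩ G.coords ⁻¹' (G.F ⁻¹' Metric.ball G.center δ),
    inter_mem (Metric.ball_mem_nhds _ hG.pos)
      ((hU.preimage G.contDiff_coords.continuous).mem_nhds ?_), _, h2.mono Set.inter_subset_right,
    fun y hy hyΓ => ?_⟩
  · simp only [Set.mem_preimage, G.coords_center, G.F_zero]
    exact Metric.mem_ball_self hG.pos
  · simp only [Function.comp_apply, hG.F_coords hy.1 hyΓ]

lemma exists_extension_normal (hS : IsChartedSurface Γ ν) (j : Fin 3) :
    ∃ g : E3 → ℂ, ContDiff ℝ 1 g ∧ ∀ y ∈ Γ, g y = cvec (ν y) j := by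
  refine exists_extension hS.isCompact.isClosed fun x hx => ?_
  obtain ⟨G, δ, rfl, hG⟩ := hS.exists_chart x hx
  have hc : ContDiff ℝ 1 G.coords := G.contDiff_coords.of_le (by exact_mod_cast le_top)
  have h1 : ContDiff ℝ 1 fun y => (G.jac (G.coords y))⁻¹ • G.normalVec (G.coords y) :=
    ((G.contDiff_jac.comp hc).inv fun y => (G.jac_pos _).ne').smul (G.contDiff_normalVec.comp hc)
  have h2 := (Complex.ofRealCLM.comp (EuclideanSpace.proj j : E3 →L[ℝ] ℝ)).contDiff (n := 1)
  refine ⟨Metric.ball G.center δ, Metric.ball_mem_nhds _ hG.pos, _,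
    (h2.comp h1).contDiffOn, fun y hy hyΓ => ?_⟩
  simp [cvec, hG.normal y hy hyΓ]

/-! ### The surface curl -/

/-- Derivatives within a surface are not unique in the normal direction. Composing with the chart
gives an honest derivative in the plane, which determines the values on tangent vectors. -/
lemma fderivWithin_tangent (hS : IsChartedSurface Γ ν) {f : E3 → ℂ} {L : E3 →L[ℝ] ℂ} {x : E3}
    (hx : x ∈ Γ) (hf : HasFDerivWithinAt f L Γ x) {a : E3} (ha : inner ℝ (ν x) a = (0 : ℝ)) :
    fderivWithin ℝ f Γ x a = L a := by
  obtain ⟨G, δ, rfl, hG⟩ := hS.exists_chart x hx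
  rw [hG.normal_center] at ha
  have hF : HasFDerivWithinAt G.F (G.DF 0) (G.F ⁻¹' Metric.ball G.center δ) 0 :=
    (G.hasFDerivAt_F 0).hasFDerivWithinAt
  have hmaps : Set.MapsTo G.F (G.F ⁻¹' Metric.ball G.center δ) Γ := fun u hu => hG.F_mem hu
  have hU : G.F ⁻¹' Metric.ball G.center δ ∈ 𝓝 (0 : E2) :=
    (Metric.isOpen_ball.preimage G.continuous_F).mem_nhds (by
      rw [Set.mem_preimage, G.F_zero]; exact Metric.mem_ball_self hG.pos)
  have h1 := hf.differentiableWithinAt.hasFDerivWithinAt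
  rw [← G.F_zero] at hf h1
  have h2 := ((hf.comp 0 hF hmaps).hasFDerivAt hU).unique ((h1.comp 0 hF hmaps).hasFDerivAt hU)
  have h3 := congrArg (fun T => T (G.coordsL a)) h2
  simp only [ContinuousLinearMap.comp_apply, G.DF_zero_coordsL ha, G.F_zero] at h3
  exact h3.symm

lemma inner_normal_tangent (hS : IsChartedSurface Γ ν) {x : E3} (hx : x ∈ Γ) (i : Fin 3) :
    inner ℝ (ν x) (EuclideanSpace.single i 1 - ν x i • ν x) = (0 : ℝ) := by
  rw [inner_sub_right, inner_smul_right, real_inner_self_eq_norm_sq, hS.norm_normal hx]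
  simp [EuclideanSpace.inner_single_right]

/-- The tangential projection changes the gradient by a multiple of n, which the cross product with
n annihilates. -/
lemma cross_tangential (n : E3) (L : E3 →L[ℝ] ℂ) :
    crossProduct (cvec n) (fun i => L (EuclideanSpace.single i 1 - n i • n)) =
      crossProduct (cvec n) fun i => L (EuclideanSpace.single i 1) := by
  have e : (fun i => L (EuclideanSpace.single i 1 - n i • n)) =
      (fun i => L (EuclideanSpace.single i 1)) - L n • cvec n := by
    ext i
    simp [cvec, mul_comm]
  rw [e, map_sub, map_smul, cross_self, smul_zero, sub_zero]

lemma surfCurl_eq (hS : IsChartedSurface Γ ν) {f : E3 → ℂ} {L : E3 →L[ℝ] ℂ} {x : E3}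
    (hx : x ∈ Γ) (hf : HasFDerivWithinAt f L Γ x) :
    surfCurl Γ ν f x = crossProduct (cvec (ν x)) fun i => L (EuclideanSpace.single i 1) := by
  rw [surfCurl, ← cross_tangential]
  congr 1
  ext i
  exact hS.fderivWithin_tangent hx hf (hS.inner_normal_tangent hx i)

lemma surfCurl_eq_of_extension (hS : IsChartedSurface Γ ν) {f g : E3 → ℂ} (hg : ContDiff ℝ 1 g)
    (h : ∀ y ∈ Γ, g y = f y) {x : E3} (hx : x ∈ Γ) :
    surfCurl Γ ν f x = crossProduct (cvec (ν x)) (grad g x) := by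
  have h1 := (hg.differentiable (by norm_num) x).hasFDerivAt.hasFDerivWithinAt (s := Γ)
  exact hS.surfCurl_eq hx (h1.congr (fun y hy => (h y hy).symm) (h x hx).symm)

/-! ### Normal derivatives of the kernels -/

lemma _root_.Poroelastic.GraphPatch.exists_taylor_h (G : GraphPatch) : ∃ K : ℝ, 0 ≤ K ∧
    ∀ u v, |G.h u - G.h v - fderiv ℝ G.h v (u - v)| ≤ K * ‖u - v‖ ^ 2 := by
  obtain ⟨K, hK, h⟩ := G.exists_lipschitz_fderiv_h
  refine ⟨K, hK, fun u v => ?_⟩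
  -- Mean value inequality for h minus its linear part at v, whose derivative is at most K|u − v| on
  -- the ball.
  have h1 := Convex.norm_image_sub_le_of_norm_hasFDerivWithin_le (𝕜 := ℝ)
    (f := fun w => G.h w - fderiv ℝ G.h v w) (f' := fun w => fderiv ℝ G.h w - fderiv ℝ G.h v)
    (s := Metric.closedBall v ‖u - v‖) (C := K * ‖u - v‖) (x := v) (y := u)
    (fun w _ => ((G.contDiff.differentiable (by norm_num) w).hasFDerivAt.sub
      (fderiv ℝ G.h v).hasFDerivAt).hasFDerivWithinAt)
    (fun w hw => (h w v).trans (by gcongr; simpa [dist_eq_norm] using hw))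
    (convex_closedBall v _) (by simp) (by simp [dist_eq_norm])
  rw [Real.norm_eq_abs] at h1
  rw [sq, ← mul_assoc]
  convert h1 using 2
  rw [map_sub]; ring

/-- The normal is almost orthogonal to short chords. -/
lemma exists_inner_normal_le (hS : IsChartedSurface Γ ν) : ∃ C : ℝ, 0 ≤ C ∧
    ∀ x ∈ Γ, ∀ y ∈ Γ, |(inner ℝ (ν y) (x - y) : ℝ)| ≤ C * ‖x - y‖ ^ 2 := by
  -- Compactness of Γ × Γ reduces the estimate to neighbourhoods of single pairs. On the diagonal,
  -- the product of the unnormalized normal with a chord is the Taylor remainder of the graph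
  -- function; off the diagonal, |x − y| is bounded below and Cauchy–Schwarz suffices.
  have key := (hS.isCompact.prod hS.isCompact).induction_on
    (p := fun s => ∃ C : ℝ, 0 ≤ C ∧ ∀ z ∈ s, z.1 ∈ Γ → z.2 ∈ Γ →
      |(inner ℝ (ν z.2) (z.1 - z.2) : ℝ)| ≤ C * ‖z.1 - z.2‖ ^ 2)
    ⟨0, le_rfl, by simp⟩ (fun s t hst ⟨C, hC, h⟩ => ⟨C, hC, fun z hz => h z (hst hz)⟩)
    (fun s t ⟨C, hC, h⟩ ⟨D, hD, h'⟩ => ⟨C + D, by positivity, fun z hz h1 h2 => by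
      rcases hz with hz | hz
      · exact (h z hz h1 h2).trans (by gcongr; linarith)
      · exact (h' z hz h1 h2).trans (by gcongr; linarith)⟩) ?_
  · obtain ⟨C, hC, h⟩ := key
    exact ⟨C, hC, fun x hx y hy => h (x, y) ⟨hx, hy⟩ hx hy⟩
  rintro ⟨x₀, y₀⟩ ⟨hx₀, hy₀⟩
  by_cases hxy : x₀ = y₀
  · subst hxy
    obtain ⟨G, δ, rfl, hG⟩ := hS.exists_chart x₀ hx₀
    obtain ⟨K, hK, hKb⟩ := G.exists_taylor_h
    refine ⟨Metric.ball G.center δ ×ˢ Metric.ball G.center δ, mem_nhdsWithin_of_mem_nhds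
      (prod_mem_nhds (Metric.ball_mem_nhds _ hG.pos) (Metric.ball_mem_nhds _ hG.pos)), K, hK, ?_⟩
    rintro ⟨x, y⟩ ⟨hx, hy⟩ hxΓ hyΓ
    simp only at hx hy hxΓ hyΓ ⊢
    have h1 := hG.F_coords hx hxΓ
    have h2 := hG.F_coords hy hyΓ
    rw [hG.normal y hy hyΓ]
    set u := G.coords x
    set v := G.coords y
    have e : (inner ℝ (G.normalVec v) (G.F u - G.F v) : ℝ) =
        G.h u - G.h v - fderiv ℝ G.h v (u - v) := by
      have h3 : G.F u - G.F v = G.DF v (u - v) +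
          (G.h u - G.h v - fderiv ℝ G.h v (u - v)) • G.b 2 := by
        rw [G.F_sub, G.DF_apply]; module
      rw [h3, inner_add_right, G.inner_normalVec_DF, inner_smul_right]
      simp [GraphPatch.normalVec, inner_sub_left, inner_smul_left]
    rw [← h1, ← h2, real_inner_smul_left, e, abs_mul, abs_inv, abs_of_pos (G.jac_pos v)]
    have hj : (G.jac v)⁻¹ ≤ 1 := by
      refine inv_le_one_of_one_le₀ ?_
      refine (pow_le_pow_iff_left₀ zero_le_one (G.jac_pos v).le two_ne_zero).1 ?_
      rw [G.jac_sq]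
      nlinarith [sq_nonneg (G.slope 0 v), sq_nonneg (G.slope 1 v)]
    calc _ ≤ 1 * (K * ‖u - v‖ ^ 2) := by gcongr; exact hKb u v
      _ ≤ _ := by rw [one_mul]; gcongr; exact G.norm_sub_le_norm_F_sub u v
  · set d := ‖x₀ - y₀‖ with hd
    have hdpos : 0 < d := norm_pos_iff.2 (sub_ne_zero.2 hxy)
    have hopen : IsOpen {z : E3 × E3 | d / 2 < ‖z.1 - z.2‖} :=
      isOpen_lt continuous_const (by fun_prop)
    refine ⟨_, mem_nhdsWithin_of_mem_nhds (hopen.mem_nhds (show d / 2 < ‖x₀ - y₀‖ by linarith)),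
      2 / d, by positivity, ?_⟩
    rintro ⟨x, y⟩ hz hxΓ hyΓ
    simp only [Set.mem_ofPred_eq] at hz hxΓ hyΓ ⊢
    refine (abs_real_inner_le_norm _ _).trans ?_
    rw [hS.norm_normal hyΓ, one_mul, sq, ← mul_assoc]
    refine le_mul_of_one_le_left (norm_nonneg _) ?_
    rw [div_mul_eq_mul_div, le_div_iff₀ hdpos]
    linarith

end IsChartedSurface

/-- The kernel is radial, so its gradient is parallel to z. This exposes the factor n·z, which is
quadratically small for a surface normal and a chord. -/
lemma fderiv_helmZ_eq (k : ℂ) {z : E3} (hz : z ≠ 0) (n : E3) :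
    fderiv ℝ (helmZ k) z n = ((inner ℝ n z / ‖z‖ ^ 2 : ℝ) : ℂ) * fderiv ℝ (helmZ k) z z := by
  have hz' : (‖z‖ : ℂ) ≠ 0 := by exact_mod_cast norm_ne_zero_iff.2 hz
  have hpi : (Real.pi : ℂ) ≠ 0 := by exact_mod_cast Real.pi_ne_zero
  have h : DifferentiableAt ℝ (fun t : ℝ => Complex.exp (Complex.I * k * t) / (4 * Real.pi * t)) ‖z‖ := by
    have h1 : DifferentiableAt ℝ (fun t : ℝ => (t : ℂ)) ‖z‖ := Complex.ofRealCLM.differentiableAt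
    refine DifferentiableAt.fun_div ?_ (by fun_prop) (by simp [hz, Real.pi_ne_zero])
    exact (h1.const_mul _).cexp
  have h2 := h.hasDerivAt.hasFDerivAt.comp z (hasFDerivAt_norm_apply hz)
  have e : fderiv ℝ (helmZ k) z = _ := h2.fderiv
  rw [e]
  generalize deriv (fun t : ℝ => Complex.exp (Complex.I * k * t) / (4 * Real.pi * t)) ‖z‖ = D
  simp [real_inner_comm]
  field_simp

/-- The double layer kernel is weakly singular. -/
lemma IsChartedSurface.exists_bound_normal {Γ : Set E3} {ν : E3 → E3} (hS : IsChartedSurface Γ ν)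
    (k : ℂ) : ∃ C : ℝ, 0 ≤ C ∧ ∀ x ∈ Γ, ∀ y ∈ Γ, x ≠ y →
      ‖∑ i, cvec (ν y) i * pd i (helmZ k) (x - y)‖ ≤ C / ‖x - y‖ ∧
      ‖∑ i, cvec (ν x) i * pd i (helmZ k) (x - y)‖ ≤ C / ‖x - y‖ := by
  obtain ⟨A, hA, h⟩ := hS.exists_inner_normal_le
  obtain ⟨R, hR⟩ := (hS.isCompact.prod hS.isCompact).exists_bound_of_continuousOn
    (f := fun z : E3 × E3 => z.1 - z.2) (by fun_prop)
  obtain ⟨B, hB, hb⟩ := (isSing_helmZ k).bound_fderiv R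
  have main : ∀ n z : E3, z ≠ 0 → ‖z‖ ≤ R → |(inner ℝ n z : ℝ)| ≤ A * ‖z‖ ^ 2 →
      ‖∑ i, cvec n i * pd i (helmZ k) z‖ ≤ A * B / ‖z‖ := by
    intro n z hz hzR hn
    have hpos := norm_pos_iff.2 hz
    have e : ∑ i, cvec n i * pd i (helmZ k) z = fderiv ℝ (helmZ k) z n :=
      (fderiv_apply_eq_sum_pd _ _ _).symm
    rw [e, fderiv_helmZ_eq k hz, norm_mul, Complex.norm_real, Real.norm_eq_abs, abs_div,
      abs_of_pos (pow_pos hpos 2)]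
    calc _ ≤ A * ‖z‖ ^ 2 / ‖z‖ ^ 2 * (B / ‖z‖ ^ (1 + 1) * ‖z‖) := by
          gcongr
          exact (ContinuousLinearMap.le_opNorm _ _).trans (by gcongr; exact hb z hz hzR)
      _ = _ := by field_simp; ring
  refine ⟨A * B, by positivity, fun x hx y hy hxy => ?_⟩
  have hxy' := sub_ne_zero.2 hxy
  refine ⟨main _ _ hxy' (hR (x, y) ⟨hx, hy⟩) (h x hx y hy),
    main _ _ hxy' (hR (x, y) ⟨hx, hy⟩) ?_⟩
  have := h y hy x hx
  rwa [← neg_sub x y, inner_neg_right, abs_neg, norm_neg] at this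

/-! ### Weak singularity of the kernels -/

lemma even_pd_pd {f : E3 → ℂ} (hf : ∀ z, f (-z) = f z) (i j : Fin 3) (z : E3) :
    pd i (pd j f) (-z) = pd i (pd j f) z := by
  have h0 : (fun v => f (-v)) = f := funext hf
  have h1 : (fun v => pd j f (-v)) = fun v => (-1) * pd j f v := by
    funext v
    have := pd_comp_neg j f v
    rw [h0] at this
    rw [this]; ring
  have h2 := pd_comp_neg i (pd j f) z
  rw [h1, pd_const_mul'] at h2
  linear_combination h2

section kernels

variable (P : Params) (k₁ k₂ : ℂ)

lemma diffZ_neg (z : E3) : diffZ k₁ k₂ (-z) = diffZ k₁ k₂ z := by simp only [diffZ, helmZ_neg]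

lemma potZ_neg (z : E3) : potZ P k₁ k₂ (-z) = potZ P k₁ k₂ z := by simp only [potZ, helmZ_neg]

lemma matN23_neg (l j : Fin 3) (z : E3) : matN23 P k₁ k₂ l j (-z) = matN23 P k₁ k₂ l j z := by
  simp only [matN23, helmZ_neg, even_pd_pd (potZ_neg P k₁ k₂)]

lemma matN22_neg (l j : Fin 3) (z : E3) : matN22 P k₁ k₂ l j (-z) = matN22 P k₁ k₂ l j z := by
  simp only [matN22, even_pd_pd (diffZ_neg k₁ k₂)]

lemma isSing_matN23 (hne : k₁ ^ 2 ≠ k₂ ^ 2) (l j : Fin 3) : IsSing 1 (matN23 P k₁ k₂ l j) := by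
  have h1 := (((isSing_potZ P k₁ k₂ hne l j).const_mul
    (1 / ((P.rho - P.beta * P.rhoF) * P.omega ^ 2))).const_mul (2 * P.mu)).const_mul (-P.beta)
  refine h1.add ?_
  split_ifs
  · exact ((isSing_helmZ P.ks).const_mul _).sub
      ((((isSing_helmZ k₁).const_mul _).sub ((isSing_helmZ k₂).const_mul _)).const_mul _)
  · exact (IsSing.const 0).succ

lemma isSing_matN22 (l j : Fin 3) : IsSing 1 (matN22 P k₁ k₂ l j) := by
  have h : ∀ i j, IsSing 1 (pd i (pd j (diffZ k₁ k₂))) := fun i j => (isSing_diffZ k₁ k₂ j).pd i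
  refine ((h l j).sub ?_).const_mul _
  split_ifs
  · simp only [Fin.sum_univ_three]
    exact ((h 0 0).add (h 1 1)).add (h 2 2)
  · exact (IsSing.const 0).succ

lemma kerN22_apply (x y : E3) (i : Fin 3) : kerN22 P k₁ k₂ x y i =
    -(2 * P.mu * couplingCoeff P k₁ k₂) * pd i (diffZ k₁ k₂) (x - y) := by
  have h : grad (fun w => helm k₁ x w - helm k₂ x w) y i = -pd i (diffZ k₁ k₂) (x - y) :=
    pd_comp_sub_left i (diffZ k₁ k₂) x y
  simp only [kerN22, Pi.smul_apply, smul_eq_mul, h, couplingCoeff]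
  ring

/-- `N₂¹` is a combination of double layer kernels and their adjoints. -/
lemma exists_kerN21_eq : ∃ a b c : ℂ, ∀ (ν : E3 → E3) (x y : E3), x ≠ y → ∀ l,
    kerN21 P k₁ k₂ ν x y l =
      (a * (∑ i, cvec (ν y) i * pd i (helmZ k₁) (x - y)) +
        b * (∑ i, cvec (ν y) i * pd i (helmZ k₂) (x - y)) +
        c * (∑ i, cvec (ν y) i * pd i (helmZ P.ks) (x - y))) * cvec (ν x) l -
      c * (∑ i, cvec (ν x) i * pd i (helmZ P.ks) (x - y)) * cvec (ν y) l := by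
  let t := Complex.I * P.omega * P.gam * P.alpha * P.beta /
            ((k₁ ^ 2 - k₂ ^ 2) * (P.lam + 2 * P.mu))
          - P.beta * (k₂ ^ 2 - P.q) / (k₁ ^ 2 - k₂ ^ 2)
  refine ⟨-((P.alpha - P.beta) / (k₁ ^ 2 - k₂ ^ 2) * k₁ ^ 2) - P.beta + t -
      P.alpha / (k₁ ^ 2 - k₂ ^ 2) * (P.kp ^ 2 - k₁ ^ 2),
    (P.alpha - P.beta) / (k₁ ^ 2 - k₂ ^ 2) * k₂ ^ 2 - t +
      P.alpha / (k₁ ^ 2 - k₂ ^ 2) * (P.kp ^ 2 - k₂ ^ 2), P.beta, fun ν x y hxy l => ?_⟩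
  rw [kerN21_apply P k₁ k₂ ν hxy]
  simp only [Fin.sum_univ_three, t]
  ring

end kernels

namespace IsChartedSurface

variable {Γ : Set E3} {ν : E3 → E3}

/-- The off-diagonal part of `Γ × Γ`. -/
def offDiag (Γ : Set E3) : Set (E3 × E3) := {z | z.1 ∈ Γ ∧ z.2 ∈ Γ ∧ z.1 ≠ z.2}

lemma continuousOn_sing {m : ℕ} {H : E3 → ℂ} (hH : IsSing m H) :
    ContinuousOn (fun z : E3 × E3 => H (z.1 - z.2)) (offDiag Γ) :=
  hH.contDiffOn.continuousOn.comp (by fun_prop) fun _ hz => sub_ne_zero.2 hz.2.2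

lemma continuousOn_cvec (hS : IsChartedSurface Γ ν) (l : Fin 3) :
    ContinuousOn (fun y => cvec (ν y) l) Γ := by
  have h : Continuous fun v : E3 => cvec v l := (contDiff_coord l).continuous
  exact h.comp_continuousOn hS.continuousOn_normal

lemma norm_cvec_le (hS : IsChartedSurface Γ ν) {y : E3} (hy : y ∈ Γ) (l : Fin 3) :
    ‖cvec (ν y) l‖ ≤ 1 := by
  rw [cvec, Complex.norm_real, ← hS.norm_normal hy]
  exact PiLp.norm_apply_le (ν y) l

lemma isWeaklySingularKernel_of_isSing (hS : IsChartedSurface Γ ν) {K : Fin 3 → Fin 3 → E3 → ℂ}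
    (hK : ∀ l j, IsSing 1 (K l j)) {g : Fin 3 → E3 → ℂ} (hg : ∀ j, ContinuousOn (g j) Γ)
    {k : E3 → E3 → C3} (hk : ∀ x y l, k x y l = ∑ j, K l j (x - y) * g j y) :
    IsWeaklySingularKernel Γ k := by
  constructor
  · refine continuousOn_pi.2 fun l => ?_
    simp only [hk]
    exact continuousOn_finsetSum _ fun j _ => (continuousOn_sing (hK l j)).mul
      ((hg j).comp continuousOn_snd fun z hz => hz.2.1)
  · obtain ⟨R, hR⟩ := (hS.isCompact.prod hS.isCompact).exists_bound_of_continuousOn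
      (f := fun z : E3 × E3 => z.1 - z.2) (by fun_prop)
    choose C hC hCb using fun l j => (hK l j).bound R
    choose M hM using fun j => hS.isCompact.exists_bound_of_continuousOn (hg j)
    refine ⟨∑ l, ∑ j, C l j * |M j|, fun x hx y hy hxy => ?_⟩
    have hnn : ∀ l j, 0 ≤ C l j * |M j| := fun l j => mul_nonneg (hC l j) (abs_nonneg _)
    rw [pi_norm_le_iff_of_nonneg (div_nonneg (Finset.sum_nonneg fun l _ =>
      Finset.sum_nonneg fun j _ => hnn l j) (norm_nonneg _))]
    intro l
    rw [hk]
    calc _ ≤ ∑ j, ‖K l j (x - y) * g j y‖ := norm_sum_le _ _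
      _ ≤ ∑ j, C l j * |M j| / ‖x - y‖ := Finset.sum_le_sum fun j _ => by
          rw [norm_mul, mul_div_right_comm]
          have h1 := hCb l j (x - y) (sub_ne_zero.2 hxy) (hR (x, y) ⟨hx, hy⟩)
          rw [pow_one] at h1
          gcongr
          · exact div_nonneg (hC l j) (norm_nonneg _)
          · exact (hM j y hy).trans (le_abs_self _)
      _ = (∑ j, C l j * |M j|) / ‖x - y‖ := (Finset.sum_div _ _ _).symm
      _ ≤ _ := by
          refine div_le_div_of_nonneg_right ?_ (norm_nonneg _)
          exact Finset.single_le_sum (f := fun l => ∑ j, C l j * |M j|)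
            (fun l _ => Finset.sum_nonneg fun j _ => hnn l j) (Finset.mem_univ l)

variable (P : Params) (k₁ k₂ : ℂ)

lemma isWeaklySingularKernel_kerN23 (hS : IsChartedSurface Γ ν) (hne : k₁ ^ 2 ≠ k₂ ^ 2) :
    IsWeaklySingularKernel Γ (kerN23 P k₁ k₂ ν) :=
  hS.isWeaklySingularKernel_of_isSing (isSing_matN23 P k₁ k₂ hne) hS.continuousOn_cvec
    (kerN23_apply P k₁ k₂ ν)

lemma isWeaklySingularKernel_kerN22 (hS : IsChartedSurface Γ ν) :
    IsWeaklySingularKernel Γ (kerN22 P k₁ k₂) :=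
  hS.isWeaklySingularKernel_of_isSing
    (K := fun l _ z => -(2 * P.mu * couplingCoeff P k₁ k₂) * pd l (diffZ k₁ k₂) z)
    -- This kernel contains no normal; a unit density in one slot fits it to the general form.
    (g := fun j _ => if j = 0 then 1 else 0)
    (fun l _ => ((isSing_diffZ k₁ k₂ l).const_mul _).succ) (fun _ => continuousOn_const)
    (fun x y l => by simp [kerN22_apply])

lemma isWeaklySingularKernel_kerN21 (hS : IsChartedSurface Γ ν) :
    IsWeaklySingularKernel Γ (kerN21 P k₁ k₂ ν) := by
  obtain ⟨a, b, c, habc⟩ := exists_kerN21_eq P k₁ k₂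
  constructor
  · refine continuousOn_pi.2 fun l => ?_
    have hx : ∀ i, ContinuousOn (fun z : E3 × E3 => cvec (ν z.1) i) (offDiag Γ) := fun i =>
      (hS.continuousOn_cvec i).comp continuousOn_fst fun z hz => hz.1
    have hy : ∀ i, ContinuousOn (fun z : E3 × E3 => cvec (ν z.2) i) (offDiag Γ) := fun i =>
      (hS.continuousOn_cvec i).comp continuousOn_snd fun z hz => hz.2.1
    have hk : ∀ k i, ContinuousOn (fun z : E3 × E3 => pd i (helmZ k) (z.1 - z.2)) (offDiag Γ) :=
      fun k i => continuousOn_sing ((isSing_helmZ k).pd i)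
    have hs : ∀ k, ContinuousOn (fun z : E3 × E3 =>
        ∑ i, cvec (ν z.2) i * pd i (helmZ k) (z.1 - z.2)) (offDiag Γ) := fun k =>
      continuousOn_finsetSum _ fun i _ => (hy i).mul (hk k i)
    have hs' : ContinuousOn (fun z : E3 × E3 =>
        ∑ i, cvec (ν z.1) i * pd i (helmZ P.ks) (z.1 - z.2)) (offDiag Γ) :=
      continuousOn_finsetSum _ fun i _ => (hx i).mul (hk P.ks i)
    refine ContinuousOn.congr (f := fun z : E3 × E3 =>
      (a * (∑ i, cvec (ν z.2) i * pd i (helmZ k₁) (z.1 - z.2)) +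
        b * (∑ i, cvec (ν z.2) i * pd i (helmZ k₂) (z.1 - z.2)) +
        c * (∑ i, cvec (ν z.2) i * pd i (helmZ P.ks) (z.1 - z.2))) * cvec (ν z.1) l -
      c * (∑ i, cvec (ν z.1) i * pd i (helmZ P.ks) (z.1 - z.2)) * cvec (ν z.2) l) ?_
      fun z hz => habc ν z.1 z.2 hz.2.2 l
    exact ((((continuousOn_const.mul (hs k₁)).add (continuousOn_const.mul (hs k₂))).add
      (continuousOn_const.mul (hs P.ks))).mul (hx l)).sub
      ((continuousOn_const.mul hs').mul (hy l))
  · obtain ⟨C₁, hC₁, h₁⟩ := hS.exists_bound_normal k₁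
    obtain ⟨C₂, hC₂, h₂⟩ := hS.exists_bound_normal k₂
    obtain ⟨C₃, hC₃, h₃⟩ := hS.exists_bound_normal P.ks
    refine ⟨(‖a‖ * C₁ + ‖b‖ * C₂ + ‖c‖ * C₃) * 1 + ‖c‖ * C₃ * 1, fun x hx y hy hxy => ?_⟩
    rw [pi_norm_le_iff_of_nonneg (by positivity)]
    intro l
    rw [habc ν x y hxy l]
    refine (norm_sub_le _ _).trans ?_
    rw [norm_mul, norm_mul, norm_mul]
    calc _ ≤ (‖a‖ * (C₁ / ‖x - y‖) + ‖b‖ * (C₂ / ‖x - y‖) + ‖c‖ * (C₃ / ‖x - y‖)) * 1 +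
          ‖c‖ * (C₃ / ‖x - y‖) * 1 := by
          gcongr
          · refine (norm_add₃_le).trans ?_
            rw [norm_mul, norm_mul, norm_mul]
            gcongr
            · exact (h₁ x hx y hy hxy).1
            · exact (h₂ x hx y hy hxy).1
            · exact (h₃ x hx y hy hxy).1
          · exact hS.norm_cvec_le hx l
          · exact (h₃ x hx y hy hxy).2
          · exact hS.norm_cvec_le hy l
      _ = _ := by ring

lemma integrableOn_of_isWeaklySingularKernel (hS : IsChartedSurface Γ ν) {k : E3 → E3 → C3}
    (hk : IsWeaklySingularKernel Γ k) {p : E3 → ℂ} (hp : ContinuousOn p Γ) {x : E3} (hx : x ∈ Γ) :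
    IntegrableOn (fun y => p y • k x y) Γ μHE[2] := by
  obtain ⟨hc, C, hC⟩ := hk
  obtain ⟨M, hM⟩ := hS.isCompact.exists_bound_of_continuousOn hp
  refine hS.integrableOn_of_bound (C := M * C) hx ?_ fun y hy hyx => ?_
  · refine (hp.mono Set.sdiff_subset).smul ?_
    exact hc.comp (f := fun y : E3 => (x, y)) (by fun_prop) fun y hy => ⟨hx, hy.1, Ne.symm hy.2⟩
  · rw [norm_smul, mul_div_assoc, norm_sub_rev y x]
    exact mul_le_mul (hM y hy) (hC x hx y hy hyx.symm) (norm_nonneg _)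
      ((norm_nonneg _).trans (hM y hy))

end IsChartedSurface

/-! ### Günter derivatives of the potentials -/

lemma crossMat_cross (n w : C3) (i j : Fin 3) :
    crossMat (crossProduct n w) i j = w i * n j - n i * w j := by
  fin_cases i <;> fin_cases j <;> simp [crossMat, crossProduct] <;> ring

lemma gunterJac_apply (n : C3) (J : Fin 3 → C3) (l : Fin 3) :
    gunterJac n J l = ∑ i, (J i l * n i - n l * J i i) := by
  simp only [gunterJac, crossMat_cross]

namespace IsChartedSurface

variable {Γ : Set E3} {ν : E3 → E3}

/-- Günter derivative of a matrix potential with even weakly singular entries. -/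
lemma tendsto_gunter (hS : IsChartedSurface Γ ν) {K : Fin 3 → Fin 3 → E3 → ℂ}
    (hK : ∀ i j, IsSing 1 (K i j)) (he : ∀ i j z, K i j (-z) = K i j z) {f : Fin 3 → E3 → ℂ}
    (hf : ∀ j, ContDiff ℝ 1 (f j)) {u : E3 → C3}
    (hu : ∀ z ∈ Γ, ∀ i, u z i = ∑ j, ∫ y in Γ, K i j (z - y) * f j y ∂μHE[2])
    {x : E3} (hx : x ∈ Γ) :
    DifferentiableWithinAt ℝ u Γ x ∧ ∀ l,
      (∀ ε > 0, IntegrableOn (fun y => gunterJac (cvec (ν x))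
        (fun i b => ∑ j, pd b (K i j) (x - y) * f j y) l) (Γ \ Metric.ball x ε) μHE[2]) ∧
      Tendsto (fun ε => ∫ y in Γ \ Metric.ball x ε, gunterJac (cvec (ν x))
        (fun i b => ∑ j, pd b (K i j) (x - y) * f j y) l ∂μHE[2]) (𝓝[>] 0)
        (𝓝 (gunter Γ ν u x l)) := by
  choose L hL hT using fun i j => hS.hasFDerivWithinAt_potential (hK i j) (he i j) (hf j) hx
  have hui : ∀ i, HasFDerivWithinAt (fun z => u z i) (∑ j, L i j) Γ x := fun i =>
    (HasFDerivWithinAt.fun_sum fun j _ => hL i j).congr (fun z hz => hu z hz i) (hu x hx i)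
  refine ⟨differentiableWithinAt_pi.2 fun i => (hui i).differentiableWithinAt, fun l => ?_⟩
  -- The Günter derivative only sees tangential derivatives, so the coordinate directions may be
  -- replaced by their projections, for which the principal values are known to exist.
  let τ : Fin 3 → E3 := fun b => EuclideanSpace.single b 1 - ν x b • ν x
  let T : E3 → Fin 3 → C3 := fun y i b => ∑ j, fderiv ℝ (K i j) (x - y) (τ b) * f j y
  have hcross : ∀ y i, crossProduct (cvec (ν x)) (fun b => ∑ j, pd b (K i j) (x - y) * f j y) =
      crossProduct (cvec (ν x)) (T y i) := by
    intro y i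
    have h := cross_tangential (ν x) (∑ j, f j y • fderiv ℝ (K i j) (x - y))
    convert h.symm using 2
    · ext b; simp [pd, mul_comm]
    · ext b; simp [T, τ, mul_comm]
  have hJ : ∀ y, gunterJac (cvec (ν x)) (fun i b => ∑ j, pd b (K i j) (x - y) * f j y) l =
      ∑ i, (T y i l * cvec (ν x) i - cvec (ν x) l * T y i i) := by
    intro y
    rw [← gunterJac_apply]
    simp only [gunterJac, hcross]
  have hTi : ∀ ε > 0, ∀ i b j, IntegrableOn
      (fun y => fderiv ℝ (K i j) (x - y) (τ b) * f j y) (Γ \ Metric.ball x ε) μHE[2] :=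
    fun ε hε i b j => hS.integrableOn_truncated
      (continuousOn_fderiv_mul (hK i j) (hf j).continuous.continuousOn x (τ b)) hε
  have hTi' : ∀ ε > 0, ∀ i b, IntegrableOn (fun y => T y i b) (Γ \ Metric.ball x ε) μHE[2] :=
    fun ε hε i b => integrable_finsetSum _ fun j _ => hTi ε hε i b j
  have hTl : ∀ i b, Tendsto (fun ε => ∫ y in Γ \ Metric.ball x ε, T y i b ∂μHE[2]) (𝓝[>] 0)
      (𝓝 ((∑ j, L i j) (τ b))) := by
    intro i b
    have h := tendsto_finsetSum Finset.univ fun j _ =>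
      hT i j (τ b) (hS.inner_normal_tangent hx b)
    rw [← sum_apply] at h
    refine h.congr' ?_
    filter_upwards [self_mem_nhdsWithin] with ε hε
    exact (integral_finsetSum _ fun j _ => hTi ε hε i b j).symm
  have hg : gunter Γ ν u x l =
      ∑ i, ((∑ j, L i j) (τ l) * cvec (ν x) i - cvec (ν x) l * (∑ j, L i j) (τ i)) := by
    simp only [gunter, gunterScalar_eq, hS.surfCurl_eq hx (hui _), ← cross_tangential,
      crossMat_cross]
    rfl
  have hterm : ∀ ε > 0, ∀ i, IntegrableOn
      (fun y => T y i l * cvec (ν x) i - cvec (ν x) l * T y i i) (Γ \ Metric.ball x ε) μHE[2] :=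
    fun ε hε i => ((hTi' ε hε i l).mul_const _).sub ((hTi' ε hε i i).const_mul _)
  simp only [hJ]
  refine ⟨fun ε hε => integrable_finsetSum _ fun i _ => hterm ε hε i, ?_⟩
  rw [hg]
  refine (tendsto_finsetSum Finset.univ fun i _ => ((hTl i l).mul_const (cvec (ν x) i)).sub
    ((hTl i i).const_mul (cvec (ν x) l))).congr' ?_
  filter_upwards [self_mem_nhdsWithin] with ε hε
  rw [integral_finsetSum _ fun i _ => hterm ε hε i]
  refine Finset.sum_congr rfl fun i _ => ?_
  rw [integral_sub ((hTi' ε hε i l).mul_const _) ((hTi' ε hε i i).const_mul _),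
    integral_mul_const, integral_const_mul]

/-! ### The potentials with a `C¹` density -/

lemma _root_.Poroelastic.IsSing.isMild {D : E3 → ℂ} (hD : IsSing 0 D) (z : E3) :
    IsMild z fun y => D (z - y) := by
  have hm : Set.MapsTo (fun y => z - y) {z}ᶜ {0}ᶜ := fun y hy => sub_ne_zero.2 (Ne.symm hy)
  refine ⟨(hD.contDiffOn.of_le (by exact_mod_cast le_top)).comp
    (contDiff_const.sub contDiff_id).contDiffOn hm, fun R => ?_⟩
  obtain ⟨A, hA, hAb⟩ := hD.bound R
  obtain ⟨B, hB, hBb⟩ := hD.bound_fderiv R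
  refine ⟨A + B, by positivity, fun y hy hyR => ?_⟩
  rw [norm_sub_rev] at hyR ⊢
  have hne : z - y ≠ 0 := hm hy
  constructor
  · have := hAb _ hne hyR
    rw [pow_zero, div_one] at this
    linarith
  · have h : fderiv ℝ (fun y => D (z - y)) y = -fderiv ℝ D (z - y) := by
      have h1 := (hD.differentiableAt hne).hasFDerivAt.comp y ((hasFDerivAt_id y).const_sub z)
      have h2 : fderiv ℝ (fun y => D (z - y)) y = _ := h1.fderiv
      rw [h2]
      ext v; simp
    rw [h, norm_neg]
    have := hBb _ hne hyR
    rw [zero_add, pow_one] at this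
    exact this.trans (by gcongr; linarith)

variable (P : Params) (k₁ k₂ : ℂ)

lemma N23_apply (hS : IsChartedSurface Γ ν) (hne : k₁ ^ 2 ≠ k₂ ^ 2) {p : E3 → ℂ}
    {f : Fin 3 → E3 → ℂ} (hf : ∀ j, Continuous (f j)) (hfp : ∀ j, ∀ y ∈ Γ, f j y = cvec (ν y) j * p y)
    (hp : ContinuousOn p Γ) {z : E3} (hz : z ∈ Γ) (l : Fin 3) :
    N23 P k₁ k₂ Γ ν p z l = ∑ j, ∫ y in Γ, matN23 P k₁ k₂ l j (z - y) * f j y ∂μHE[2] := by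
  have hi := hS.integrableOn_of_isWeaklySingularKernel
    (hS.isWeaklySingularKernel_kerN23 P k₁ k₂ hne) hp hz
  rw [N23, eval_integral fun i => Integrable.eval hi i, ← integral_finsetSum _ fun j _ =>
    hS.integrableOn_sing (isSing_matN23 P k₁ k₂ hne l j) (hf j).continuousOn hz]
  refine setIntegral_congr_fun hS.measurableSet fun y hy => ?_
  simp only [Pi.smul_apply, smul_eq_mul, kerN23_apply, Finset.mul_sum]
  refine Finset.sum_congr rfl fun j _ => ?_
  rw [hfp j y hy]
  ring

lemma _root_.Poroelastic.integral_crossMat_eq_zero {μ : Measure E3} {s : E3 → C3}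
    (hs : ∀ k, Integrable (fun y => s y k) μ ∧ ∫ y, s y k ∂μ = 0) (i j : Fin 3) :
    Integrable (fun y => crossMat (s y) i j) μ ∧ ∫ y, crossMat (s y) i j ∂μ = 0 := by
  have h0 : Integrable (fun _ : E3 => (0 : ℂ)) μ := integrable_zero _ _ _
  fin_cases i <;> fin_cases j <;>
    simp [crossMat, integral_neg, (hs _).2, (hs _).1, (hs _).1.fun_neg, h0]

/-- Integration by parts on Γ: the integral of ν × ∇(p ∂ᵢ(γ_{k₁} − γ_{k₂})) vanishes, so the surface
derivative passes from p to the kernel and produces the second derivatives in `matN22`. -/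
lemma N22_apply (hS : IsChartedSurface Γ ν) {p g : E3 → ℂ} (hg : ContDiff ℝ 1 g)
    (hgp : ∀ y ∈ Γ, g y = p y)
    {f : Fin 3 → E3 → ℂ} (hf : ∀ j, Continuous (f j)) (hfp : ∀ j, ∀ y ∈ Γ, f j y = cvec (ν y) j * p y)
    {z : E3} (hz : z ∈ Γ) :
    IntegrableOn (fun y => kerN22 P k₁ k₂ z y ᵥ* gunterScalar Γ ν p y) Γ μHE[2] ∧ ∀ l,
    N22 P k₁ k₂ Γ (gunterScalar Γ ν p) z l =
      ∑ j, ∫ y in Γ, matN22 P k₁ k₂ l j (z - y) * f j y ∂μHE[2] := by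
  let D : Fin 3 → E3 → ℂ := fun i y => pd i (diffZ k₁ k₂) (z - y)
  have hD : ∀ i, IsMild z fun y => D i y * g y := fun i =>
    ((isSing_diffZ k₁ k₂ i).isMild z).mul (IsMild.of_contDiff hg z)
  let S : Fin 3 → E3 → C3 := fun i y => crossProduct (cvec (ν y)) (grad (fun w => D i w * g w) y)
  have hS0 : ∀ i j, IntegrableOn (fun y => crossMat (S i y) i j) Γ μHE[2] ∧
      ∫ y in Γ, crossMat (S i y) i j ∂μHE[2] = 0 := fun i j =>
    integral_crossMat_eq_zero (fun k => hS.integral_cross_grad (hD i) k) i j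
  set c : ℂ := 2 * P.mu * couplingCoeff P k₁ k₂ with hc
  have hM : ∀ l j, IntegrableOn (fun y => matN22 P k₁ k₂ l j (z - y) * f j y) Γ μHE[2] :=
    fun l j => hS.integrableOn_sing (isSing_matN22 P k₁ k₂ l j) (hf j).continuousOn hz
  -- Leibniz rule for D·p; the last sum is the total surface derivative that Stokes removes.
  have hpt : ∀ l, ∀ y ∈ Γ, y ≠ z → (kerN22 P k₁ k₂ z y ᵥ* gunterScalar Γ ν p y) l =
      ∑ j, matN22 P k₁ k₂ l j (z - y) * f j y + ∑ i, -c * crossMat (S i y) i l := by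
    intro l y hy hyz
    have hzy : z - y ≠ 0 := sub_ne_zero.2 hyz.symm
    have hgrad : ∀ i b, grad (fun w => D i w * g w) y b =
        D i y * pd b g y - g y * pd b (pd i (diffZ k₁ k₂)) (z - y) := by
      intro i b
      have h1 : DifferentiableAt ℝ (D i) y :=
        ((isSing_diffZ k₁ k₂ i).isMild z).differentiableAt hyz
      have h2 : pd b (D i) y = -pd b (pd i (diffZ k₁ k₂)) (z - y) :=
        pd_comp_sub_left b (pd i (diffZ k₁ k₂)) z y
      rw [grad, pd_mul h1 (hg.differentiable (by norm_num) y), h2]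
      ring
    simp only [gunterScalar_eq, hS.surfCurl_eq_of_extension hg hgp hy, Matrix.vecMul, dotProduct,
      S, crossMat_cross, hgrad, kerN22_apply, matN22, hfp _ y hy, ← hc, ← hgp y hy,
      Fin.sum_univ_three]
    simp only [grad, D]
    fin_cases l <;> simp <;> ring
  have hi : ∀ l, IntegrableOn (fun y => (kerN22 P k₁ k₂ z y ᵥ* gunterScalar Γ ν p y) l) Γ μHE[2] ∧
      ∫ y in Γ, (kerN22 P k₁ k₂ z y ᵥ* gunterScalar Γ ν p y) l ∂μHE[2] =
        ∑ j, ∫ y in Γ, matN22 P k₁ k₂ l j (z - y) * f j y ∂μHE[2] := by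
    intro l
    have hae : (fun y => (kerN22 P k₁ k₂ z y ᵥ* gunterScalar Γ ν p y) l) =ᵐ[μHE[2].restrict Γ]
        fun y => ∑ j, matN22 P k₁ k₂ l j (z - y) * f j y + ∑ i, -c * crossMat (S i y) i l := by
      filter_upwards [ae_ne z, ae_restrict_mem hS.measurableSet] with y h1 h2 using hpt l y h2 h1
    have i1 := integrable_finsetSum Finset.univ fun j _ => hM l j
    have i2 := integrable_finsetSum Finset.univ fun i _ => (hS0 i l).1.const_mul (-c)
    refine ⟨(i1.add i2).congr hae.symm, ?_⟩
    rw [integral_congr_ae hae, integral_add i1 i2, integral_finsetSum _ fun j _ => hM l j,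
      integral_finsetSum _ fun i _ => (hS0 i l).1.const_mul (-c)]
    simp only [integral_const_mul, (hS0 _ l).2, mul_zero, Finset.sum_const_zero, add_zero]
  refine ⟨Integrable.of_eval fun l => (hi l).1, fun l => ?_⟩
  rw [N22, eval_integral fun l => (hi l).1, (hi l).2]

end IsChartedSurface

/-! ### The regularized hyper-singular operator -/

namespace IsChartedSurface

variable {Γ : Set E3} {ν : E3 → E3} (P : Params) (k₁ k₂ : ℂ)

/-- Outside the ball of radius ε the kernel splits by `hyperKernel_eq`. The N₂¹ part converges
absolutely, and the two Günter parts converge by `tendsto_gunter`, for which p and ν are first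
extended to C¹ functions on the whole space. -/
theorem regularization (hS : IsChartedSurface Γ ν) (hP : P.Admissible)
    (hk : P.IsWaveNumbers k₁ k₂) (hne : k₁ ^ 2 ≠ k₂ ^ 2) {p : E3 → ℂ} (hp : ContDiffOn ℝ 1 p Γ)
    {x : E3} (hx : x ∈ Γ) :
    IntegrableOn (fun y => p y • kerN21 P k₁ k₂ ν x y) Γ μHE[2] ∧
      IntegrableOn (fun y => kerN22 P k₁ k₂ x y ᵥ* gunterScalar Γ ν p y) Γ μHE[2] ∧
      IntegrableOn (fun y => p y • kerN23 P k₁ k₂ ν x y) Γ μHE[2] ∧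
      DifferentiableWithinAt ℝ (N22 P k₁ k₂ Γ (gunterScalar Γ ν p)) Γ x ∧
      DifferentiableWithinAt ℝ (N23 P k₁ k₂ Γ ν p) Γ x ∧
      HasN2 P k₁ k₂ Γ ν p x (N21 P k₁ k₂ Γ ν p x +
        gunter Γ ν (N22 P k₁ k₂ Γ (gunterScalar Γ ν p)) x +
        gunter Γ ν (N23 P k₁ k₂ Γ ν p) x) := by
  obtain ⟨g, hg, hgp⟩ := hS.exists_extension_of_contDiffOn hp
  choose n hn hnν using hS.exists_extension_normal
  let f : Fin 3 → E3 → ℂ := fun j y => n j y * g y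
  have hf : ∀ j, ContDiff ℝ 1 (f j) := fun j => (hn j).mul hg
  have hfp : ∀ j, ∀ y ∈ Γ, f j y = cvec (ν y) j * p y := fun j y hy => by
    simp only [f, hnν j y hy, hgp y hy]
  have hpc := hp.continuousOn
  have i21 := hS.integrableOn_of_isWeaklySingularKernel
    (hS.isWeaklySingularKernel_kerN21 P k₁ k₂) hpc hx
  have i23 := hS.integrableOn_of_isWeaklySingularKernel
    (hS.isWeaklySingularKernel_kerN23 P k₁ k₂ hne) hpc hx
  have hN22 := fun z hz => hS.N22_apply P k₁ k₂ hg hgp (fun j => (hf j).continuous) hfp (z := z) hz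
  have hN23 := fun z hz => hS.N23_apply P k₁ k₂ hne (fun j => (hf j).continuous) hfp hpc (z := z) hz
  obtain ⟨d22, t22⟩ := hS.tendsto_gunter (isSing_matN22 P k₁ k₂) (matN22_neg P k₁ k₂) hf
    (fun z hz => (hN22 z hz).2) hx
  obtain ⟨d23, t23⟩ := hS.tendsto_gunter (isSing_matN23 P k₁ k₂ hne) (matN23_neg P k₁ k₂) hf
    hN23 hx
  refine ⟨i21, (hN22 x hx).1, i23, d22, d23, ?_⟩
  have hmeas : ∀ ε, MeasurableSet (Γ \ Metric.ball x ε) := fun ε =>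
    hS.measurableSet.diff Metric.isOpen_ball.measurableSet
  let J : (Fin 3 → Fin 3 → E3 → ℂ) → Fin 3 → E3 → ℂ := fun K l y => gunterJac (cvec (ν x))
    (fun i b => ∑ j, pd b (K i j) (x - y) * f j y) l
  have hpt : ∀ ε > 0, ∀ y ∈ Γ \ Metric.ball x ε, ∀ l,
      (hyperKernel P k₁ k₂ ν x y *ᵥ Sum.elim (0 : C3) (fun _ => p y)) (Sum.inl l) =
        (p y • kerN21 P k₁ k₂ ν x y) l + J (matN22 P k₁ k₂) l y + J (matN23 P k₁ k₂) l y := by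
    rintro ε hε y ⟨hy, hyε⟩ l
    have hxy : x ≠ y := by
      rintro rfl
      exact hyε (Metric.mem_ball_self hε)
    have hd := sub_ne_zero.2 hxy
    have hpd : ∀ i j b, pd b (fun z => matN23 P k₁ k₂ i j z + matN22 P k₁ k₂ i j z) (x - y) =
        pd b (matN23 P k₁ k₂ i j) (x - y) + pd b (matN22 P k₁ k₂ i j) (x - y) := fun i j b =>
      pd_add ((isSing_matN23 P k₁ k₂ hne i j).differentiableAt hd)
        ((isSing_matN22 P k₁ k₂ i j).differentiableAt hd) b
    rw [hyperKernel_eq P k₁ k₂ hP hk hne ν hxy, Pi.smul_apply, smul_eq_mul, add_assoc]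
    congr 1
    simp only [J, gunterJac_apply, hpd, hfp _ y hy, Fin.sum_univ_three]
    ring
  have iT : ∀ ε > 0, ∀ l, IntegrableOn
      (fun y => (p y • kerN21 P k₁ k₂ ν x y) l + J (matN22 P k₁ k₂) l y + J (matN23 P k₁ k₂) l y)
      (Γ \ Metric.ball x ε) μHE[2] := fun ε hε l =>
    (((Integrable.eval i21 l).mono_measure
      (Measure.restrict_mono Set.sdiff_subset le_rfl)).add ((t22 l).1 ε hε)).add ((t23 l).1 ε hε)
  have iK : ∀ ε > 0, ∀ l, IntegrableOn (fun y =>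
      (hyperKernel P k₁ k₂ ν x y *ᵥ Sum.elim (0 : C3) (fun _ => p y)) (Sum.inl l))
      (Γ \ Metric.ball x ε) μHE[2] := fun ε hε l =>
    (iT ε hε l).congr_fun (fun y hy => (hpt ε hε y hy l).symm) (hmeas ε)
  -- The truncated integrals converge as they are, so the coefficients of ε⁻¹ and log ε are zero.
  refine ⟨fun ε hε => Integrable.of_eval (iK ε hε), 0, 0, ?_⟩
  simp only [smul_zero, sub_zero]
  refine tendsto_pi_nhds.2 fun l => ?_
  have l21 : Tendsto (fun ε => ∫ y in Γ \ Metric.ball x ε, (p y • kerN21 P k₁ k₂ ν x y) l ∂μHE[2])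
      (𝓝[>] 0) (𝓝 (N21 P k₁ k₂ Γ ν p x l)) := by
    have h := tendsto_setIntegral_punctured (ae_ne x) (Integrable.eval i21 l)
      (S := fun ε => (Metric.ball x ε)ᶜ) (fun ε => Metric.isOpen_ball.measurableSet.compl)
      fun y hy => by
        filter_upwards [Ioo_mem_nhdsGT (dist_pos.2 hy)] with ε hε
        exact fun h => absurd (Metric.mem_ball.1 h) (not_lt.2 hε.2.le)
    rw [N21, eval_integral fun i => Integrable.eval i21 i]
    refine h.congr fun ε => ?_
    rw [Measure.restrict_restrict Metric.isOpen_ball.measurableSet.compl, Set.inter_comm,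
      ← Set.sdiff_eq]
  have hlim := (l21.add (t22 l).2).add (t23 l).2
  refine hlim.congr' ?_
  filter_upwards [self_mem_nhdsWithin] with ε hε
  have j1 : IntegrableOn (fun y => (p y • kerN21 P k₁ k₂ ν x y) l) (Γ \ Metric.ball x ε) μHE[2] :=
    (Integrable.eval i21 l).mono_measure (Measure.restrict_mono Set.sdiff_subset le_rfl)
  have j2 : IntegrableOn (J (matN22 P k₁ k₂) l) (Γ \ Metric.ball x ε) μHE[2] := (t22 l).1 ε hε
  have j3 : IntegrableOn (J (matN23 P k₁ k₂) l) (Γ \ Metric.ball x ε) μHE[2] := (t23 l).1 ε hε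
  rw [eval_integral (iK ε hε), setIntegral_congr_fun (hmeas ε) fun y hy => hpt ε hε y hy l,
    integral_add (f := fun y => (p y • kerN21 P k₁ k₂ ν x y) l + J (matN22 P k₁ k₂) l y)
      (j1.add j2) j3, integral_add j1 j2]

end IsChartedSurface

end Poroelastic

end

/-! ### The theorem for the boundary of a smooth bounded domain -/

theorem mainTheorem6 (P : Poroelastic.Params) (hP : P.Admissible)
    (k₁ k₂ : ℂ) (hk : P.IsWaveNumbers k₁ k₂) (hne : k₁ ^ 2 ≠ k₂ ^ 2)
    (Ω : Set Poroelastic.E3) (hΩ : Poroelastic.IsSmoothBoundedDomain Ω)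
    (ν : Poroelastic.E3 → Poroelastic.E3) (hν : Poroelastic.IsOutwardUnitNormal Ω ν) :
    (Poroelastic.IsWeaklySingularKernel (frontier Ω) (Poroelastic.kerN21 P k₁ k₂ ν) ∧
      Poroelastic.IsWeaklySingularKernel (frontier Ω) (Poroelastic.kerN22 P k₁ k₂) ∧
      Poroelastic.IsWeaklySingularKernel (frontier Ω) (Poroelastic.kerN23 P k₁ k₂ ν)) ∧
    ∀ p : Poroelastic.E3 → ℂ, ContDiffOn ℝ 1 p (frontier Ω) → ∀ x ∈ frontier Ω,
      IntegrableOn (fun y => p y • Poroelastic.kerN21 P k₁ k₂ ν x y) (frontier Ω) μHE[2] ∧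
      IntegrableOn (fun y => Poroelastic.kerN22 P k₁ k₂ x y ᵥ*
        Poroelastic.gunterScalar (frontier Ω) ν p y) (frontier Ω) μHE[2] ∧
      IntegrableOn (fun y => p y • Poroelastic.kerN23 P k₁ k₂ ν x y) (frontier Ω) μHE[2] ∧
      DifferentiableWithinAt ℝ (Poroelastic.N22 P k₁ k₂ (frontier Ω)
        (Poroelastic.gunterScalar (frontier Ω) ν p)) (frontier Ω) x ∧
      DifferentiableWithinAt ℝ (Poroelastic.N23 P k₁ k₂ (frontier Ω) ν p) (frontier Ω) x ∧
      Poroelastic.HasN2 P k₁ k₂ (frontier Ω) ν p x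
        (Poroelastic.N21 P k₁ k₂ (frontier Ω) ν p x +
          Poroelastic.gunter (frontier Ω) ν
            (Poroelastic.N22 P k₁ k₂ (frontier Ω)
              (Poroelastic.gunterScalar (frontier Ω) ν p)) x +
          Poroelastic.gunter (frontier Ω) ν
            (Poroelastic.N23 P k₁ k₂ (frontier Ω) ν p) x) := by
  have hS := hΩ.isChartedSurface hν
  exact ⟨⟨hS.isWeaklySingularKernel_kerN21 P k₁ k₂, hS.isWeaklySingularKernel_kerN22 P k₁ k₂,
    hS.isWeaklySingularKernel_kerN23 P k₁ k₂ hne⟩,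
    fun p hp x hx => hS.regularization P k₁ k₂ hP hk hne hp hx⟩
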